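/- Let $n\ge 1$, let $\lambda\in\mathbb R$, and let $\mathfrak g_\kappa$ be the complex Lie algebra with basis $x_1,\dots,x_n$ and brackets $[x_1,x_j]=i\lambda x_j$ for $j>1$, $[x_j,x_k]=0$ for $j,k>1$. Put $U=U(\mathfrak g_\kappa)$. For an algebra automorphism $\sigma$ of $U$ let ${}_\sigma U$ be $U$ with the bimodule structure $a\cdot b\cdot c=\sigma(a)bc$, and let $H_*(U,{}_\sigma U)$ be its Hochschild homology. The twisted Hochschild dimension of $U$ is the largest $d$ such that $H_d(U,{}_\sigma U)\neq 0$ for some automorphism $\sigma$. 1. The twisted Hochschild dimension of $U$ equals $n$. 2. For an automorphism $\sigma$ of $U$ one has $H_n(U,{}_\sigma U)\ne 0$ if and only if there are $a_2,\dots,a_n\in\mathbb N_0$ such that $\sigma(x_1)=x_1+i\mu$ and $\sigma(x_j)=x_j$ for $j>1$, where $\mu=-\lambda(n-1+a_2+\dots+a_n)$. 3. In the case $a_2=\dots=a_n=0$, the automorphism $\sigma(x_1)=x_1-i(n-1)\lambda$, $\sigma(x_j)=x_j$ is the inverse of $\sigma^\omega_i$, where $\sigma^\omega$ is the modular group of the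 weight $\omega$. In detail, name the coordinates of $\mathbb R^n$ as $(x_0,\vec x)$, with $\vec x\in\mathbb R^{n-1}$, so that $x_0,\dots,x_{n-1}$ correspond to the generators $x_1,\dots,x_n$ in this order. Let $\mathcal A$ be the space of Fourier transforms of Schwartz functions on $\mathbb R^n$ with compact support in the first variable, with the product and involution $$(f\star g)(x)=\int e^{ip_0x_0}(\mathcal F_0f)(p_0,\vec x)\,g(x_0,e^{-\lambda p_0}\vec x)\,\frac{dp_0}{2\pi},\qquad f^*(x)=\int e^{ip_0x_0}(\mathcal F_0\overline f)(p_0,e^{-\lambda p_0}\vec x)\,\frac{dp_0}{2\pi},$$ where $(\mathcal F_0f)(p_0,\vec x)=\int e^{-ip_0y}f(y,\vec x)\,dy$, and let $\omega(f)=\int_{\mathbb R^n}f(x)\,d^nx$. Then: * The maps $(\sigma^\omega_tf)(x_0,\vec x)=f(x_0+t(n-1)\lambda,\vec x)$, $t\in\mathbb R$, form a one-parameter group of automorphisms of $(\mathcal A,\star,{}^*)$ that preserves $\omega$. The products $f\star g$ with $f,g\in\mathcal A$ are integrable, and $\omega$ satisfies the KMS condition: for all $f,g\in\mathcal A$ there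 is a bounded continuous function $F$ on $\{0\le\operatorname{Im}z\le1\}$, holomorphic in the interior, with $F(t)=\omega(\sigma^\omega_t(f)\star g)$ and $F(t+i)=\omega(g\star\sigma^\omega_t(f))$ for all $t\in\mathbb R$. * Let $U$ act on Schwartz functions by left star multiplication with the coordinate functions: the generator $x_1$ acts as $f\mapsto x_0f+i\lambda\sum_{k=1}^{n-1}x_k\partial_kf$, and the generator $x_{k+1}$ as $f\mapsto x_kf$ for $1\le k\le n-1$. There is exactly one family $(\sigma^\omega_z)_{z\in\mathbb C}$ of automorphisms of $U$ such that $\sigma^\omega_t(u\star f)=\sigma^\omega_t(u)\star\sigma^\omega_t(f)$ for all $t\in\mathbb R$, $u\in U$, $f\in\mathcal A$, and such that $\sigma^\omega_z(u)$ is a polynomial in $z$ with coefficients in $U$ for every $u\in U$. For this family, $(\sigma^\omega_i)^{-1}$ is the automorphism $x_1\mapsto x_1-i(n-1)\lambda$, $x_j\mapsto x_j$ for $j>1$. -/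

import Mathlib

open scoped TensorProduct SchwartzMap FourierTransform LineDeriv ComplexConjugate

noncomputable section

/-! ### Hochschild homology -/

namespace Hochschild

variable {k A M : Type*} [CommRing k] [Ring A] [Algebra k A] [AddCommGroup M] [Module k M]

/-- The face `x ⊗ a₀ ⊗ ⋯ ⊗ a_m ↦ x a₀ ⊗ a₁ ⊗ ⋯ ⊗ a_m`, where `r a x` stands for `x a`. -/
def firstFace (r : A →ₗ[k] Module.End k M) (m : ℕ) :
    MultilinearMap k (fun _ : Fin (m + 1) => A) (M →ₗ[k] M ⊗[k] (⨂[k]^m A)) :=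
  MultilinearMap.mk'
    (fun a => (TensorProduct.mk k M (⨂[k]^m A)).flip (PiTensorProduct.tprod k (Fin.tail a)) ∘ₗ
      r (a 0))
    (fun a i x y => by
      refine Fin.cases ?_ (fun i => ?_) i
      · simp [Fin.tail_update_zero, LinearMap.comp_add]
      · have h : (0 : Fin (m + 1)) ≠ i.succ := (Fin.succ_ne_zero i).symm
        simp [Fin.tail_update_succ, LinearMap.add_comp, Function.update_of_ne h])
    (fun a i c x => by
      refine Fin.cases ?_ (fun i => ?_) i
      · simp [Fin.tail_update_zero, LinearMap.comp_smul]
      · have h : (0 : Fin (m + 1)) ≠ i.succ := (Fin.succ_ne_zero i).symm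
        simp [Fin.tail_update_succ, LinearMap.smul_comp, Function.update_of_ne h])

/-- The face `x ⊗ a₀ ⊗ ⋯ ⊗ a_m ↦ a_m x ⊗ a₀ ⊗ ⋯ ⊗ a_{m-1}`, where `l a x` stands for `a x`. -/
def lastFace (l : A →ₗ[k] Module.End k M) (m : ℕ) :
    MultilinearMap k (fun _ : Fin (m + 1) => A) (M →ₗ[k] M ⊗[k] (⨂[k]^m A)) :=
  MultilinearMap.mk'
    (fun a => (TensorProduct.mk k M (⨂[k]^m A)).flip (PiTensorProduct.tprod k (Fin.init a)) ∘ₗ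
      l (a (Fin.last m)))
    (fun a i x y => by
      refine Fin.lastCases ?_ (fun i => ?_) i
      · simp [Fin.init_update_last, LinearMap.comp_add]
      · have h : Fin.last m ≠ i.castSucc := (Fin.castSucc_lt_last i).ne'
        simp [Fin.init_update_castSucc, LinearMap.add_comp, Function.update_of_ne h])
    (fun a i c x => by
      refine Fin.lastCases ?_ (fun i => ?_) i
      · simp [Fin.init_update_last, LinearMap.comp_smul]
      · have h : Fin.last m ≠ i.castSucc := (Fin.castSucc_lt_last i).ne'
        simp [Fin.init_update_castSucc, LinearMap.smul_comp, Function.update_of_ne h])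

theorem contractNth_update {m : ℕ} (j : Fin m) (a : Fin (m + 1) → A) (i : Fin (m + 1)) :
    ∃ (p : Fin m) (u v : A), ∀ x : A,
      Fin.contractNth j.castSucc (· * ·) (Function.update a i x) =
        Function.update (Fin.contractNth j.castSucc (· * ·) a) p (u * x * v) := by
  rcases lt_trichotomy (i : ℕ) (j : ℕ) with h | h | h
  · refine ⟨⟨i, by omega⟩, 1, 1, fun x => ?_⟩
    ext q
    simp only [Fin.contractNth, Function.update_apply, Fin.ext_iff, Fin.val_castSucc, Fin.val_succ,
      one_mul, mul_one]
    split_ifs <;> first | rfl | omega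
  · refine ⟨j, 1, a j.succ, fun x => ?_⟩
    ext q
    simp only [Fin.contractNth, Function.update_apply, Fin.ext_iff, Fin.val_castSucc, Fin.val_succ,
      one_mul]
    split_ifs <;> first | rfl | omega | skip
    rename_i h1 h2 h3 h4
    rw [Fin.ext h2]
  · by_cases h' : (i : ℕ) = j + 1
    · refine ⟨j, a j.castSucc, 1, fun x => ?_⟩
      ext q
      simp only [Fin.contractNth, Function.update_apply, Fin.ext_iff, Fin.val_castSucc,
        Fin.val_succ, mul_one]
      split_ifs <;> first | rfl | omega | skip
      rename_i h1 h2 h3 h4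
      rw [Fin.ext h2]
    · refine ⟨⟨i - 1, by omega⟩, 1, 1, fun x => ?_⟩
      ext q
      simp only [Fin.contractNth, Function.update_apply, Fin.ext_iff, Fin.val_castSucc,
        Fin.val_succ, one_mul, mul_one]
      split_ifs <;> first | rfl | omega

/-- The face `x ⊗ a₀ ⊗ ⋯ ⊗ a_m ↦ x ⊗ a₀ ⊗ ⋯ ⊗ a_j a_{j+1} ⊗ ⋯ ⊗ a_m`. -/
def innerFace (k A M : Type*) [CommRing k] [Ring A] [Algebra k A] [AddCommGroup M] [Module k M]
    (m : ℕ) (j : Fin m) :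
    MultilinearMap k (fun _ : Fin (m + 1) => A) (M →ₗ[k] M ⊗[k] (⨂[k]^m A)) :=
  MultilinearMap.mk'
    (fun a => (TensorProduct.mk k M (⨂[k]^m A)).flip
      (PiTensorProduct.tprod k (Fin.contractNth j.castSucc (· * ·) a)))
    (fun a i x y => by
      obtain ⟨p, u, v, h⟩ := contractNth_update j a i
      simp only [h, mul_add, add_mul, MultilinearMap.map_update_add, map_add])
    (fun a i c x => by
      obtain ⟨p, u, v, h⟩ := contractNth_update j a i
      simp only [h, mul_smul_comm, smul_mul_assoc, MultilinearMap.map_update_smul, map_smul])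

/-- The Hochschild differential `M ⊗ A^{⊗(m+1)} → M ⊗ A^{⊗m}` of an algebra `A` with coefficients
in a bimodule `M`, whose actions are `l a x = a x` and `r a x = x a`:
`b(x ⊗ a₀ ⊗ ⋯ ⊗ a_m) = x a₀ ⊗ a₁ ⊗ ⋯ ⊗ a_m + ∑ⱼ (-1)^(j+1) x ⊗ ⋯ ⊗ a_j a_{j+1} ⊗ ⋯
  + (-1)^(m+1) a_m x ⊗ a₀ ⊗ ⋯ ⊗ a_{m-1}`. -/
def differential (l r : A →ₗ[k] Module.End k M) (m : ℕ) :
    M ⊗[k] (⨂[k]^(m + 1) A) →ₗ[k] M ⊗[k] (⨂[k]^m A) :=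
  TensorProduct.lift (PiTensorProduct.lift
    (firstFace r m + ∑ j : Fin m, (-1 : k) ^ ((j : ℕ) + 1) • innerFace k A M m j
      + (-1 : k) ^ (m + 1) • lastFace l m)).flip

/-- The Hochschild cycles of degree `m`. -/
def cycles (l r : A →ₗ[k] Module.End k M) : (m : ℕ) → Submodule k (M ⊗[k] (⨂[k]^m A))
  | 0 => ⊤
  | m + 1 => LinearMap.ker (differential l r m)

/-- The Hochschild homology `H_m(A, M)`: cycles modulo boundaries. -/
abbrev Homology (l r : A →ₗ[k] Module.End k M) (m : ℕ) : Type _ :=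
  cycles l r m ⧸ (LinearMap.range (differential l r m)).submoduleOf (cycles l r m)

/-- The twisted Hochschild homology `H_m(A, _σA)`; the bimodule `_σA` is `A` with
`a · x · c = σ(a) x c`. -/
abbrev TwistedHomology (σ : A ≃ₐ[k] A) (m : ℕ) : Type _ :=
  Homology (M := A) ((LinearMap.mul k A) ∘ₗ σ.toLinearMap) (LinearMap.mul k A).flip m

/-- The largest degree in which `H_*(A, _σA)` is nonzero. -/
def homologicalDim (σ : A ≃ₐ[k] A) : WithBot ℕ∞ :=
  ⨆ (m : ℕ) (_ : Nontrivial (TwistedHomology σ m)), ((m : ℕ∞) : WithBot ℕ∞)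

/-- The twisted Hochschild dimension of `A`: the largest homological dimension of
`H_*(A, _σA)` over all automorphisms `σ` of `A`. -/
def twistedDim (k A : Type*) [CommRing k] [Ring A] [Algebra k A] : WithBot ℕ∞ :=
  ⨆ σ : A ≃ₐ[k] A, homologicalDim σ

end Hochschild

/-! ### The κ-Minkowski Lie algebra and its enveloping algebra -/

namespace Kappa

attribute [local instance] LieRing.ofAssociativeRing

/-- The underlying space `ℂⁿ` of the `n`-dimensional κ-Minkowski Lie algebra. The index `0 : Fin n`
is the time direction, and `lam` is `1 / κ`. -/
def LieAlg (n : ℕ) (_lam : ℝ) : Type := Fin n → ℂ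

variable {n : ℕ} {lam : ℝ}

instance : AddCommGroup (LieAlg n lam) := inferInstanceAs (AddCommGroup (Fin n → ℂ))

instance : Module ℂ (LieAlg n lam) := inferInstanceAs (Module ℂ (Fin n → ℂ))

/-- The `j`-th coordinate of an element of the Lie algebra. -/
def coord (j : Fin n) : LieAlg n lam →ₗ[ℂ] ℂ := LinearMap.proj (φ := fun _ : Fin n => ℂ) j

theorem coord_ext {v w : LieAlg n lam} (h : ∀ j, coord j v = coord j w) : v = w := funext h

/-- The basis vectors of the Lie algebra; `gen 0` is the time generator. -/
def gen (j : Fin n) : LieAlg n lam := Pi.single (M := fun _ => ℂ) j 1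

theorem coord_gen (j l : Fin n) : coord l (gen j : LieAlg n lam) = if l = j then 1 else 0 :=
  Pi.single_apply (M := ℂ) j 1 l

variable [NeZero n]

/-- The bracket `[v, w] = i lam (v₀ w - w₀ v)`, the bilinear one with `[x₀, x_j] = i lam x_j` and
`[x_j, x_k] = 0` for `j, k ≠ 0`. -/
instance : Bracket (LieAlg n lam) (LieAlg n lam) :=
  ⟨fun v w => (Complex.I * lam) • (coord 0 v • w - coord 0 w • v)⟩

theorem coord_lie (v w : LieAlg n lam) (j : Fin n) :
    coord j ⁅v, w⁆ = Complex.I * lam * (coord 0 v * coord j w - coord 0 w * coord j v) := by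
  change coord j ((Complex.I * lam) • (coord 0 v • w - coord 0 w • v)) = _
  simp only [map_smul, map_sub, smul_eq_mul]

instance : LieRing (LieAlg n lam) where
  add_lie u v w := by
    apply coord_ext; intro j; simp only [coord_lie, map_add]; ring
  lie_add u v w := by
    apply coord_ext; intro j; simp only [coord_lie, map_add]; ring
  lie_self u := by
    apply coord_ext; intro j; simp only [coord_lie, map_zero]; ring
  leibniz_lie u v w := by
    apply coord_ext; intro j; simp only [coord_lie, map_add]; ring

instance : LieAlgebra ℂ (LieAlg n lam) where
  lie_smul c v w := by
    apply coord_ext; intro j; simp only [coord_lie, map_smul, smul_eq_mul]; ring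

theorem lie_gen_zero (j : Fin n) (hj : j ≠ 0) :
    ⁅(gen 0 : LieAlg n lam), (gen j : LieAlg n lam)⁆ =
      (Complex.I * lam) • (gen j : LieAlg n lam) := by
  apply coord_ext; intro l
  simp [coord_lie, coord_gen, hj.symm]

theorem lie_gen_gen (j l : Fin n) (hj : j ≠ 0) (hl : l ≠ 0) :
    ⁅(gen j : LieAlg n lam), (gen l : LieAlg n lam)⁆ = 0 := by
  apply coord_ext; intro q
  simp [coord_lie, coord_gen, hj.symm, hl.symm]

variable (n lam)

/-- The enveloping algebra of the κ-Minkowski Lie algebra. -/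
abbrev Env : Type := UniversalEnvelopingAlgebra ℂ (LieAlg n lam)

/-- The generators `x_j` in the enveloping algebra. -/
def X (j : Fin n) : Env n lam := UniversalEnvelopingAlgebra.ι ℂ (gen j)

/-- The linear map `x₀ ↦ x₀ + c`, `x_j ↦ x_j` from the Lie algebra to the enveloping algebra. -/
def shiftLin (c : ℂ) : LieAlg n lam →ₗ[ℂ] Env n lam :=
  (UniversalEnvelopingAlgebra.ι ℂ : LieAlg n lam →ₗ⁅ℂ⁆ Env n lam).toLinearMap +
    (Algebra.linearMap ℂ (Env n lam)) ∘ₗ (c • coord 0)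

theorem shiftLin_apply (c : ℂ) (v : LieAlg n lam) :
    shiftLin n lam c v =
      UniversalEnvelopingAlgebra.ι ℂ v + algebraMap ℂ (Env n lam) (c * coord 0 v) := rfl

theorem shiftLin_lie (c : ℂ) (v w : LieAlg n lam) :
    shiftLin n lam c ⁅v, w⁆ = ⁅shiftLin n lam c v, shiftLin n lam c w⁆ := by
  have h0 : coord 0 ⁅v, w⁆ = 0 := by rw [coord_lie]; ring
  have h1 := Algebra.commutes (c * coord 0 v) (UniversalEnvelopingAlgebra.ι ℂ w : Env n lam)
  have h2 := Algebra.commutes (c * coord 0 w) (UniversalEnvelopingAlgebra.ι ℂ v : Env n lam)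
  have h3 := Algebra.commutes (c * coord 0 v) (algebraMap ℂ (Env n lam) (c * coord 0 w))
  rw [shiftLin_apply, shiftLin_apply, shiftLin_apply, h0, mul_zero, map_zero, add_zero,
    LieHom.map_lie, LieRing.of_associative_ring_bracket, LieRing.of_associative_ring_bracket,
    mul_add, mul_add, add_mul, add_mul, add_mul, add_mul, h1, h2, h3]
  abel

/-- The endomorphism `x₀ ↦ x₀ + c`, `x_j ↦ x_j` for `j ≠ 0`. -/
def shiftHom (c : ℂ) : Env n lam →ₐ[ℂ] Env n lam :=
  UniversalEnvelopingAlgebra.lift ℂ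
    { shiftLin n lam c with map_lie' := fun {v w} => shiftLin_lie n lam c v w }

theorem shiftHom_ι (c : ℂ) (v : LieAlg n lam) :
    shiftHom n lam c (UniversalEnvelopingAlgebra.ι ℂ v) =
      UniversalEnvelopingAlgebra.ι ℂ v + algebraMap ℂ (Env n lam) (c * coord 0 v) :=
  UniversalEnvelopingAlgebra.lift_ι_apply ℂ _ v

theorem shiftHom_comp (c d : ℂ) (h : c + d = 0) :
    (shiftHom n lam c).comp (shiftHom n lam d) = AlgHom.id ℂ (Env n lam) := by
  apply UniversalEnvelopingAlgebra.hom_ext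
  apply LieHom.ext
  intro v
  have h1 : c * coord 0 v + d * coord 0 v = 0 := by rw [← add_mul, h, zero_mul]
  change shiftHom n lam c (shiftHom n lam d (UniversalEnvelopingAlgebra.ι ℂ v)) =
    UniversalEnvelopingAlgebra.ι ℂ v
  rw [shiftHom_ι, map_add, shiftHom_ι, AlgHom.commutes, add_assoc, ← map_add, h1, map_zero,
    add_zero]

/-- The automorphism `σ(x₀) = x₀ + iμ`, `σ(x_j) = x_j` for `j ≠ 0`. -/
def shift (μ : ℂ) : Env n lam ≃ₐ[ℂ] Env n lam :=
  AlgEquiv.ofAlgHom (shiftHom n lam (Complex.I * μ)) (shiftHom n lam (-(Complex.I * μ)))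
    (shiftHom_comp n lam _ _ (by ring)) (shiftHom_comp n lam _ _ (by ring))

theorem shift_X_zero (μ : ℂ) :
    shift n lam μ (X n lam 0) = X n lam 0 + algebraMap ℂ (Env n lam) (Complex.I * μ) := by
  refine (shiftHom_ι n lam (Complex.I * μ) (gen 0)).trans ?_
  rw [coord_gen, if_pos rfl, mul_one, X]

theorem shift_X (μ : ℂ) (j : Fin n) (hj : j ≠ 0) :
    shift n lam μ (X n lam j) = X n lam j := by
  refine (shiftHom_ι n lam (Complex.I * μ) (gen j)).trans ?_
  rw [coord_gen, if_neg hj.symm, mul_zero, map_zero, add_zero, X]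

/-! ### The function algebra of κ-Minkowski space, the weight `ω` and its modular group -/

/-- Space-time `ℝⁿ`. -/
abbrev Space (n : ℕ) : Type := EuclideanSpace ℝ (Fin n)

/-- The Schwartz functions on `ℝⁿ` that are compactly supported in the time variable. -/
def compactTime : Submodule ℂ 𝓢(Space n, ℂ) where
  carrier := {φ | ∃ K : Set ℝ, IsCompact K ∧ ∀ p, φ p ≠ 0 → p 0 ∈ K}
  zero_mem' := ⟨∅, isCompact_empty, fun p hp => (hp rfl).elim⟩
  add_mem' := by
    rintro φ ψ ⟨K, hK, h⟩ ⟨L, hL, h'⟩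
    refine ⟨K ∪ L, hK.union hL, fun p hp => ?_⟩
    by_cases h0 : φ p = 0
    · exact Or.inr (h' p fun h1 => hp (by simp [h0, h1]))
    · exact Or.inl (h p h0)
  smul_mem' := by
    rintro c φ ⟨K, hK, h⟩
    exact ⟨K, hK, fun p hp => h p fun h0 => hp (by simp [h0])⟩

/-- The space `𝒜` of Fourier transforms of the functions in `compactTime`. -/
def alg : Submodule ℂ 𝓢(Space n, ℂ) :=
  (compactTime n).map (FourierTransform.fourierCLM ℂ 𝓢(Space n, ℂ)).toLinearMap

variable {n}

/-- The point with time coordinate `s` and space coordinates `r x_j`. -/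
def point (s r : ℝ) (x : Space n) : Space n :=
  WithLp.toLp 2 fun j => if j = 0 then s else r * x j

/-- The Fourier transform in the time variable, `∫ e^{-ipy} f(y, x_1, …) dy`. -/
def timeFourier (f : Space n → ℂ) (p : ℝ) (x : Space n) : ℂ :=
  ∫ y : ℝ, Complex.exp (-(Complex.I * p * y)) * f (point y 1 x)

/-- The star product
`(f ⋆ g)(x) = (2π)⁻¹ ∫ e^{i p x₀} (𝓕₀ f)(p, x_1, …) g(x₀, e^{-lam p} x_1, …) dp`. -/
def starMul (f g : Space n → ℂ) (x : Space n) : ℂ :=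
  (2 * Real.pi : ℂ)⁻¹ * ∫ p : ℝ, Complex.exp (Complex.I * p * x 0) * timeFourier f p x *
    g (point (x 0) (Real.exp (-(lam * p))) x)

/-- The involution `f^*(x) = (2π)⁻¹ ∫ e^{i p x₀} (𝓕₀ (conj f))(p, e^{-lam p} x_1, …) dp`. -/
def starInv (f : Space n → ℂ) (x : Space n) : ℂ :=
  (2 * Real.pi : ℂ)⁻¹ * ∫ p : ℝ, Complex.exp (Complex.I * p * x 0) *
    timeFourier (fun y => conj (f y)) p (point (x 0) (Real.exp (-(lam * p))) x)

/-- The weight `ω`, the Lebesgue integral. -/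
def weight (f : Space n → ℂ) : ℂ := ∫ x, f x

/-- `S` is a modular group of the weight `ω` on `(𝒜, ⋆, *)`: a one-parameter group of automorphisms
that preserve `ω` and for which `ω` satisfies the KMS condition: for all `f, g ∈ 𝒜` there is a
bounded continuous function `F` on the strip `0 ≤ Im z ≤ 1`, holomorphic inside, with
`F(t) = ω(S_t(f) ⋆ g)` and `F(t + i) = ω(g ⋆ S_t(f))`. -/
structure IsModularGroup (S : ℝ → (Space n → ℂ) →ₗ[ℂ] (Space n → ℂ)) : Prop where
  map_mem : ∀ t, ∀ f ∈ alg n, ∃ g ∈ alg n, S t f = g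
  map_zero : ∀ f ∈ alg n, S 0 f = f
  map_add : ∀ s t, ∀ f ∈ alg n, S (s + t) f = S s (S t f)
  map_mul : ∀ t, ∀ f ∈ alg n, ∀ g ∈ alg n, S t (starMul lam f g) = starMul lam (S t f) (S t g)
  map_inv : ∀ t, ∀ f ∈ alg n, S t (starInv lam f) = starInv lam (S t f)
  invariant : ∀ t, ∀ f ∈ alg n, weight (S t f) = weight f
  integrable : ∀ f ∈ alg n, ∀ g ∈ alg n, MeasureTheory.Integrable (starMul lam f g)
  kms : ∀ f ∈ alg n, ∀ g ∈ alg n, ∃ F : ℂ → ℂ,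
    ContinuousOn F {z | 0 ≤ z.im ∧ z.im ≤ 1} ∧
    DifferentiableOn ℂ F {z | 0 < z.im ∧ z.im < 1} ∧
    (∃ C : ℝ, ∀ z : ℂ, 0 ≤ z.im → z.im ≤ 1 → ‖F z‖ ≤ C) ∧
    (∀ t : ℝ, F t = weight (starMul lam (S t f) g)) ∧
    (∀ t : ℝ, F (t + Complex.I) = weight (starMul lam g (S t f)))

/-- The group `(σ_t f)(x₀, x_1, …) = f(x₀ + t (n - 1) lam, x_1, …)` on functions. -/
def modularGroup (t : ℝ) : (Space n → ℂ) →ₗ[ℂ] (Space n → ℂ) where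
  toFun f x := f (x + (t * (n - 1) * lam) • EuclideanSpace.single 0 1)
  map_add' _ _ := rfl
  map_smul' _ _ := rfl

/-- The same group on Schwartz functions. -/
def modularGroupSchwartz (t : ℝ) : 𝓢(Space n, ℂ) →L[ℂ] 𝓢(Space n, ℂ) :=
  SchwartzMap.compSubConstCLM ℂ (-((t * (n - 1) * lam) • EuclideanSpace.single 0 1))

theorem modularGroupSchwartz_coe (t : ℝ) (f : 𝓢(Space n, ℂ)) :
    (modularGroupSchwartz lam t f : Space n → ℂ) = modularGroup lam t f := by
  funext x
  simp [modularGroupSchwartz, modularGroup]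

variable {lam}

/-- Multiplication by the linear function `∑ v_j x_j`. -/
def mulLin : LieAlg n lam →ₗ[ℂ] Module.End ℂ 𝓢(Space n, ℂ) :=
  ∑ j : Fin n, (coord j).smulRight
    (SchwartzMap.smulLeftCLM ℂ (fun x : Space n => (x j : ℂ))).toLinearMap

/-- The Euler operator `∑_{j ≠ 0} x_j ∂_j` in the space variables. -/
def euler (n : ℕ) [NeZero n] : Module.End ℂ 𝓢(Space n, ℂ) :=
  ∑ j ∈ Finset.univ.erase (0 : Fin n),
    (SchwartzMap.smulLeftCLM ℂ (fun x : Space n => (x j : ℂ)) ∘L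
      LineDeriv.lineDerivOpCLM ℂ 𝓢(Space n, ℂ) (EuclideanSpace.single j (1 : ℝ))).toLinearMap

theorem temperate_coord {n : ℕ} (j : Fin n) :
    (fun x : Space n => (x j : ℂ)).HasTemperateGrowth :=
  (Complex.ofRealCLM ∘L EuclideanSpace.proj j).hasTemperateGrowth

theorem mulLin_apply {n : ℕ} {lam : ℝ} (v : LieAlg n lam) (f : 𝓢(Space n, ℂ)) (x : Space n) :
    mulLin v f x = (∑ j, coord j v * (x j : ℂ)) * f x := by
  simp [mulLin, SchwartzMap.smulLeftCLM_apply_apply (temperate_coord _), Finset.sum_mul, mul_assoc]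

theorem euler_apply (f : 𝓢(Space n, ℂ)) (x : Space n) :
    euler n f x = ∑ j ∈ Finset.univ.erase (0 : Fin n),
      (x j : ℂ) * fderiv ℝ f x (EuclideanSpace.single j (1 : ℝ)) := by
  simp only [euler, LinearMap.sum_apply, sum_apply]
  refine Finset.sum_congr rfl fun j _ => ?_
  simp [SchwartzMap.smulLeftCLM_apply_apply (temperate_coord j),
    SchwartzMap.lineDerivOp_apply_eq_fderiv]

theorem euler_mulLin (v : LieAlg n lam) (f : 𝓢(Space n, ℂ)) (x : Space n) :
    euler n (mulLin v f) x = (∑ j, coord j v * (x j : ℂ)) * euler n f x +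
      (∑ j ∈ Finset.univ.erase (0 : Fin n), coord j v * (x j : ℂ)) * f x := by
  have hf : (mulLin v f : Space n → ℂ) = fun x =>
      (∑ j, coord j v • (Complex.ofRealCLM ∘L EuclideanSpace.proj (𝕜 := ℝ) j)) x * f x := by
    funext y
    simp [mulLin_apply]
  rw [euler_apply, euler_apply, Finset.mul_sum, Finset.sum_mul, ← Finset.sum_add_distrib, hf]
  refine Finset.sum_congr rfl fun j _ => ?_
  rw [fderiv_fun_mul (ContinuousLinearMap.differentiableAt _) f.differentiableAt]
  simp [apply_ite Complex.ofReal]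
  ring

/-- The operators `x_j ⋆` of left star multiplication by the coordinate functions, extended
linearly to the Lie algebra: `x₀ ⋆ f = x₀ f + i lam ∑_{j ≠ 0} x_j ∂_j f` and `x_j ⋆ f = x_j f` for
`j ≠ 0`, which is what the formula for the star product gives when `𝓕₀ x₀ = 2πi δ'` and
`𝓕₀ 1 = 2πδ`. -/
def leftLin : LieAlg n lam →ₗ[ℂ] Module.End ℂ 𝓢(Space n, ℂ) :=
  mulLin + ((Complex.I * lam) • coord 0).smulRight (euler n)

theorem leftLin_apply (v : LieAlg n lam) (f : 𝓢(Space n, ℂ)) (x : Space n) :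
    leftLin v f x = (∑ j, coord j v * (x j : ℂ)) * f x +
      Complex.I * lam * coord 0 v * euler n f x := by
  simp [leftLin, mulLin_apply]

theorem leftLin_lie (v w : LieAlg n lam) : leftLin ⁅v, w⁆ = ⁅leftLin v, leftLin w⁆ := by
  ext f x
  have key : ∀ v w : LieAlg n lam, leftLin v (leftLin w f) x =
      (∑ j, coord j v * (x j : ℂ)) * ((∑ j, coord j w * (x j : ℂ)) * f x +
        Complex.I * lam * coord 0 w * euler n f x) +
      Complex.I * lam * coord 0 v * ((∑ j, coord j w * (x j : ℂ)) * euler n f x +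
        (∑ j ∈ Finset.univ.erase (0 : Fin n), coord j w * (x j : ℂ)) * f x +
        Complex.I * lam * coord 0 w * euler n (euler n f) x) := by
    intro v w
    have h : leftLin w f = mulLin w f + (Complex.I * lam * coord 0 w) • euler n f := by
      simp [leftLin]
    rw [leftLin_apply, leftLin_apply, h, map_add, map_smul]
    simp [euler_mulLin]
  have hs : ∀ v : LieAlg n lam, ∑ j ∈ Finset.univ.erase (0 : Fin n), coord j v * (x j : ℂ) =
      ∑ j, coord j v * (x j : ℂ) - coord 0 v * (x 0 : ℂ) := by
    intro v
    rw [← Finset.add_sum_erase _ _ (Finset.mem_univ (0 : Fin n))]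
    ring
  have hb : ∑ j, coord j ⁅v, w⁆ * (x j : ℂ) = Complex.I * lam *
      (coord 0 v * ∑ j, coord j w * (x j : ℂ) - coord 0 w * ∑ j, coord j v * (x j : ℂ)) := by
    rw [Finset.mul_sum, Finset.mul_sum, ← Finset.sum_sub_distrib, Finset.mul_sum]
    refine Finset.sum_congr rfl fun j _ => ?_
    rw [coord_lie]; ring
  have h0 : coord 0 ⁅v, w⁆ = 0 := by rw [coord_lie]; ring
  have hr : (⁅leftLin v, leftLin w⁆ : Module.End ℂ 𝓢(Space n, ℂ)) f x =
      leftLin v (leftLin w f) x - leftLin w (leftLin v f) x := by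
    rw [LieRing.of_associative_ring_bracket]; rfl
  rw [hr, key, key, leftLin_apply, hb, h0, hs, hs]
  ring

/-- The left action `u ⋆ f` of the enveloping algebra on Schwartz functions. -/
def leftAct : Env n lam →ₐ[ℂ] Module.End ℂ 𝓢(Space n, ℂ) :=
  UniversalEnvelopingAlgebra.lift ℂ
    { (leftLin : LieAlg n lam →ₗ[ℂ] Module.End ℂ 𝓢(Space n, ℂ)) with
      map_lie' := fun {v w} => leftLin_lie v w }

/-- `α` is the extension to the enveloping algebra of the group `σ_t = modularGroup lam t`, together
with its analytic continuation to complex times: `σ_t(u ⋆ f) = α_t(u) ⋆ σ_t(f)` for real `t` and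
`f ∈ 𝒜`, and each `α_z(u)` is a polynomial in `z`, with coefficients in the enveloping algebra. -/
structure IsModularExtension (α : ℂ → Env n lam ≃ₐ[ℂ] Env n lam) : Prop where
  intertwines : ∀ (t : ℝ) (u : Env n lam), ∀ f ∈ alg n,
    modularGroupSchwartz lam t (leftAct u f) = leftAct (α t u) (modularGroupSchwartz lam t f)
  polynomial : ∀ u : Env n lam, ∃ P : Polynomial (Env n lam), ∀ z : ℂ,
    α z u = P.eval (algebraMap ℂ (Env n lam) z)

end Kappa

end

/-! Homology. For a bimodule `M` over `U`, the top Hochschild homology is found by building the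
trivial module out of `U` one generator at a time. For a left `U`-module `W`, the space `W ⊗ M` is a
bimodule with the diagonal left action and the right action on `M`. For `W = U` it is isomorphic to
the free bimodule, whose homology is `M` in degree zero (`exists_isTopHomology_diag`); for `W = ℂ`
it is `M` itself. Between the two lie the quotients of `U` by the left ideals generated by some of
the space generators. Right multiplication by one more generator is injective on such a quotient,
with the next quotient as cokernel, and the long exact sequence raises the top degree by one and
replaces the top homology by the kernel of the induced operator (`IsTopHomology.exists_of_exact`). A
generator `x_j` induces `m ↦ m x_j - x_j m`. Since `x₀` commutes with the `x_j` only up to `i lam`,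
its operator is moved by `i lam` in each of the `n - 1` space steps. After the last step, with `x₀`,
homology vanishes above degree `n`, and in degree `n` it is the space of `m` with `m x_j = σ(x_j) m`
for `j ≠ 0` and `m x₀ - σ(x₀) m = (n - 1) i lam m`.

To solve these equations, elements of `U` are written as polynomials with `x₀` last (`symbol`). The
product of symbols is the commutative one up to translations of `x₀`, which change a polynomial only
in lower `x₀`-degree. Comparing degrees shows that a solution `m ≠ 0` forces `σ` to fix every `x_j`
and to shift `x₀` by a constant; that constant is determined by the space degree of any monomial of
`m` (`eq_of_mul_eq`). Conversely the monomials in the space generators are solutions.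

Modular group. Integrating over time first gives `ω(f ⋆ g) = (2π)⁻¹ ∫ h(p) dp` with `h(p) = ∫ (𝓕₀
f)(p, v) (𝓕₀ g)(-p, e^{-lam p} v) dv`. Exchanging `f` and `g` amounts, after `p ↦ -p` and a dilation
of `ℝ^{n-1}`, to the factor `e^{-(n-1) lam p}` (`density_neg`). A time translation of `f` by `(n -
1) lam t` multiplies `h(p)` by `e^{i (n-1) lam t p}`, which at `t = i` is that factor. As `h` has
bounded support, the integral is entire in `t`: this is the KMS condition.

On `U` the translations act by shifts of `x₀`, polynomially in `t`. The extension is unique for real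
times because `U` acts faithfully on `𝒜` (`eq_zero_of_leftAct`), and for complex times because a
polynomial is determined by its values at the reals. -/

noncomputable section

/-! ### The Hochschild complex: functoriality, the contracting homotopy, `b² = 0` -/

namespace Hochschild

section Basic

variable {k A M N : Type*} [CommRing k] [Ring A] [Algebra k A] [AddCommGroup M] [Module k M]
  [AddCommGroup N] [Module k N]

/-- The maps `l a x = a x` and `r a x = x a` make `M` a bimodule. -/
structure IsBimodule (l r : A →ₗ[k] Module.End k M) : Prop where
  left_one : ∀ x, l 1 x = x
  left_mul : ∀ a b x, l (a * b) x = l a (l b x)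
  right_mul : ∀ a b x, r (a * b) x = r b (r a x)
  comm : ∀ a b x, l a (r b x) = r b (l a x)

/-- `f` is a homomorphism of bimodules. -/
structure IsBimoduleHom (l r : A →ₗ[k] Module.End k M) (l' r' : A →ₗ[k] Module.End k N)
    (f : M →ₗ[k] N) : Prop where
  left : ∀ a x, f (l a x) = l' a (f x)
  right : ∀ a x, f (r a x) = r' a (f x)

theorem differential_tmul (l r : A →ₗ[k] Module.End k M) (m : ℕ) (x : M) (a : Fin (m + 1) → A) :
    differential l r m (x ⊗ₜ PiTensorProduct.tprod k a) =
      r (a 0) x ⊗ₜ PiTensorProduct.tprod k (Fin.tail a) +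
      ∑ j : Fin m, (-1 : k) ^ ((j : ℕ) + 1) •
        (x ⊗ₜ[k] PiTensorProduct.tprod k (Fin.contractNth j.castSucc (· * ·) a)) +
      (-1 : k) ^ (m + 1) • (l (a (Fin.last m)) x ⊗ₜ PiTensorProduct.tprod k (Fin.init a)) := by
  simp [differential, firstFace, innerFace, lastFace]

theorem hom_ext_tprod {L : Type*} [AddCommMonoid L] [Module k L] {m : ℕ}
    {f g : M ⊗[k] (⨂[k]^m A) →ₗ[k] L}
    (h : ∀ x a, f (x ⊗ₜ PiTensorProduct.tprod k a) = g (x ⊗ₜ PiTensorProduct.tprod k a)) :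
    f = g := by
  refine TensorProduct.ext (LinearMap.ext fun x => PiTensorProduct.ext (MultilinearMap.ext fun a => ?_))
  exact h x a

theorem differential_rTensor {l r : A →ₗ[k] Module.End k M} {l' r' : A →ₗ[k] Module.End k N}
    {f : M →ₗ[k] N} (hf : IsBimoduleHom l r l' r' f) (m : ℕ) (z : M ⊗[k] (⨂[k]^(m + 1) A)) :
    differential l' r' m (f.rTensor _ z) = f.rTensor _ (differential l r m z) := by
  refine LinearMap.congr_fun (f := differential l' r' m ∘ₗ f.rTensor _)
    (g := f.rTensor _ ∘ₗ differential l r m) (hom_ext_tprod fun x a => ?_) z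
  simp [differential_tmul, hf.left, hf.right]

theorem tail_snoc {A : Type*} {m : ℕ} (a : Fin (m + 1) → A) (c : A) :
    Fin.tail (Fin.snoc (α := fun _ => A) a c) = Fin.snoc (α := fun _ => A) (Fin.tail a) c := by
  ext i
  simp only [Fin.tail, Fin.snoc, Fin.val_succ, Fin.castLT, cast_eq]
  split_ifs <;> first | rfl | omega

theorem contractNth_castSucc_snoc {m : ℕ} (a : Fin (m + 1) → A) (c : A) (j : Fin m) :
    Fin.contractNth j.castSucc.castSucc (· * ·) (Fin.snoc (α := fun _ => A) a c) =
      Fin.snoc (α := fun _ => A) (Fin.contractNth j.castSucc (· * ·) a) c := by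
  ext i
  simp only [Fin.contractNth, Fin.snoc, Fin.val_castSucc, Fin.castLT, Fin.val_succ, cast_eq]
  split_ifs <;> first | rfl | omega

theorem contractNth_last_snoc {m : ℕ} (a : Fin (m + 1) → A) (c : A) :
    Fin.contractNth (Fin.last m).castSucc (· * ·) (Fin.snoc (α := fun _ => A) a c) =
      Fin.snoc (α := fun _ => A) (Fin.init a) (a (Fin.last m) * c) := by
  ext i
  simp only [Fin.contractNth, Fin.snoc, Fin.val_castSucc, Fin.castLT, Fin.val_succ, cast_eq,
    Fin.val_last, Fin.init]
  split_ifs <;> first | rfl | omega | skip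
  rename_i h1 h2 h3 h4
  rw [show (⟨(i : ℕ), h3⟩ : Fin (m + 1)) = Fin.last m from Fin.ext h2]

variable (k A) in
/-- Appending a factor, `a₀ ⊗ ⋯ ⊗ a_{m-1} ↦ a₀ ⊗ ⋯ ⊗ a_{m-1} ⊗ c`. -/
def snocTensor (m : ℕ) : A →ₗ[k] (⨂[k]^m A) →ₗ[k] (⨂[k]^(m + 1) A) :=
  ((TensorProduct.mk k (⨂[k]^m A) (⨂[k]^1 A)).flip.compr₂ TensorPower.mulEquiv.toLinearMap) ∘ₗ
    (PiTensorProduct.subsingletonEquiv (R := k) (s := fun _ : Fin 1 => A) 0).symm.toLinearMap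

theorem snocTensor_tprod (m : ℕ) (c : A) (a : Fin m → A) :
    snocTensor k A m c (PiTensorProduct.tprod k a) =
      PiTensorProduct.tprod k (Fin.snoc (α := fun _ => A) a c) := by
  have h : (PiTensorProduct.subsingletonEquiv (R := k) (s := fun _ : Fin 1 => A) 0).symm c =
      PiTensorProduct.tprod k fun _ : Fin 1 => c := by
    rw [LinearEquiv.symm_apply_eq]; simp
  have := TensorPower.tprod_mul_tprod k a (fun _ : Fin 1 => c)
  rw [Fin.append_right_eq_snoc] at this
  rw [← this]
  simp only [snocTensor, LinearMap.comp_apply, LinearMap.compr₂_apply, LinearMap.flip_apply,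
    TensorProduct.mk_apply, LinearEquiv.coe_coe, h]
  rfl

/-! The bimodule `A ⊗ V`, with the left action on `A` and the right action on `V`. -/

variable (k A M) in
/-- The left action on `A ⊗ V`. -/
def freeLeft : A →ₗ[k] Module.End k (A ⊗[k] M) := LinearMap.rTensorHom M ∘ₗ LinearMap.mul k A

variable (A) in
/-- The right action on `A ⊗ V`. -/
def tensorRight (W : Type*) [AddCommGroup W] [Module k W] (r : A →ₗ[k] Module.End k M) :
    A →ₗ[k] Module.End k (W ⊗[k] M) := LinearMap.lTensorHom W ∘ₗ r

@[simp] theorem freeLeft_tmul (a c : A) (v : M) :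
    freeLeft k A M a (c ⊗ₜ v) = (a * c) ⊗ₜ v := rfl

@[simp] theorem tensorRight_tmul {W : Type*} [AddCommGroup W] [Module k W]
    (r : A →ₗ[k] Module.End k M) (a : A) (w : W) (v : M) :
    tensorRight A W r a (w ⊗ₜ v) = w ⊗ₜ r a v := rfl

/-- The contracting homotopy `(c ⊗ v) ⊗ a ↦ (1 ⊗ v) ⊗ a ⊗ c`. -/
def homotopy (k A M : Type*) [CommRing k] [Ring A] [Algebra k A] [AddCommGroup M] [Module k M]
    (m : ℕ) : (A ⊗[k] M) ⊗[k] (⨂[k]^m A) →ₗ[k] (A ⊗[k] M) ⊗[k] (⨂[k]^(m + 1) A) :=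
  TensorProduct.lift (TensorProduct.lift (LinearMap.mk₂ k
    (fun c v => TensorProduct.mk k (A ⊗[k] M) (⨂[k]^(m + 1) A) (1 ⊗ₜ v) ∘ₗ snocTensor k A m c)
    (fun c c' v => by simp [LinearMap.comp_add]) (fun t c v => by simp [LinearMap.comp_smul])
    (fun c v v' => by simp [TensorProduct.tmul_add, LinearMap.add_comp])
    (fun t c v => by simp [LinearMap.smul_comp])))

theorem homotopy_tmul (m : ℕ) (c : A) (v : M) (a : Fin m → A) :
    homotopy k A M m ((c ⊗ₜ v) ⊗ₜ PiTensorProduct.tprod k a) =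
      (1 ⊗ₜ v) ⊗ₜ PiTensorProduct.tprod k (Fin.snoc (α := fun _ => A) a c) := by
  simp [homotopy, snocTensor_tprod]

theorem hom_ext_tmul_tprod {L : Type*} [AddCommMonoid L] [Module k L] {m : ℕ}
    {f g : (A ⊗[k] M) ⊗[k] (⨂[k]^m A) →ₗ[k] L}
    (h : ∀ c v a, f ((c ⊗ₜ v) ⊗ₜ PiTensorProduct.tprod k a) =
      g ((c ⊗ₜ v) ⊗ₜ PiTensorProduct.tprod k a)) : f = g := by
  refine hom_ext_tprod fun x a => ?_
  refine LinearMap.congr_fun (f := f ∘ₗ (TensorProduct.mk k _ _).flip (PiTensorProduct.tprod k a))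
    (g := g ∘ₗ (TensorProduct.mk k _ _).flip (PiTensorProduct.tprod k a))
    (TensorProduct.ext' fun c v => h c v a) x

/-- Appending `c` commutes with all faces that do not touch it. The inner face multiplying the last
factor `a_m` by `c` reproduces the last face of the original tensor, where `a_m` acts on `c` from
the left; the new last face returns `c` to the coefficient and contributes `± z`. -/
theorem differential_homotopy (r : A →ₗ[k] Module.End k M) (m : ℕ)
    (z : (A ⊗[k] M) ⊗[k] (⨂[k]^(m + 1) A)) :
    differential (freeLeft k A M) (tensorRight A A r) (m + 1) (homotopy k A M (m + 1) z) =
      homotopy k A M m (differential (freeLeft k A M) (tensorRight A A r) m z) +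
        (-1 : k) ^ m • z := by
  refine LinearMap.congr_fun
    (f := differential (freeLeft k A M) (tensorRight A A r) (m + 1) ∘ₗ homotopy k A M (m + 1))
    (g := homotopy k A M m ∘ₗ differential (freeLeft k A M) (tensorRight A A r) m +
      (-1 : k) ^ m • LinearMap.id) (hom_ext_tmul_tprod (m := m + 1) fun c v a => ?_) z
  have h0 : (Fin.snoc (α := fun _ => A) a c : Fin (m + 2) → A) 0 = a 0 :=
    Fin.snoc_castSucc (α := fun _ => A) c a 0
  simp only [LinearMap.comp_apply, LinearMap.add_apply, LinearMap.smul_apply, LinearMap.id_apply,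
    homotopy_tmul, differential_tmul, map_add, map_sum, map_smul, freeLeft_tmul,
    tensorRight_tmul, tail_snoc, Fin.snoc_last, Fin.init_snoc, mul_one, Fin.sum_univ_castSucc,
    contractNth_castSucc_snoc, contractNth_last_snoc, Fin.val_castSucc, Fin.val_last, h0]
  rw [pow_add _ m 2, neg_one_sq, mul_one]
  simp only [add_assoc]

theorem neg_one_smul_of_add_eq_zero {L : Type*} [AddCommGroup L] [Module k L] {x z : L}
    (h : x + z = 0) : (-1 : k) • x = z := by
  rw [neg_smul, one_smul, neg_eq_iff_add_eq_zero, h]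

theorem neg_one_smul_add_self {L : Type*} [AddCommGroup L] [Module k L] (z : L) :
    (-1 : k) • z + z = 0 := by
  rw [neg_smul, one_smul, neg_add_cancel]

/-- In degree zero the first face survives: the homotopy contracts the complex onto the copy `1 ⊗ M`
of `M`, by `c ⊗ v ↦ 1 ⊗ v c`. -/
theorem differential_homotopy_zero (r : A →ₗ[k] Module.End k M) (c : A) (v : M)
    (a : Fin 0 → A) :
    differential (freeLeft k A M) (tensorRight A A r) 0
      (homotopy k A M 0 ((c ⊗ₜ v) ⊗ₜ PiTensorProduct.tprod k a)) +
        (c ⊗ₜ v) ⊗ₜ PiTensorProduct.tprod k a = (1 ⊗ₜ r c v) ⊗ₜ PiTensorProduct.tprod k a := by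
  rw [homotopy_tmul, differential_tmul]
  have h1 : (Fin.snoc (α := fun _ => A) a c : Fin 1 → A) 0 = c := by simp [Fin.snoc]
  have h2 : (Fin.snoc (α := fun _ => A) a c : Fin 1 → A) (Fin.last 0) = c := h1
  rw [h1, h2, Subsingleton.elim (Fin.tail (Fin.snoc (α := fun _ => A) a c)) a, Fin.init_snoc]
  simp only [Finset.univ_eq_empty, Finset.sum_empty, add_zero, zero_add, pow_one, tensorRight_tmul,
    freeLeft_tmul, mul_one, add_assoc]
  refine (congrArg _ (neg_one_smul_add_self (k := k)
    ((c ⊗ₜ[k] v) ⊗ₜ[k] PiTensorProduct.tprod k a : (A ⊗[k] M) ⊗[k] (⨂[k]^0 A)))).trans ?_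
  exact add_zero _

/-- These endomorphisms move a coefficient `1 ⊗ v` to an arbitrary `c ⊗ v`, so identities of
bimodule maps need only be checked on the range of the homotopy. -/
theorem rTensor_mulRight_isBimoduleHom (r : A →ₗ[k] Module.End k M) (d : A) :
    IsBimoduleHom (freeLeft k A M) (tensorRight A A r) (freeLeft k A M) (tensorRight A A r)
      ((LinearMap.mulRight k d).rTensor M) where
  left a x := by
    refine LinearMap.congr_fun (f := (LinearMap.mulRight k d).rTensor M ∘ₗ freeLeft k A M a)
      (g := freeLeft k A M a ∘ₗ (LinearMap.mulRight k d).rTensor M)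
      (TensorProduct.ext' fun c v => ?_) x
    simp [mul_assoc]
  right a x := by
    refine LinearMap.congr_fun (f := (LinearMap.mulRight k d).rTensor M ∘ₗ tensorRight A A r a)
      (g := tensorRight A A r a ∘ₗ (LinearMap.mulRight k d).rTensor M)
      (TensorProduct.ext' fun c v => ?_) x
    simp

theorem differential_zero_differential_one {l r : A →ₗ[k] Module.End k M} (h : IsBimodule l r)
    (z : M ⊗[k] (⨂[k]^2 A)) : differential l r 0 (differential l r 1 z) = 0 := by
  suffices h : differential l r 0 ∘ₗ differential l r 1 = 0 from LinearMap.congr_fun h z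
  refine hom_ext_tprod fun x a => ?_
  have h0 : Fin.tail a 0 = a 1 := rfl
  have h1 : Fin.init a 0 = a 0 := rfl
  have h2 : Fin.contractNth 0 (· * ·) a 0 = a 0 * a 1 := rfl
  have h3 : Fin.init (Fin.tail a) = Fin.tail (Fin.init a) := Subsingleton.elim _ _
  have h4 : Fin.tail (Fin.contractNth 0 (· * ·) a) = Fin.tail (Fin.init a) :=
    Subsingleton.elim _ _
  have h5 : Fin.init (Fin.contractNth 0 (· * ·) a) = Fin.tail (Fin.init a) :=
    Subsingleton.elim _ _
  have h6 : Fin.tail (Fin.tail a) = Fin.tail (Fin.init a) := Subsingleton.elim _ _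
  have h7 : Fin.init (Fin.init a) = Fin.tail (Fin.init a) := Subsingleton.elim _ _
  simp [differential_tmul, h.right_mul, h.left_mul, h.comm, h0, h1, h2, h3, h4, h5, h6, h7]
  abel

theorem freeLeft_isBimodule (r : A →ₗ[k] Module.End k M)
    (hr : ∀ a b x, r (a * b) x = r b (r a x)) :
    IsBimodule (freeLeft k A M) (tensorRight A A r) where
  left_one x := LinearMap.congr_fun (f := freeLeft k A M 1) (g := LinearMap.id)
    (TensorProduct.ext' fun c v => by simp) x
  left_mul a b x := LinearMap.congr_fun (f := freeLeft k A M (a * b))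
    (g := freeLeft k A M a ∘ₗ freeLeft k A M b)
    (TensorProduct.ext' fun c v => by simp [mul_assoc]) x
  right_mul a b x := LinearMap.congr_fun (f := tensorRight A A r (a * b))
    (g := tensorRight A A r b ∘ₗ tensorRight A A r a)
    (TensorProduct.ext' fun c v => by simp [hr]) x
  comm a b x := LinearMap.congr_fun (f := freeLeft k A M a ∘ₗ tensorRight A A r b)
    (g := tensorRight A A r b ∘ₗ freeLeft k A M a)
    (TensorProduct.ext' fun c v => by simp) x

/-- On free bimodules `b² = 0` follows by induction on the degree from the homotopy formula, which
avoids the bookkeeping of pairs of faces. Only the lowest degree is computed by hand. -/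
theorem differential_differential_free (r : A →ₗ[k] Module.End k M)
    (hr : ∀ a b x, r (a * b) x = r b (r a x)) (m : ℕ)
    (z : (A ⊗[k] M) ⊗[k] (⨂[k]^(m + 2) A)) :
    differential (freeLeft k A M) (tensorRight A A r) m
      (differential (freeLeft k A M) (tensorRight A A r) (m + 1) z) = 0 := by
  induction m with
  | zero =>
    exact differential_zero_differential_one (freeLeft_isBimodule r hr) z
  | succ m ih =>
    suffices h : differential (freeLeft k A M) (tensorRight A A r) (m + 1) ∘ₗ
        differential (freeLeft k A M) (tensorRight A A r) (m + 2) = 0 from LinearMap.congr_fun h z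
    -- On the range of the homotopy `h`, the relation `b h = h b ± 1` is used in two consecutive
    -- degrees. Its signs are opposite, so the two terms `± b w` cancel, and the rest is `h b² w`,
    -- zero by induction.
    have hs : ∀ w, differential (freeLeft k A M) (tensorRight A A r) (m + 1)
        (differential (freeLeft k A M) (tensorRight A A r) (m + 2)
          (homotopy k A M (m + 2) w)) = 0 := by
      intro w
      rw [differential_homotopy, map_add, differential_homotopy, ih, map_zero, zero_add, map_smul,
        ← add_smul, pow_succ]
      simp
    refine hom_ext_tmul_tprod (m := m + 3) fun c v a => ?_
    -- Every pure tensor is the image, under right multiplication by `c` on the coefficients, of a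
    -- tensor in the range of `h`.
    have h1 : ((c ⊗ₜ[k] v) ⊗ₜ[k] PiTensorProduct.tprod k a : (A ⊗[k] M) ⊗[k] (⨂[k]^(m + 3) A)) =
        ((LinearMap.mulRight k c).rTensor M).rTensor _ (homotopy k A M (m + 2)
          ((a (Fin.last _) ⊗ₜ v) ⊗ₜ PiTensorProduct.tprod k (Fin.init a))) := by
      rw [homotopy_tmul, Fin.snoc_init_self]
      simp
    rw [h1, LinearMap.comp_apply, differential_rTensor (rTensor_mulRight_isBimoduleHom r c),
      differential_rTensor (rTensor_mulRight_isBimoduleHom r c), hs]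
    simp

/-- The action map `A ⊗ M → M`, with `A` acting on the left factor and `M` carrying the right
action, is a surjective bimodule homomorphism, so `b² = 0` descends from the free bimodule. -/
theorem differential_differential {l r : A →ₗ[k] Module.End k M} (h : IsBimodule l r) (m : ℕ)
    (z : M ⊗[k] (⨂[k]^(m + 2) A)) :
    differential l r m (differential l r (m + 1) z) = 0 := by
  have hf : IsBimoduleHom (freeLeft k A M) (tensorRight A A r) l r (TensorProduct.lift l) := by
    constructor
    · intro a x
      refine LinearMap.congr_fun (f := TensorProduct.lift l ∘ₗ freeLeft k A M a)
        (g := l a ∘ₗ TensorProduct.lift l) (TensorProduct.ext' fun c v => ?_) x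
      simp [h.left_mul]
    · intro a x
      refine LinearMap.congr_fun (f := TensorProduct.lift l ∘ₗ tensorRight A A r a)
        (g := r a ∘ₗ TensorProduct.lift l) (TensorProduct.ext' fun c v => ?_) x
      simp [h.comm]
  suffices h' : differential l r m ∘ₗ differential l r (m + 1) = 0 from LinearMap.congr_fun h' z
  refine hom_ext_tprod fun x a => ?_
  have h1 : (x ⊗ₜ[k] PiTensorProduct.tprod k a : M ⊗[k] (⨂[k]^(m + 2) A)) =
      (TensorProduct.lift l).rTensor _ ((1 ⊗ₜ x) ⊗ₜ PiTensorProduct.tprod k a) := by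
    simp [h.left_one]
  rw [h1, LinearMap.comp_apply, differential_rTensor hf, differential_rTensor hf,
    differential_differential_free r h.right_mul, map_zero, LinearMap.zero_apply]

end Basic

end Hochschild

end

noncomputable section

/-! ### The top Hochschild homology along short exact sequences -/

namespace Hochschild

section TopHomology

variable {k A M N P : Type*} [Field k] [Ring A] [Algebra k A] [AddCommGroup M] [Module k M]
  [AddCommGroup N] [Module k N] [AddCommGroup P] [Module k P]

theorem rTensor_mem_cycles {l r : A →ₗ[k] Module.End k M} {l' r' : A →ₗ[k] Module.End k N}
    {f : M →ₗ[k] N} (hf : IsBimoduleHom l r l' r' f) {m : ℕ} {z : M ⊗[k] (⨂[k]^m A)}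
    (hz : z ∈ cycles l r m) : f.rTensor _ z ∈ cycles l' r' m := by
  cases m with
  | zero => exact Submodule.mem_top
  | succ m =>
    have h : differential l r m z = 0 := hz
    change differential l' r' m _ = 0
    rw [differential_rTensor hf, h, map_zero]

/-- Over a field, tensoring with a power of `A` preserves injectivity. -/
theorem mem_cycles_of_rTensor {l r : A →ₗ[k] Module.End k M} {l' r' : A →ₗ[k] Module.End k N}
    {f : M →ₗ[k] N} (hf : IsBimoduleHom l r l' r' f) (hi : Function.Injective f) {m : ℕ}
    {z : M ⊗[k] (⨂[k]^m A)} (hz : f.rTensor _ z ∈ cycles l' r' m) : z ∈ cycles l r m := by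
  cases m with
  | zero => exact Submodule.mem_top
  | succ m =>
    have h : differential l' r' m (f.rTensor _ z) = 0 := hz
    change differential l r m z = 0
    rw [differential_rTensor hf] at h
    exact Module.Flat.rTensor_preserves_injective_linearMap f hi (by rw [h, map_zero])

theorem differential_mem_cycles {l r : A →ₗ[k] Module.End k M} (h : IsBimodule l r) (m : ℕ)
    (z : M ⊗[k] (⨂[k]^(m + 1) A)) : differential l r m z ∈ cycles l r m := by
  cases m with
  | zero => exact Submodule.mem_top
  | succ m => exact differential_differential h m z

/-- The Hochschild homology with coefficients in `M` vanishes above the degree `d`, and `φ` induces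
an isomorphism of the homology in degree `d` with the subspace `R` of `P`. -/
structure IsTopHomology (l r : A →ₗ[k] Module.End k M) (d : ℕ) (R : Submodule k P)
    (φ : M ⊗[k] (⨂[k]^d A) →ₗ[k] P) : Prop where
  vanishing : ∀ m, d < m → cycles l r m ≤ LinearMap.range (differential l r m)
  ker : ∀ z ∈ cycles l r d, φ z = 0 ↔ z ∈ LinearMap.range (differential l r d)
  range : ∀ p, p ∈ R ↔ ∃ z ∈ cycles l r d, φ z = p

theorem IsTopHomology.subsingleton_of_lt {l r : A →ₗ[k] Module.End k M} {d : ℕ}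
    {R : Submodule k P} {φ : M ⊗[k] (⨂[k]^d A) →ₗ[k] P} (h : IsTopHomology l r d R φ) {m : ℕ}
    (hm : d < m) : Subsingleton (Homology l r m) := by
  rw [Submodule.Quotient.subsingleton_iff, eq_top_iff]
  rintro ⟨z, hz⟩ -
  exact h.vanishing m hm hz

theorem IsTopHomology.nontrivial_iff {l r : A →ₗ[k] Module.End k M} {d : ℕ}
    {R : Submodule k P} {φ : M ⊗[k] (⨂[k]^d A) →ₗ[k] P} (h : IsTopHomology l r d R φ) :
    Nontrivial (Homology l r d) ↔ ∃ p ∈ R, p ≠ 0 := by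
  rw [← not_subsingleton_iff_nontrivial, Submodule.Quotient.subsingleton_iff, eq_top_iff]
  constructor
  · intro hn
    by_contra! hc
    refine hn ?_
    rintro ⟨z, hz⟩ -
    exact (h.ker z hz).1 (hc _ ((h.range _).2 ⟨z, hz, rfl⟩))
  · rintro ⟨p, hp, hp0⟩ hn
    obtain ⟨z, hz, rfl⟩ := (h.range p).1 hp
    exact hp0 ((h.ker z hz).2 (hn (x := ⟨z, hz⟩) trivial))

/-- Transport along an isomorphism of bimodules. -/
theorem IsTopHomology.congr {l r : A →ₗ[k] Module.End k M} {l' r' : A →ₗ[k] Module.End k N}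
    {d : ℕ} {R : Submodule k P} {φ : M ⊗[k] (⨂[k]^d A) →ₗ[k] P} (h : IsTopHomology l r d R φ)
    (e : N ≃ₗ[k] M) (he : IsBimoduleHom l' r' l r e.toLinearMap)
    (he' : IsBimoduleHom l r l' r' e.symm.toLinearMap) :
    IsTopHomology l' r' d R (φ ∘ₗ e.toLinearMap.rTensor _) := by
  have h1 : ∀ {m : ℕ} (z : N ⊗[k] (⨂[k]^m A)),
      e.symm.toLinearMap.rTensor _ (e.toLinearMap.rTensor _ z) = z := by
    intro m z
    rw [← LinearMap.rTensor_comp_apply]; simp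
  have h2 : ∀ {m : ℕ} (z : M ⊗[k] (⨂[k]^m A)),
      e.toLinearMap.rTensor _ (e.symm.toLinearMap.rTensor _ z) = z := by
    intro m z
    rw [← LinearMap.rTensor_comp_apply]; simp
  have h3 : ∀ {m : ℕ} (z : N ⊗[k] (⨂[k]^m A)), e.toLinearMap.rTensor _ z ∈
      LinearMap.range (differential l r m) → z ∈ LinearMap.range (differential l' r' m) := by
    rintro m z ⟨w, hw⟩
    exact ⟨e.symm.toLinearMap.rTensor _ w, by rw [differential_rTensor he', hw, h1]⟩
  refine ⟨fun m hm z hz => h3 z (h.vanishing m hm (rTensor_mem_cycles he hz)), fun z hz => ?_,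
    fun p => ?_⟩
  · rw [LinearMap.comp_apply, h.ker _ (rTensor_mem_cycles he hz)]
    refine ⟨h3 z, ?_⟩
    rintro ⟨w, rfl⟩
    exact ⟨_, differential_rTensor he _ w⟩
  · rw [h.range]
    constructor
    · rintro ⟨z, hz, rfl⟩
      exact ⟨_, rTensor_mem_cycles he' hz, by rw [LinearMap.comp_apply, h2]⟩
    · rintro ⟨z, hz, rfl⟩
      exact ⟨_, rTensor_mem_cycles he hz, rfl⟩

/-- The top homology of the cokernel `N` of an injective bimodule endomorphism `θ` of `M` is the
kernel of `θ` on the top homology of `M`. An endomorphism `Θ'` of `N` that lifts to `Θ` with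
`Θ θ = θ Θ₀` acts on it as `Θ₀` does. -/
theorem IsTopHomology.exists_of_exact {l r : A →ₗ[k] Module.End k M}
    {l' r' : A →ₗ[k] Module.End k N} (hM : IsBimodule l r)
    {d : ℕ} {R : Submodule k P} {φ : M ⊗[k] (⨂[k]^d A) →ₗ[k] P} (h : IsTopHomology l r d R φ)
    {θ : M →ₗ[k] M} {π : M →ₗ[k] N} (hθ : IsBimoduleHom l r l r θ) (hπ : IsBimoduleHom l r l' r' π)
    (hinj : Function.Injective θ) (hsurj : Function.Surjective π) (hex : Function.Exact θ π)
    {D : P →ₗ[k] P} (hD : ∀ z ∈ cycles l r d, φ (θ.rTensor _ z) = D (φ z)) :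
    ∃ φ' : N ⊗[k] (⨂[k]^(d + 1) A) →ₗ[k] P,
      IsTopHomology l' r' (d + 1) (R ⊓ LinearMap.ker D) φ' ∧
      ∀ (Θ Θ₀ : M →ₗ[k] M) (Θ' : N →ₗ[k] N) (D₀ : P →ₗ[k] P), IsBimoduleHom l r l r Θ →
        (∀ x, Θ (θ x) = θ (Θ₀ x)) → (∀ x, π (Θ x) = Θ' (π x)) →
        (∀ z ∈ cycles l r d, φ (Θ₀.rTensor _ z) = D₀ (φ z)) →
        ∀ z ∈ cycles l' r' (d + 1), φ' (Θ'.rTensor _ z) = D₀ (φ' z) := by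
  have hinj' : ∀ m, Function.Injective (θ.rTensor (⨂[k]^m A)) := fun m =>
    Module.Flat.rTensor_preserves_injective_linearMap θ hinj
  have hsurj' : ∀ m, Function.Surjective (π.rTensor (⨂[k]^m A)) := fun m =>
    LinearMap.rTensor_surjective _ hsurj
  have hex' : ∀ m, Function.Exact (θ.rTensor (⨂[k]^m A)) (π.rTensor (⨂[k]^m A)) := fun m =>
    rTensor_exact _ hex hsurj
  -- a cycle of `N` lifts to `w`, and the boundary of `w` is `θ v`
  have lift : ∀ m, ∀ z ∈ cycles l' r' (m + 1), ∀ w, π.rTensor _ w = z →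
      ∃ v ∈ cycles l r m, θ.rTensor _ v = differential l r m w := by
    rintro m z hz w rfl
    have hz' : differential l' r' m (π.rTensor _ w) = 0 := hz
    rw [differential_rTensor hπ] at hz'
    obtain ⟨v, hv⟩ := (hex' m _).1 hz'
    exact ⟨v, mem_cycles_of_rTensor hθ hinj (hv ▸ differential_mem_cycles hM m w), hv⟩
  -- Over a field the chain-level surjection and injection split linearly. This gives the connecting
  -- map `z ↦ θ⁻¹ b(π⁻¹ z)` as a linear map on all chains of `N`; outside the cycles its value
  -- depends on the splittings and is never used.
  obtain ⟨sec, hsec⟩ := LinearMap.exists_rightInverse_of_surjective _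
    (LinearMap.range_eq_top.2 (hsurj' (d + 1)))
  obtain ⟨ret, hret⟩ := LinearMap.exists_leftInverse_of_injective _
    (LinearMap.ker_eq_bot.2 (hinj' d))
  have hret' : ∀ v, ret (θ.rTensor _ v) = v := LinearMap.congr_fun hret
  have hsec' : ∀ z, π.rTensor _ (sec z) = z := LinearMap.congr_fun hsec
  -- On cycles the connecting map is independent of the lift: another lift differs from `w` by some
  -- `θ u`, which changes `v` by the boundary `b u`, and `φ` kills boundaries.
  have key : ∀ w, ∀ v ∈ cycles l r d, θ.rTensor _ v = differential l r d w →
      (φ ∘ₗ ret ∘ₗ differential l r d ∘ₗ sec) (π.rTensor _ w) = φ v := by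
    intro w v hv hvw
    have h0 : π.rTensor _ (sec (π.rTensor _ w) - w) = 0 := by rw [map_sub, hsec', sub_self]
    obtain ⟨u, hu⟩ := (hex' _ _).1 h0
    have h1 : differential l r d (sec (π.rTensor _ w)) =
        θ.rTensor _ (v + differential l r d u) := by
      rw [map_add, hvw, ← differential_rTensor hθ, hu, map_sub]; abel
    simp only [LinearMap.comp_apply, h1, hret', map_add]
    rw [(h.ker _ (differential_mem_cycles hM d u)).2 ⟨u, rfl⟩, add_zero]
  refine ⟨φ ∘ₗ ret ∘ₗ differential l r d ∘ₗ sec, ⟨?_, ?_, ?_⟩, ?_⟩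
  · intro m hm z hz
    obtain ⟨m, rfl⟩ : ∃ m', m = m' + 1 := ⟨m - 1, by omega⟩
    obtain ⟨w, rfl⟩ := hsurj' _ z
    obtain ⟨v, hv, hvw⟩ := lift m _ hz w rfl
    obtain ⟨u, rfl⟩ := h.vanishing m (by omega) hv
    -- Subtracting `θ u` leaves the image in `N` unchanged and turns the lift `w` into a cycle of
    -- `M`, which bounds because the degree exceeds `d`.
    have h1 : w - θ.rTensor _ u ∈ cycles l r (m + 1) := by
      change differential l r m _ = 0
      rw [map_sub, differential_rTensor hθ, hvw, sub_self]
    obtain ⟨y, hy⟩ := h.vanishing (m + 1) (by omega) h1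
    refine ⟨π.rTensor _ y, ?_⟩
    rw [differential_rTensor hπ, hy, map_sub, (hex' _ _).2 ⟨u, rfl⟩, sub_zero]
  · intro z hz
    obtain ⟨w, rfl⟩ := hsurj' _ z
    obtain ⟨v, hv, hvw⟩ := lift d _ hz w rfl
    rw [key w v hv hvw, h.ker v hv]
    constructor
    · rintro ⟨u, rfl⟩
      have h1 : w - θ.rTensor _ u ∈ cycles l r (d + 1) := by
        change differential l r d _ = 0
        rw [map_sub, differential_rTensor hθ, hvw, sub_self]
      obtain ⟨y, hy⟩ := h.vanishing (d + 1) (by omega) h1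
      refine ⟨π.rTensor _ y, ?_⟩
      rw [differential_rTensor hπ, hy, map_sub, (hex' _ _).2 ⟨u, rfl⟩, sub_zero]
    · rintro ⟨z', hz'⟩
      obtain ⟨y, rfl⟩ := hsurj' _ z'
      have h0 : π.rTensor _ (w - differential l r (d + 1) y) = 0 := by
        rw [map_sub, ← hz', differential_rTensor hπ, sub_self]
      obtain ⟨u, hu⟩ := (hex' _ _).1 h0
      refine ⟨u, hinj' d ?_⟩
      rw [hvw, ← differential_rTensor hθ, hu, map_sub, differential_differential hM, sub_zero]
  · intro p
    rw [Submodule.mem_inf, LinearMap.mem_ker, h.range]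
    constructor
    · rintro ⟨⟨v, hv, rfl⟩, hp⟩
      -- `D (φ v) = 0` says that `θ v` is a boundary `b w`. The image of `w` in `N` is then a cycle,
      -- and the connecting map sends it to the class of `v`.
      rw [← hD v hv, h.ker _ (rTensor_mem_cycles hθ hv)] at hp
      obtain ⟨w, hw⟩ := hp
      refine ⟨π.rTensor _ w, ?_, key w v hv hw.symm⟩
      change differential l' r' d _ = 0
      rw [differential_rTensor hπ, hw]
      exact (hex' _ _).2 ⟨v, rfl⟩
    · rintro ⟨z, hz, rfl⟩
      obtain ⟨w, rfl⟩ := hsurj' _ z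
      obtain ⟨v, hv, hvw⟩ := lift d _ hz w rfl
      rw [key w v hv hvw, ← hD v hv]
      exact ⟨⟨v, hv, rfl⟩, (h.ker _ (rTensor_mem_cycles hθ hv)).2 ⟨w, hvw.symm⟩⟩
  · intro Θ Θ₀ Θ' D₀ hΘ hc hp hD₀ z hz
    obtain ⟨w, rfl⟩ := hsurj' _ z
    obtain ⟨v, hv, hvw⟩ := lift d _ hz w rfl
    have h1 : Θ'.rTensor (⨂[k]^(d + 1) A) (π.rTensor _ w) = π.rTensor _ (Θ.rTensor _ w) := by
      rw [← LinearMap.rTensor_comp_apply, ← LinearMap.rTensor_comp_apply,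
        show Θ' ∘ₗ π = π ∘ₗ Θ from LinearMap.ext fun x => (hp x).symm]
    -- `Θ w` lifts `Θ' z`, and its boundary is `Θ θ v = θ Θ₀ v`, so the connecting map replaces `v`
    -- by `Θ₀ v`.
    have h2 : θ.rTensor _ (Θ₀.rTensor _ v) = differential l r d (Θ.rTensor _ w) := by
      rw [differential_rTensor hΘ, ← hvw, ← LinearMap.rTensor_comp_apply,
        ← LinearMap.rTensor_comp_apply, show Θ ∘ₗ θ = θ ∘ₗ Θ₀ from LinearMap.ext hc]
    have h3 : Θ₀.rTensor _ v ∈ cycles l r d := by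
      refine mem_cycles_of_rTensor hθ hinj ?_
      rw [h2]
      exact differential_mem_cycles hM d _
    rw [h1, key _ _ h3 h2, key w v hv hvw, hD₀ v hv]

/-- The bimodule `A ⊗ V` has homology in degree zero only, where it is `V`. -/
theorem isTopHomology_free (r : A →ₗ[k] Module.End k M)
    (hr : ∀ a b x, r (a * b) x = r b (r a x)) (hr1 : ∀ x, r 1 x = x) :
    IsTopHomology (freeLeft k A M) (tensorRight A A r) 0 (⊤ : Submodule k M)
      (TensorProduct.lift r ∘ₗ (TensorProduct.rid k (A ⊗[k] M)).toLinearMap ∘ₗ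
        (PiTensorProduct.isEmptyEquiv (R := k) (s := fun _ : Fin 0 => A) (Fin 0)).toLinearMap.lTensor _) := by
  have hφ : ∀ c v (a : Fin 0 → A), (TensorProduct.lift r ∘ₗ
      (TensorProduct.rid k (A ⊗[k] M)).toLinearMap ∘ₗ
        (PiTensorProduct.isEmptyEquiv (R := k) (s := fun _ : Fin 0 => A) (Fin 0)).toLinearMap.lTensor _)
        ((c ⊗ₜ v) ⊗ₜ PiTensorProduct.tprod k a) = r c v := by
    intro c v a
    simp
  set φ := TensorProduct.lift r ∘ₗ (TensorProduct.rid k (A ⊗[k] M)).toLinearMap ∘ₗ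
        (PiTensorProduct.isEmptyEquiv (R := k) (s := fun _ : Fin 0 => A) (Fin 0)).toLinearMap.lTensor _ with hφd
  -- In degree zero, `b h + 1` factors through `φ`. Hence `φ z = 0` makes `z` the boundary of `-h
  -- z`.
  have hcyc : ∀ z, differential (freeLeft k A M) (tensorRight A A r) 0 (homotopy k A M 0 z) + z =
      (1 ⊗ₜ φ z) ⊗ₜ PiTensorProduct.tprod k (Fin.elim0 : Fin 0 → A) := by
    intro z
    refine LinearMap.congr_fun
      (f := differential (freeLeft k A M) (tensorRight A A r) 0 ∘ₗ homotopy k A M 0 + LinearMap.id)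
      (g := (TensorProduct.mk k (A ⊗[k] M) (⨂[k]^0 A)).flip
        (PiTensorProduct.tprod k (Fin.elim0 : Fin 0 → A)) ∘ₗ TensorProduct.mk k A M 1 ∘ₗ φ)
      (hom_ext_tmul_tprod (m := 0) fun c v a => ?_) z
    rw [LinearMap.add_apply, LinearMap.comp_apply, LinearMap.id_apply, differential_homotopy_zero,
      LinearMap.comp_apply, LinearMap.comp_apply, hφ, Subsingleton.elim a Fin.elim0]
    rfl
  have hb : ∀ z, φ (differential (freeLeft k A M) (tensorRight A A r) 0 z) = 0 := by
    intro z
    refine LinearMap.congr_fun (f := φ ∘ₗ differential (freeLeft k A M) (tensorRight A A r) 0)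
      (g := 0) (hom_ext_tmul_tprod (m := 1) fun c v a => ?_) z
    simp only [LinearMap.comp_apply, differential_tmul, Finset.univ_eq_empty, Finset.sum_empty,
      add_zero, map_add, map_smul, tensorRight_tmul, freeLeft_tmul, hφ, LinearMap.zero_apply]
    rw [show a (Fin.last 0) = a 0 from rfl, hr]
    simp
  refine ⟨?_, ?_, ?_⟩
  · intro m hm z hz
    obtain ⟨m, rfl⟩ : ∃ m', m = m' + 1 := ⟨m - 1, by omega⟩
    have h0 : differential (freeLeft k A M) (tensorRight A A r) m z = 0 := hz
    have h1 := differential_homotopy r m z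
    rw [h0, map_zero, zero_add] at h1
    refine ⟨(-1 : k) ^ m • homotopy k A M (m + 1) z, ?_⟩
    rw [map_smul, h1, smul_smul, ← mul_pow]
    simp
  · intro z _
    constructor
    · intro h0
      have h1 := hcyc z
      rw [h0, TensorProduct.tmul_zero, TensorProduct.zero_tmul] at h1
      refine ⟨(-1 : k) • homotopy k A M 0 z, ?_⟩
      rw [map_smul]
      exact neg_one_smul_of_add_eq_zero (L := (A ⊗[k] M) ⊗[k] (⨂[k]^0 A)) h1
    · rintro ⟨w, rfl⟩
      exact hb w
  · intro p
    refine ⟨fun _ => ⟨(1 ⊗ₜ p) ⊗ₜ PiTensorProduct.tprod k Fin.elim0, Submodule.mem_top, ?_⟩,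
      fun _ => Submodule.mem_top⟩
    rw [hφ, hr1]

end TopHomology

end Hochschild

end

noncomputable section

/-! ### Diagonal bimodules over enveloping algebras -/

namespace UniversalEnvelopingAlgebra

attribute [local instance] LieRing.ofAssociativeRing

/-- The elements with the property form a subalgebra. Lifting `ι` into it and including back is the
identity, by the universal property. -/
theorem induction_ι {k L : Type*} [CommRing k] [LieRing L] [LieAlgebra k L]
    {p : UniversalEnvelopingAlgebra k L → Prop}
    (algebraMap : ∀ c, p (algebraMap k _ c)) (ι : ∀ u, p (ι k u))
    (add : ∀ a b, p a → p b → p (a + b)) (mul : ∀ a b, p a → p b → p (a * b))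
    (a : UniversalEnvelopingAlgebra k L) : p a := by
  let S : Subalgebra k (UniversalEnvelopingAlgebra k L) :=
    { carrier := {a | p a}
      mul_mem' := fun {a b} ha hb => mul a b ha hb
      add_mem' := fun {a b} ha hb => add a b ha hb
      algebraMap_mem' := algebraMap }
  let f : L →ₗ⁅k⁆ S :=
    { toFun := fun u => ⟨UniversalEnvelopingAlgebra.ι k u, ι u⟩
      map_add' := fun u v => Subtype.ext (map_add (UniversalEnvelopingAlgebra.ι k) u v)
      map_smul' := fun c u => Subtype.ext (map_smul (UniversalEnvelopingAlgebra.ι k) c u)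
      map_lie' := fun {u v} => Subtype.ext (LieHom.map_lie (UniversalEnvelopingAlgebra.ι k) u v) }
  have h : S.val.comp (lift k f) = AlgHom.id k _ := by
    apply hom_ext
    apply LieHom.ext
    intro u
    change ((lift k f (UniversalEnvelopingAlgebra.ι k u) : S) : UniversalEnvelopingAlgebra k L) = _
    rw [lift_ι_apply]
    rfl
  have h1 := AlgHom.congr_fun h a
  rw [AlgHom.id_apply] at h1
  rw [← h1]
  exact (lift k f a).2

/-- A linear map that intertwines the actions of a Lie algebra intertwines those of its enveloping
algebra. -/
theorem intertwines_of_ι {k L V V' : Type*} [CommRing k] [LieRing L] [LieAlgebra k L]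
    [AddCommGroup V] [Module k V] [AddCommGroup V'] [Module k V']
    (ρ : UniversalEnvelopingAlgebra k L →ₐ[k] Module.End k V)
    (ρ' : UniversalEnvelopingAlgebra k L →ₐ[k] Module.End k V') (f : V →ₗ[k] V')
    (h : ∀ u x, f (ρ (ι k u) x) = ρ' (ι k u) (f x)) (a : UniversalEnvelopingAlgebra k L) :
    ∀ x, f (ρ a x) = ρ' a (f x) := by
  induction a using induction_ι with
  | algebraMap c => intro x; simp [Module.algebraMap_end_apply]
  | ι u => exact h u
  | add a b ha hb => intro x; simp [ha, hb]
  | mul a b ha hb => intro x; simp [ha, hb]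

end UniversalEnvelopingAlgebra

namespace Hochschild

open UniversalEnvelopingAlgebra

attribute [local instance] LieRing.ofAssociativeRing

section Diagonal

local notation "𝒰[" k "," L "]" => UniversalEnvelopingAlgebra k L

variable {k L M : Type*} [Field k] [LieRing L] [LieAlgebra k L] [AddCommGroup M] [Module k M]
  {l r : UniversalEnvelopingAlgebra k L →ₗ[k] Module.End k M}

variable (W : Type*) [AddCommGroup W] [Module k W] [Module 𝒰[k, L] W] [IsScalarTower k 𝒰[k, L] W]

/-- The diagonal action `u (w ⊗ x) = u w ⊗ x + w ⊗ u x` of a Lie algebra. -/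
def diagLin (l : 𝒰[k, L] →ₗ[k] Module.End k M) : L →ₗ[k] Module.End k (W ⊗[k] M) :=
  (LinearMap.rTensorHom M ∘ₗ (Algebra.lsmul k k W).toLinearMap + LinearMap.lTensorHom W ∘ₗ l) ∘ₗ
    (ι k : L →ₗ⁅k⁆ 𝒰[k, L]).toLinearMap

theorem diagLin_tmul (l : 𝒰[k, L] →ₗ[k] Module.End k M) (u : L) (w : W) (x : M) :
    diagLin W l u (w ⊗ₜ x) = (ι k u • w) ⊗ₜ x + w ⊗ₜ l (ι k u) x := rfl

theorem diagLin_lie (h : IsBimodule l r) (u v : L) :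
    diagLin W l ⁅u, v⁆ = ⁅diagLin W l u, diagLin W l v⁆ := by
  refine TensorProduct.ext' fun w x => ?_
  rw [LieRing.of_associative_ring_bracket, LinearMap.sub_apply, Module.End.mul_apply,
    Module.End.mul_apply]
  simp only [diagLin_tmul, map_add, LieHom.map_lie, LieRing.of_associative_ring_bracket, sub_smul,
    map_sub, LinearMap.sub_apply, h.left_mul, mul_smul, TensorProduct.tmul_sub,
    TensorProduct.sub_tmul]
  abel

/-- The diagonal action of the enveloping algebra on `W ⊗ M`. -/
def diagHom (h : IsBimodule l r) : 𝒰[k, L] →ₐ[k] Module.End k (W ⊗[k] M) :=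
  lift k { diagLin W l with map_lie' := fun {u v} => diagLin_lie W h u v }

theorem diagHom_ι (h : IsBimodule l r) (u : L) (w : W) (x : M) :
    diagHom W h (ι k u) (w ⊗ₜ x) = (ι k u • w) ⊗ₜ x + w ⊗ₜ l (ι k u) x := by
  rw [diagHom, lift_ι_apply]
  exact diagLin_tmul W l u w x

theorem diagHom_comm (h : IsBimodule l r) {f : Module.End k (W ⊗[k] M)}
    (hf : ∀ u w x, f (diagHom W h (ι k u) (w ⊗ₜ x)) = diagHom W h (ι k u) (f (w ⊗ₜ x)))
    (a : 𝒰[k, L]) (z : W ⊗[k] M) : f (diagHom W h a z) = diagHom W h a (f z) :=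
  intertwines_of_ι _ _ f (fun u z => LinearMap.congr_fun (f := f ∘ₗ diagHom W h (ι k u))
    (g := diagHom W h (ι k u) ∘ₗ f) (TensorProduct.ext' fun w x => hf u w x) z) a z

theorem diagHom_isBimodule (h : IsBimodule l r) :
    IsBimodule (diagHom W h).toLinearMap (tensorRight 𝒰[k, L] W r) where
  left_one x := by simp
  left_mul a b x := by simp
  right_mul a b x := LinearMap.congr_fun (f := tensorRight 𝒰[k, L] W r (a * b))
    (g := tensorRight 𝒰[k, L] W r b ∘ₗ tensorRight 𝒰[k, L] W r a)
    (TensorProduct.ext' fun c v => by simp [h.right_mul]) x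
  comm a b x := by
    refine (diagHom_comm W h (f := tensorRight 𝒰[k, L] W r b) (fun u w x => ?_) a x).symm
    simp only [diagHom_ι, map_add, tensorRight_tmul, h.comm]

/-- The diagonal action is functorial in the module `W`. All maps of the exact sequences below arise
in this way. -/
theorem diagHom_map (h : IsBimodule l r) {W} {W' : Type*} [AddCommGroup W] [Module k W]
    [Module 𝒰[k, L] W] [IsScalarTower k 𝒰[k, L] W] [AddCommGroup W'] [Module k W'] [Module 𝒰[k, L] W']
    [IsScalarTower k 𝒰[k, L] W'] (f : W →ₗ[𝒰[k, L]] W') :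
    IsBimoduleHom (diagHom W h).toLinearMap (tensorRight 𝒰[k, L] W r) (diagHom W' h).toLinearMap
      (tensorRight 𝒰[k, L] W' r) ((f.restrictScalars k).rTensor M) where
  left a x := by
    refine intertwines_of_ι (diagHom W h) (diagHom W' h) _ (fun u z => ?_) a x
    refine LinearMap.congr_fun (f := (f.restrictScalars k).rTensor M ∘ₗ diagHom W h (ι k u))
      (g := diagHom W' h (ι k u) ∘ₗ (f.restrictScalars k).rTensor M)
      (TensorProduct.ext' fun w x => ?_) z
    simp only [LinearMap.comp_apply, diagHom_ι, map_add, LinearMap.rTensor_tmul,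
      LinearMap.coe_restrictScalars, map_smul]
  right a x := by
    refine LinearMap.congr_fun (f := (f.restrictScalars k).rTensor M ∘ₗ tensorRight 𝒰[k, L] W r a)
      (g := tensorRight 𝒰[k, L] W' r a ∘ₗ (f.restrictScalars k).rTensor M)
      (TensorProduct.ext' fun w x => ?_) x
    simp

/-- The right action of the Lie algebra on `U ⊗ M` by `a ⊗ x ↦ a u ⊗ x - a ⊗ u x`. -/
def twistLin (l : 𝒰[k, L] →ₗ[k] Module.End k M) : L →ₗ[k] (Module.End k (𝒰[k, L] ⊗[k] M))ᵐᵒᵖ :=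
  (MulOpposite.opLinearEquiv k).toLinearMap ∘ₗ
    (LinearMap.rTensorHom M ∘ₗ (LinearMap.mul k 𝒰[k, L]).flip - LinearMap.lTensorHom 𝒰[k, L] ∘ₗ l) ∘ₗ
    (ι k : L →ₗ⁅k⁆ 𝒰[k, L]).toLinearMap

theorem twistLin_tmul (l : 𝒰[k, L] →ₗ[k] Module.End k M) (u : L) (a : 𝒰[k, L]) (x : M) :
    (twistLin l u).unop (a ⊗ₜ x) = (a * ι k u) ⊗ₜ x - a ⊗ₜ l (ι k u) x := rfl

theorem twistLin_lie (h : IsBimodule l r) (u v : L) :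
    twistLin l ⁅u, v⁆ = ⁅twistLin l u, twistLin l v⁆ := by
  apply MulOpposite.unop_injective
  refine TensorProduct.ext' fun w x => ?_
  rw [LieRing.of_associative_ring_bracket, MulOpposite.unop_sub, LinearMap.sub_apply,
    MulOpposite.unop_mul, MulOpposite.unop_mul, Module.End.mul_apply, Module.End.mul_apply]
  simp only [twistLin_tmul, map_sub, LieHom.map_lie, LieRing.of_associative_ring_bracket, mul_sub,
    LinearMap.sub_apply, h.left_mul, mul_assoc, TensorProduct.tmul_sub, TensorProduct.sub_tmul]
  abel

/-- The right action of the enveloping algebra that extends `twistLin`. -/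
def twistHom (h : IsBimodule l r) : 𝒰[k, L] →ₐ[k] (Module.End k (𝒰[k, L] ⊗[k] M))ᵐᵒᵖ :=
  lift k { twistLin l with map_lie' := fun {u v} => twistLin_lie h u v }

theorem twistHom_ι (h : IsBimodule l r) (u : L) (a : 𝒰[k, L]) (x : M) :
    (twistHom h (ι k u)).unop (a ⊗ₜ x) = (a * ι k u) ⊗ₜ x - a ⊗ₜ l (ι k u) x := by
  rw [twistHom, lift_ι_apply]
  exact twistLin_tmul l u a x

/-- The twisted right action touches the left factor only by right multiplications, which commute
with left ones. -/
theorem twistHom_freeLeft (h : IsBimodule l r) (c a : 𝒰[k, L]) :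
    ∀ z, (twistHom h a).unop (freeLeft k 𝒰[k, L] M c z) = freeLeft k 𝒰[k, L] M c ((twistHom h a).unop z) := by
  induction a using induction_ι with
  | algebraMap t => intro z; simp [Module.algebraMap_end_apply]
  | ι u =>
    intro z
    refine LinearMap.congr_fun (f := (twistHom h (ι k u)).unop ∘ₗ freeLeft k 𝒰[k, L] M c)
      (g := freeLeft k 𝒰[k, L] M c ∘ₗ (twistHom h (ι k u)).unop) (TensorProduct.ext' fun w x => ?_) z
    simp only [LinearMap.comp_apply, freeLeft_tmul, twistHom_ι, map_sub, mul_assoc]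
  | add a b ha hb => intro z; simp [ha, hb]
  | mul a b ha hb => intro z; simp [ha, hb]

/-- The map `a ⊗ x ↦ a (1 ⊗ x)` from `U ⊗ M` with the action on the first factor to `U ⊗ M` with
the diagonal action. -/
def freeToDiag (h : IsBimodule l r) : 𝒰[k, L] ⊗[k] M →ₗ[k] 𝒰[k, L] ⊗[k] M :=
  TensorProduct.lift ((TensorProduct.mk k 𝒰[k, L] M 1).lcomp k _ ∘ₗ (diagHom 𝒰[k, L] h).toLinearMap)

theorem freeToDiag_tmul (h : IsBimodule l r) (a : 𝒰[k, L]) (x : M) :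
    freeToDiag h (a ⊗ₜ x) = diagHom 𝒰[k, L] h a (1 ⊗ₜ x) := rfl

/-- The inverse of `freeToDiag`. -/
def diagToFree (h : IsBimodule l r) : 𝒰[k, L] ⊗[k] M →ₗ[k] 𝒰[k, L] ⊗[k] M :=
  TensorProduct.lift ((TensorProduct.mk k 𝒰[k, L] M 1).lcomp k _ ∘ₗ
    (MulOpposite.opLinearEquiv k).symm.toLinearMap ∘ₗ (twistHom h).toLinearMap)

theorem diagToFree_tmul (h : IsBimodule l r) (a : 𝒰[k, L]) (x : M) :
    diagToFree h (a ⊗ₜ x) = (twistHom h a).unop (1 ⊗ₜ x) := rfl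

/-- For a generator `u`, the element `u a ⊗ x` goes to the left multiple by `u` of the image of `a ⊗
x`, minus a term from the twist which `a ⊗ u x` restores. -/
theorem diagToFree_diagHom (h : IsBimodule l r) (c : 𝒰[k, L]) (z : 𝒰[k, L] ⊗[k] M) :
    diagToFree h (diagHom 𝒰[k, L] h c z) = freeLeft k 𝒰[k, L] M c (diagToFree h z) := by
  refine intertwines_of_ι (diagHom 𝒰[k, L] h)
    ((Module.End.rTensorAlgHom k 𝒰[k, L] M).comp (Algebra.lmul k 𝒰[k, L])) _ (fun u z => ?_) c z
  refine LinearMap.congr_fun (f := diagToFree h ∘ₗ diagHom 𝒰[k, L] h (ι k u))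
    (g := freeLeft k 𝒰[k, L] M (ι k u) ∘ₗ diagToFree h) (TensorProduct.ext' fun a x => ?_) z
  rw [LinearMap.comp_apply, LinearMap.comp_apply, diagHom_ι, map_add, diagToFree_tmul,
    diagToFree_tmul, diagToFree_tmul, smul_eq_mul, map_mul, MulOpposite.unop_mul,
    Module.End.mul_apply, twistHom_ι, map_sub, one_mul, sub_add_cancel, ← twistHom_freeLeft,
    freeLeft_tmul, mul_one]

/-- The twist `a u ⊗ x - a ⊗ u x` is chosen for this: applied to `1 ⊗ x`, the diagonal action of `u`
gives `u ⊗ x + 1 ⊗ u x`, and subtracting the second term leaves right multiplication by `u`. -/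
theorem freeToDiag_twistHom (h : IsBimodule l r) (c : 𝒰[k, L]) :
    ∀ z, freeToDiag h ((twistHom h c).unop z) =
      (LinearMap.mulRight k c).rTensor M (freeToDiag h z) := by
  have hc : ∀ (c a : 𝒰[k, L]) (z : 𝒰[k, L] ⊗[k] M), (LinearMap.mulRight k c).rTensor M
      (diagHom 𝒰[k, L] h a z) = diagHom 𝒰[k, L] h a ((LinearMap.mulRight k c).rTensor M z) := by
    intro c a z
    refine diagHom_comm _ h (fun u w x => ?_) a z
    simp only [diagHom_ι, map_add, LinearMap.rTensor_tmul, LinearMap.mulRight_apply, smul_mul_assoc]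
  induction c using induction_ι with
  | algebraMap t =>
    intro z
    have h1 : LinearMap.mulRight k (algebraMap k 𝒰[k, L] t) = t • LinearMap.id := by
      ext a; simp [Algebra.smul_def, Algebra.commutes]
    rw [h1, LinearMap.rTensor_smul]
    simp [Module.algebraMap_end_apply]
  | ι u =>
    intro z
    refine LinearMap.congr_fun (f := freeToDiag h ∘ₗ (twistHom h (ι k u)).unop)
      (g := (LinearMap.mulRight k (ι k u)).rTensor M ∘ₗ freeToDiag h)
      (TensorProduct.ext' fun a x => ?_) z
    rw [LinearMap.comp_apply, LinearMap.comp_apply, twistHom_ι, map_sub, freeToDiag_tmul,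
      freeToDiag_tmul, freeToDiag_tmul, hc, map_mul, Module.End.mul_apply, diagHom_ι, map_add,
      smul_eq_mul, mul_one, add_sub_cancel_right]
    simp
  | add a b ha hb =>
    intro z
    have h1 : LinearMap.mulRight k (a + b) = LinearMap.mulRight k a + LinearMap.mulRight k b := by
      ext; simp [mul_add]
    rw [h1, LinearMap.rTensor_add]
    simp [ha, hb]
  | mul a b ha hb =>
    intro z
    have h1 : LinearMap.mulRight k (a * b) = LinearMap.mulRight k b ∘ₗ LinearMap.mulRight k a := by
      ext; simp [mul_assoc]
    rw [h1, LinearMap.rTensor_comp]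
    simp [ha, hb]

theorem freeToDiag_diagToFree (h : IsBimodule l r) (z : 𝒰[k, L] ⊗[k] M) :
    freeToDiag h (diagToFree h z) = z := by
  refine LinearMap.congr_fun (f := freeToDiag h ∘ₗ diagToFree h) (g := LinearMap.id)
    (TensorProduct.ext' fun a x => ?_) z
  rw [LinearMap.comp_apply, diagToFree_tmul, freeToDiag_twistHom, freeToDiag_tmul, map_one]
  simp

theorem diagToFree_freeToDiag (h : IsBimodule l r) (z : 𝒰[k, L] ⊗[k] M) :
    diagToFree h (freeToDiag h z) = z := by
  refine LinearMap.congr_fun (f := diagToFree h ∘ₗ freeToDiag h) (g := LinearMap.id)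
    (TensorProduct.ext' fun a x => ?_) z
  rw [LinearMap.comp_apply, freeToDiag_tmul, diagToFree_diagHom, diagToFree_tmul, map_one]
  simp

theorem freeToDiag_isBimoduleHom (h : IsBimodule l r) :
    IsBimoduleHom (freeLeft k 𝒰[k, L] M) (tensorRight 𝒰[k, L] 𝒰[k, L] r)
      (diagHom 𝒰[k, L] h).toLinearMap (tensorRight 𝒰[k, L] 𝒰[k, L] r) (freeToDiag h) where
  left c z := by
    refine LinearMap.congr_fun (f := freeToDiag h ∘ₗ freeLeft k 𝒰[k, L] M c)
      (g := diagHom 𝒰[k, L] h c ∘ₗ freeToDiag h) (TensorProduct.ext' fun a x => ?_) z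
    simp [freeToDiag_tmul]
  right c z := by
    refine LinearMap.congr_fun (f := freeToDiag h ∘ₗ tensorRight 𝒰[k, L] 𝒰[k, L] r c)
      (g := tensorRight 𝒰[k, L] 𝒰[k, L] r c ∘ₗ freeToDiag h) (TensorProduct.ext' fun a x => ?_) z
    rw [LinearMap.comp_apply, LinearMap.comp_apply, tensorRight_tmul, freeToDiag_tmul,
      freeToDiag_tmul, ← tensorRight_tmul]
    exact (diagHom_isBimodule 𝒰[k, L] h).comm a c _

theorem IsBimoduleHom.symm {A M N : Type*} [Ring A] [Algebra k A] [AddCommGroup M] [Module k M]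
    [AddCommGroup N] [Module k N] {l r : A →ₗ[k] Module.End k M} {l' r' : A →ₗ[k] Module.End k N}
    {e : M ≃ₗ[k] N} (he : IsBimoduleHom l r l' r' e.toLinearMap) :
    IsBimoduleHom l' r' l r e.symm.toLinearMap where
  left a x := by
    apply e.injective
    have := he.left a (e.symm x)
    simp only [LinearEquiv.coe_coe, LinearEquiv.apply_symm_apply] at this ⊢
    exact this.symm
  right a x := by
    apply e.injective
    have := he.right a (e.symm x)
    simp only [LinearEquiv.coe_coe, LinearEquiv.apply_symm_apply] at this ⊢
    exact this.symm

/-- The isomorphism of `U ⊗ M` with the diagonal action and `U ⊗ M` with the action on `U`. -/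
def diagEquivFree (h : IsBimodule l r) : (𝒰[k, L] ⊗[k] M) ≃ₗ[k] (𝒰[k, L] ⊗[k] M) :=
  LinearEquiv.symm (LinearEquiv.ofLinearMap (freeToDiag h) (diagToFree h)
    (LinearMap.ext (freeToDiag_diagToFree h)) (LinearMap.ext (diagToFree_freeToDiag h)))

/-- The homology of the diagonal bimodule `U ⊗ M` is concentrated in degree zero, where it is `M`,
and the right multiplication by `u` on `U` acts on it as `x ↦ x u - u x`. -/
theorem exists_isTopHomology_diag (h : IsBimodule l r) (hr1 : ∀ x, r 1 x = x) :
    ∃ φ, IsTopHomology (diagHom 𝒰[k, L] h).toLinearMap (tensorRight 𝒰[k, L] 𝒰[k, L] r) 0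
        (⊤ : Submodule k M) φ ∧
      ∀ (u : L) z, φ (((LinearMap.mulRight k (ι k u)).rTensor M).rTensor _ z) =
        (r (ι k u) - l (ι k u)) (φ z) := by
  have he : IsBimoduleHom (freeLeft k 𝒰[k, L] M) (tensorRight 𝒰[k, L] 𝒰[k, L] r)
      (diagHom 𝒰[k, L] h).toLinearMap (tensorRight 𝒰[k, L] 𝒰[k, L] r)
      (diagEquivFree h).symm.toLinearMap := freeToDiag_isBimoduleHom h
  refine ⟨_, (isTopHomology_free r h.right_mul hr1).congr (diagEquivFree h) he.symm he,
    fun u z => ?_⟩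
  -- Under the isomorphism with the free bimodule, right multiplication on the diagonal side becomes
  -- the twisted action.
  have h1 : (diagEquivFree h).toLinearMap ∘ₗ (LinearMap.mulRight k (ι k u)).rTensor M =
      (twistHom h (ι k u)).unop ∘ₗ (diagEquivFree h).toLinearMap := by
    refine LinearMap.ext fun z => ?_
    apply (diagEquivFree h).symm.injective
    have := freeToDiag_twistHom h (ι k u) (diagToFree h z)
    rw [freeToDiag_diagToFree] at this
    simp only [LinearMap.comp_apply, LinearEquiv.coe_coe, LinearEquiv.symm_apply_apply]
    exact this.symm
  rw [LinearMap.comp_apply, LinearMap.comp_apply _ _ z, ← LinearMap.rTensor_comp_apply, h1,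
    LinearMap.rTensor_comp_apply]
  generalize (diagEquivFree h).toLinearMap.rTensor _ z = y
  simp only [LinearMap.comp_apply]
  have h2 : ∀ (t : Module.End k (𝒰[k, L] ⊗[k] M)) (y : (𝒰[k, L] ⊗[k] M) ⊗[k] (⨂[k]^0 𝒰[k, L])),
    (TensorProduct.rid k _).toLinearMap ((PiTensorProduct.isEmptyEquiv (R := k)
      (s := fun _ : Fin 0 => 𝒰[k, L]) (Fin 0)).toLinearMap.lTensor _ (t.rTensor _ y)) =
    t ((TensorProduct.rid k _).toLinearMap ((PiTensorProduct.isEmptyEquiv (R := k)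
      (s := fun _ : Fin 0 => 𝒰[k, L]) (Fin 0)).toLinearMap.lTensor _ y)) := by
    intro t y
    induction y using TensorProduct.induction_on with
    | zero => simp
    | tmul x y => simp
    | add x y hx hy => simp only [map_add, hx, hy]
  rw [h2]
  -- Degree-zero homology is read off by `a ⊗ x ↦ x a`. It sends `a u ⊗ x - a ⊗ u x` to `(x a) u - u
  -- (x a)`, because the left and right actions commute.
  refine LinearMap.congr_fun (f := TensorProduct.lift r ∘ₗ (twistHom h (ι k u)).unop)
    (g := (r (ι k u) - l (ι k u)) ∘ₗ TensorProduct.lift r) (TensorProduct.ext' fun a x => ?_) _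
  rw [LinearMap.comp_apply, twistHom_ι]
  simp [-ι_apply, h.right_mul, h.comm]

end Diagonal

end Hochschild

end

noncomputable section

/-! ### The Poincaré–Birkhoff–Witt basis -/

namespace Kappa

open MvPolynomial UniversalEnvelopingAlgebra
open scoped IsMulCommutative

attribute [local instance] LieRing.ofAssociativeRing

variable (n : ℕ) [NeZero n] (lam : ℝ)

theorem ι_eq_sum (v : LieAlg n lam) :
    UniversalEnvelopingAlgebra.ι ℂ v = ∑ j, coord j v • Kappa.X n lam j := by
  have h : v = ∑ j, coord j v • (gen j : LieAlg n lam) := by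
    apply coord_ext
    intro l
    simp [map_sum, coord_gen]
  conv_lhs => rw [h]
  simp only [map_sum, map_smul]
  rfl

theorem X_zero_mul_X {j : Fin n} (hj : j ≠ 0) : Kappa.X n lam 0 * Kappa.X n lam j =
    Kappa.X n lam j * Kappa.X n lam 0 + (Complex.I * lam) • Kappa.X n lam j := by
  have h := congrArg (UniversalEnvelopingAlgebra.ι ℂ) (lie_gen_zero (lam := lam) j hj)
  rw [LieHom.map_lie, LieRing.of_associative_ring_bracket, map_smul, sub_eq_iff_eq_add] at h
  rw [add_comm]
  exact h

theorem X_mul_X_comm {j l : Fin n} (hj : j ≠ 0) (hl : l ≠ 0) :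
    Kappa.X n lam j * Kappa.X n lam l = Kappa.X n lam l * Kappa.X n lam j := by
  have h := congrArg (UniversalEnvelopingAlgebra.ι ℂ) (lie_gen_gen (lam := lam) j l hj hl)
  rw [LieHom.map_lie, LieRing.of_associative_ring_bracket, map_zero, sub_eq_zero] at h
  exact h

/-- The enveloping algebra is generated by the `x_j`. -/
theorem env_induction {p : Env n lam → Prop} (algebraMap : ∀ c, p (algebraMap ℂ _ c))
    (X : ∀ j, p (Kappa.X n lam j)) (add : ∀ a b, p a → p b → p (a + b))
    (mul : ∀ a b, p a → p b → p (a * b)) (a : Env n lam) : p a := by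
  induction a using induction_ι with
  | algebraMap c => exact algebraMap c
  | ι v =>
    rw [ι_eq_sum]
    refine Finset.sum_induction _ p add (by simpa using algebraMap 0) fun j _ => ?_
    rw [Algebra.smul_def]
    exact mul _ _ (algebraMap _) (X j)
  | add a b ha hb => exact add a b ha hb
  | mul a b ha hb => exact mul a b ha hb

theorem env_algHom_ext {B : Type*} [Ring B] [Algebra ℂ B] {f g : Env n lam →ₐ[ℂ] B}
    (h : ∀ j, f (Kappa.X n lam j) = g (Kappa.X n lam j)) : f = g := by
  refine AlgHom.ext fun a => ?_
  induction a using env_induction with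
  | algebraMap c => simp
  | X j => exact h j
  | add a b ha hb => simp [ha, hb]
  | mul a b ha hb => simp [ha, hb]

/-- The Euler derivation `∑_{j ≠ 0} x_j ∂_j` on polynomials. -/
def polyEuler : Derivation ℂ (MvPolynomial (Fin n) ℂ) (MvPolynomial (Fin n) ℂ) :=
  mkDerivation ℂ fun j => if j = 0 then 0 else MvPolynomial.X j

@[simp] theorem polyEuler_X_zero : polyEuler n (MvPolynomial.X 0) = 0 := by simp [polyEuler]

theorem polyEuler_X {j : Fin n} (hj : j ≠ 0) :
    polyEuler n (MvPolynomial.X j) = MvPolynomial.X j := by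
  simp [polyEuler, hj]

/-- The total degree of a monomial in the variables other than the time variable. -/
def spaceDegree (b : Fin n →₀ ℕ) : ℕ := ∑ j ∈ Finset.univ.erase 0, b j

theorem polyEuler_monomial (b : Fin n →₀ ℕ) (c : ℂ) :
    polyEuler n (monomial b c) = (spaceDegree n b : ℂ) • monomial b c := by
  rw [polyEuler, mkDerivation_monomial, Finsupp.sum_fintype _ _ (by simp), spaceDegree,
    ← Finset.add_sum_erase _ _ (Finset.mem_univ (0 : Fin n)), if_pos rfl, smul_zero, zero_add,
    Nat.cast_sum, Finset.sum_smul, Finset.smul_sum]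
  refine Finset.sum_congr rfl fun j hj => ?_
  rw [if_neg (Finset.ne_of_mem_erase hj), smul_eq_mul]
  by_cases h : b j = 0
  · simp [h]
  · have h1 : Finsupp.single j 1 ≤ b := by
      rw [Finsupp.single_le_iff]; omega
    rw [MvPolynomial.X, monomial_mul, tsub_add_cancel_of_le h1, mul_one, smul_monomial,
      smul_monomial, smul_eq_mul, smul_eq_mul, mul_comm]

/-- The substitution `x₀ ↦ x₀ + c`. -/
def translate (c : ℂ) : MvPolynomial (Fin n) ℂ →ₐ[ℂ] MvPolynomial (Fin n) ℂ :=
  aeval fun j => if j = 0 then MvPolynomial.X 0 + C c else MvPolynomial.X j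

@[simp] theorem translate_X_zero (c : ℂ) :
    translate n c (MvPolynomial.X 0) = MvPolynomial.X 0 + C c := by
  simp [translate]

theorem translate_X (c : ℂ) {j : Fin n} (hj : j ≠ 0) :
    translate n c (MvPolynomial.X j) = MvPolynomial.X j := by
  simp [translate, hj]

@[simp] theorem translate_translate (c d : ℂ) (p : MvPolynomial (Fin n) ℂ) :
    translate n c (translate n d p) = translate n (c + d) p := by
  refine AlgHom.congr_fun (φ₁ := (translate n c).comp (translate n d)) (algHom_ext fun j => ?_) p
  by_cases hj : j = 0
  · subst hj
    simp [translate_X_zero, add_assoc]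
  · simp [translate_X n _ hj]

@[simp] theorem translate_zero (p : MvPolynomial (Fin n) ℂ) : translate n 0 p = p := by
  refine AlgHom.congr_fun (φ₁ := translate n 0) (φ₂ := AlgHom.id ℂ _) (algHom_ext fun j => ?_) p
  by_cases hj : j = 0
  · subst hj
    simp
  · simp [translate_X n _ hj]

/-- The Lie algebra acting on polynomials by the left multiplications of ordered monomials, with
the time variable written last. -/
def symbolLin : LieAlg n lam →ₗ[ℂ] Module.End ℂ (MvPolynomial (Fin n) ℂ) :=
  ∑ j, (coord j).smulRight (LinearMap.mulLeft ℂ (MvPolynomial.X j)) +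
    (coord 0).smulRight ((Complex.I * lam) • (polyEuler n).toLinearMap)

theorem symbolLin_apply (v : LieAlg n lam) (p : MvPolynomial (Fin n) ℂ) :
    symbolLin n lam v p = (∑ j, coord j v • MvPolynomial.X j) * p +
      (Complex.I * lam * coord 0 v) • polyEuler n p := by
  simp only [symbolLin, LinearMap.add_apply, LinearMap.sum_apply, LinearMap.smulRight_apply,
    LinearMap.smul_apply, LinearMap.mulLeft_apply, Finset.sum_mul, smul_mul_assoc, smul_smul,
    mul_comm (coord 0 v)]
  rfl

theorem polyEuler_sum (v : LieAlg n lam) :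
    polyEuler n (∑ j, coord j v • MvPolynomial.X j) =
      ∑ j, coord j v • MvPolynomial.X j - coord 0 v • MvPolynomial.X 0 := by
  rw [map_sum, ← Finset.add_sum_erase _ _ (Finset.mem_univ (0 : Fin n)),
    ← Finset.add_sum_erase _ (fun j => coord j v • (MvPolynomial.X j : MvPolynomial (Fin n) ℂ))
      (Finset.mem_univ (0 : Fin n)), add_sub_cancel_left]
  rw [Derivation.map_smul, polyEuler_X_zero, smul_zero, zero_add]
  refine Finset.sum_congr rfl fun j hj => ?_
  rw [Derivation.map_smul, polyEuler_X n (Finset.ne_of_mem_erase hj)]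

/-- In essence `[x₀ + i lam E, x_j] = i lam x_j`, because the Euler derivation `E` kills `x₀` and
fixes each other variable. -/
theorem symbolLin_lie (v w : LieAlg n lam) :
    symbolLin n lam ⁅v, w⁆ = ⁅symbolLin n lam v, symbolLin n lam w⁆ := by
  refine LinearMap.ext fun p => ?_
  have hb : ∑ j, coord j ⁅v, w⁆ • (MvPolynomial.X j : MvPolynomial (Fin n) ℂ) = (Complex.I * lam) •
      (coord 0 v • ∑ j, coord j w • MvPolynomial.X j -
        coord 0 w • ∑ j, coord j v • MvPolynomial.X j) := by
    rw [Finset.smul_sum, Finset.smul_sum, ← Finset.sum_sub_distrib, Finset.smul_sum]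
    refine Finset.sum_congr rfl fun j _ => ?_
    rw [coord_lie]; module
  have h0 : coord 0 ⁅v, w⁆ = 0 := by rw [coord_lie]; ring
  rw [LieRing.of_associative_ring_bracket, LinearMap.sub_apply, Module.End.mul_apply,
    Module.End.mul_apply]
  simp only [symbolLin_apply, map_add, map_smul, Derivation.leibniz, polyEuler_sum, hb, h0,
    smul_eq_mul]
  simp only [smul_eq_C_mul, map_mul]
  simp
  ring

/-- The action of the enveloping algebra on polynomials. -/
def symbolHom : Env n lam →ₐ[ℂ] Module.End ℂ (MvPolynomial (Fin n) ℂ) :=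
  lift ℂ { symbolLin n lam with map_lie' := fun {v w} => symbolLin_lie n lam v w }

theorem symbolHom_X_zero (p : MvPolynomial (Fin n) ℂ) :
    symbolHom n lam (Kappa.X n lam 0) p = MvPolynomial.X 0 * p + (Complex.I * lam) • polyEuler n p := by
  rw [symbolHom, Kappa.X, lift_ι_apply]
  refine (symbolLin_apply n lam (gen 0) p).trans ?_
  simp [coord_gen]

theorem symbolHom_X {j : Fin n} (hj : j ≠ 0) (p : MvPolynomial (Fin n) ℂ) :
    symbolHom n lam (Kappa.X n lam j) p = MvPolynomial.X j * p := by
  rw [symbolHom, Kappa.X, lift_ι_apply]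
  refine (symbolLin_apply n lam (gen j) p).trans ?_
  simp [coord_gen, hj.symm]

/-- The commuting operators of left multiplication by `x_j`, `j ≠ 0`, and of right multiplication
by `x₀`. -/
def orderedMul (j : Fin n) : Module.End ℂ (Env n lam) :=
  if j = 0 then LinearMap.mulRight ℂ (Kappa.X n lam 0) else LinearMap.mulLeft ℂ (Kappa.X n lam j)

theorem orderedMul_zero (a : Env n lam) : orderedMul n lam 0 a = a * Kappa.X n lam 0 := by
  simp [orderedMul]

theorem orderedMul_of_ne {j : Fin n} (hj : j ≠ 0) (a : Env n lam) :
    orderedMul n lam j a = Kappa.X n lam j * a := by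
  simp [orderedMul, hj]

/-- Writing `x₀` as a right multiplication makes it commute with all left multiplications. Ordered
monomials thereby become an evaluation of a commutative polynomial ring. -/
theorem orderedMul_comm (i j : Fin n) :
    orderedMul n lam i * orderedMul n lam j = orderedMul n lam j * orderedMul n lam i := by
  refine LinearMap.ext fun a => ?_
  rw [Module.End.mul_apply, Module.End.mul_apply]
  by_cases hi : i = 0 <;> by_cases hj : j = 0
  · rw [hi, hj]
  · rw [hi, orderedMul_zero, orderedMul_zero, orderedMul_of_ne n lam hj,
      orderedMul_of_ne n lam hj, mul_assoc]
  · rw [hj, orderedMul_zero, orderedMul_zero, orderedMul_of_ne n lam hi,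
      orderedMul_of_ne n lam hi, mul_assoc]
  · rw [orderedMul_of_ne n lam hi, orderedMul_of_ne n lam hi, orderedMul_of_ne n lam hj,
      orderedMul_of_ne n lam hj, ← mul_assoc, ← mul_assoc, X_mul_X_comm n lam hi hj]

/-- Polynomials in commuting elements of an algebra. -/
theorem exists_algHom_of_commute {σ R B : Type*} [CommRing R] [Ring B] [Algebra R B] (f : σ → B)
    (hf : ∀ i j, f i * f j = f j * f i) :
    ∃ g : MvPolynomial σ R →ₐ[R] B, ∀ i, g (MvPolynomial.X i) = f i := by
  have h : ∀ a ∈ Set.range f, ∀ b ∈ Set.range f, a * b = b * a := by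
    rintro _ ⟨i, rfl⟩ _ ⟨j, rfl⟩
    exact hf i j
  have : IsMulCommutative (Algebra.adjoin R (Set.range f)) := Algebra.isMulCommutative_adjoin R h
  let F : σ → Algebra.adjoin R (Set.range f) := fun i => ⟨f i, Algebra.subset_adjoin ⟨i, rfl⟩⟩
  refine ⟨(Algebra.adjoin R (Set.range f)).val.comp (MvPolynomial.aeval F), fun i => ?_⟩
  change ((MvPolynomial.aeval F (MvPolynomial.X i) : Algebra.adjoin R (Set.range f)) : B) = f i
  rw [aeval_X]

/-- The evaluation of polynomials at the commuting operators `orderedMul`. -/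
def orderedHom : MvPolynomial (Fin n) ℂ →ₐ[ℂ] Module.End ℂ (Env n lam) :=
  (exists_algHom_of_commute (orderedMul n lam) (orderedMul_comm n lam)).choose

theorem orderedHom_X (j : Fin n) :
    orderedHom n lam (MvPolynomial.X j) = orderedMul n lam j :=
  (exists_algHom_of_commute (orderedMul n lam) (orderedMul_comm n lam)).choose_spec j

/-- The element of the enveloping algebra with a given symbol: the polynomial with the time
variable written last. -/
def ofSymbol : MvPolynomial (Fin n) ℂ →ₗ[ℂ] Env n lam :=
  LinearMap.applyₗ 1 ∘ₗ (orderedHom n lam).toLinearMap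

theorem ofSymbol_apply (p : MvPolynomial (Fin n) ℂ) : ofSymbol n lam p = orderedHom n lam p 1 :=
  rfl

theorem ofSymbol_C (c : ℂ) : ofSymbol n lam (C c) = algebraMap ℂ _ c := by
  rw [ofSymbol_apply, ← algebraMap_eq, AlgHom.commutes, Module.algebraMap_end_apply,
    Algebra.algebraMap_eq_smul_one]

theorem ofSymbol_one : ofSymbol n lam 1 = 1 := by
  rw [ofSymbol_apply, map_one (orderedHom n lam), Module.End.one_apply]

theorem ofSymbol_X_zero_mul (p : MvPolynomial (Fin n) ℂ) :
    ofSymbol n lam (MvPolynomial.X 0 * p) = ofSymbol n lam p * Kappa.X n lam 0 := by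
  rw [ofSymbol_apply, map_mul, orderedHom_X, Module.End.mul_apply, orderedMul_zero]
  rfl

theorem ofSymbol_X_mul {j : Fin n} (hj : j ≠ 0) (p : MvPolynomial (Fin n) ℂ) :
    ofSymbol n lam (MvPolynomial.X j * p) = Kappa.X n lam j * ofSymbol n lam p := by
  rw [ofSymbol_apply, map_mul, orderedHom_X, Module.End.mul_apply, orderedMul_of_ne n lam hj]
  rfl

/-- The commutator with `x₀` is a derivation of `U`, given on generators by `i lam` times the Euler
derivation. -/
theorem X_zero_mul_ofSymbol (p : MvPolynomial (Fin n) ℂ) :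
    Kappa.X n lam 0 * ofSymbol n lam p = ofSymbol n lam p * Kappa.X n lam 0 +
      (Complex.I * lam) • ofSymbol n lam (polyEuler n p) := by
  induction p using MvPolynomial.induction_on with
  | C c => rw [ofSymbol_C, ← algebraMap_eq, Derivation.map_algebraMap]; simp [Algebra.commutes]
  | add p q hp hq => simp only [map_add, mul_add, add_mul, hp, hq, smul_add]; abel
  | mul_X p j hp =>
    rw [mul_comm, Derivation.leibniz, smul_eq_mul, smul_eq_mul]
    by_cases hj : j = 0
    · subst hj
      rw [polyEuler_X_zero, mul_zero, add_zero, ofSymbol_X_zero_mul, ofSymbol_X_zero_mul,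
        ← mul_assoc, hp, add_mul, smul_mul_assoc]
    · rw [polyEuler_X n hj, map_add, ofSymbol_X_mul n lam hj, ofSymbol_X_mul n lam hj, mul_comm p,
        ofSymbol_X_mul n lam hj, ← mul_assoc, X_zero_mul_X n lam hj, add_mul, mul_assoc, hp,
        mul_add, mul_smul_comm, smul_add, smul_mul_assoc, mul_assoc]
      abel

/-- At `p = 1` this shows that the ordered monomials span `U`; the converse composition below shows
that they are independent. -/
theorem ofSymbol_symbolHom (a : Env n lam) (p : MvPolynomial (Fin n) ℂ) :
    ofSymbol n lam (symbolHom n lam a p) = a * ofSymbol n lam p := by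
  induction a using env_induction generalizing p with
  | algebraMap c =>
    rw [AlgHom.commutes, Module.algebraMap_end_apply, map_smul, Algebra.smul_def]
  | X j =>
    by_cases hj : j = 0
    · subst hj
      rw [symbolHom_X_zero, map_add, ofSymbol_X_zero_mul, map_smul, X_zero_mul_ofSymbol]
    · rw [symbolHom_X n lam hj, ofSymbol_X_mul n lam hj]
  | add a b ha hb => simp [ha, hb, add_mul]
  | mul a b ha hb => simp [ha, hb, mul_assoc]

theorem symbolHom_ofSymbol (p : MvPolynomial (Fin n) ℂ) :
    symbolHom n lam (ofSymbol n lam p) 1 = p := by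
  -- Left multiplications commute with the right multiplication by `x₀`, which on symbols is
  -- multiplication by the time variable.
  have hc : ∀ (a : Env n lam) (q : MvPolynomial (Fin n) ℂ),
      symbolHom n lam a (MvPolynomial.X 0 * q) = MvPolynomial.X 0 * symbolHom n lam a q := by
    intro a
    induction a using env_induction with
    | algebraMap c => intro q; simp [Module.algebraMap_end_apply]
    | X j =>
      intro q
      by_cases hj : j = 0
      · subst hj
        rw [symbolHom_X_zero, symbolHom_X_zero, Derivation.leibniz, polyEuler_X_zero, smul_zero,
          add_zero, smul_eq_mul, mul_add, mul_smul_comm]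
      · rw [symbolHom_X n lam hj, symbolHom_X n lam hj, mul_left_comm]
    | add a b ha hb => intro q; simp [ha, hb, mul_add]
    | mul a b ha hb => intro q; simp [ha, hb]
  induction p using MvPolynomial.induction_on with
  | C c => rw [ofSymbol_C, AlgHom.commutes, Module.algebraMap_end_apply, smul_eq_C_mul, mul_one]
  | add p q hp hq => simp [hp, hq]
  | mul_X p j hp =>
    rw [mul_comm]
    by_cases hj : j = 0
    · subst hj
      rw [ofSymbol_X_zero_mul, map_mul, Module.End.mul_apply, symbolHom_X_zero,
        Derivation.map_one_eq_zero, smul_zero, add_zero, hc, hp]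
    · rw [ofSymbol_X_mul n lam hj, map_mul, Module.End.mul_apply, symbolHom_X n lam hj, hp]

/-- The symbol of an element of the enveloping algebra: the polynomial which gives it when the time
variable is written last. -/
def symbol : Env n lam ≃ₗ[ℂ] MvPolynomial (Fin n) ℂ :=
  LinearEquiv.ofLinearMap (LinearMap.applyₗ 1 ∘ₗ (symbolHom n lam).toLinearMap) (ofSymbol n lam)
    (LinearMap.ext (symbolHom_ofSymbol n lam))
    (LinearMap.ext fun a => (ofSymbol_symbolHom n lam a 1).trans (by rw [ofSymbol_one, mul_one]; rfl))

theorem symbol_apply (a : Env n lam) : symbol n lam a = symbolHom n lam a 1 := rfl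

theorem symbol_symm_apply (p : MvPolynomial (Fin n) ℂ) :
    (symbol n lam).symm p = ofSymbol n lam p := rfl

theorem symbol_mul (a b : Env n lam) : symbol n lam (a * b) = symbolHom n lam a (symbol n lam b) := by
  rw [symbol_apply, map_mul, Module.End.mul_apply, symbol_apply]

theorem symbol_X (j : Fin n) : symbol n lam (Kappa.X n lam j) = MvPolynomial.X j := by
  rw [symbol_apply]
  by_cases hj : j = 0
  · subst hj
    rw [symbolHom_X_zero, Derivation.map_one_eq_zero, smul_zero, add_zero, mul_one]
  · rw [symbolHom_X n lam hj, mul_one]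

theorem symbol_mul_X_zero (a : Env n lam) :
    symbol n lam (a * Kappa.X n lam 0) = MvPolynomial.X 0 * symbol n lam a := by
  rw [← LinearEquiv.eq_symm_apply, symbol_symm_apply, ofSymbol_X_zero_mul, ← symbol_symm_apply,
    LinearEquiv.symm_apply_apply]

/-- Moving `x_j` to the left through the trailing powers of `x₀` uses `x₀ x_j = x_j (x₀ + i lam)`.
-/
theorem symbol_mul_X {j : Fin n} (hj : j ≠ 0) (a : Env n lam) :
    symbol n lam (a * Kappa.X n lam j) =
      MvPolynomial.X j * translate n (Complex.I * lam) (symbol n lam a) := by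
  obtain ⟨p, rfl⟩ : ∃ p, a = ofSymbol n lam p :=
    ⟨symbol n lam a, ((symbol n lam).symm_apply_apply a).symm⟩
  have h2 : ∀ p, symbol n lam (ofSymbol n lam p) = p := (symbol n lam).apply_symm_apply
  rw [h2]
  induction p using MvPolynomial.induction_on with
  | C c =>
    rw [ofSymbol_C, ← Algebra.smul_def, map_smul, symbol_X, ← algebraMap_eq, AlgHom.commutes,
      Algebra.smul_def, mul_comm]
  | add p q hp hq => simp only [map_add, add_mul, mul_add, hp, hq]
  | mul_X p i hp =>
    rw [mul_comm]
    by_cases hi : i = 0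
    · subst hi
      rw [ofSymbol_X_zero_mul, mul_assoc, X_zero_mul_X n lam hj, mul_add, map_add, ← mul_assoc,
        symbol_mul_X_zero, mul_smul_comm, map_smul, hp, map_mul, translate_X_zero, smul_eq_C_mul]
      ring
    · rw [ofSymbol_X_mul n lam hi, mul_assoc, symbol_mul, symbolHom_X n lam hi, hp, map_mul,
        translate_X n _ hi]
      ring

end Kappa
end

noncomputable section

/-! ### Products, degrees and ideals of symbols -/

namespace Kappa

open MvPolynomial UniversalEnvelopingAlgebra

variable (n : ℕ) [NeZero n] (lam : ℝ)

theorem translate_monomial (c : ℂ) (b : Fin n →₀ ℕ) (a : ℂ) :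
    translate n c (monomial b a) =
      monomial (b.erase 0) a * (MvPolynomial.X 0 + C c) ^ b 0 := by
  have h : ∀ b : Fin n →₀ ℕ, b 0 = 0 → translate n c (monomial b a) = monomial b a := by
    intro b hb
    rw [monomial_eq, map_mul, ← algebraMap_eq, AlgHom.commutes, Finsupp.prod, map_prod]
    congr 1
    refine Finset.prod_congr rfl fun j hj => ?_
    have hj0 : j ≠ 0 := by
      rintro rfl
      exact Finsupp.mem_support_iff.1 hj hb
    rw [map_pow, translate_X n c hj0]
  have hb : (monomial b a : MvPolynomial (Fin n) ℂ) =
      monomial (b.erase 0) a * MvPolynomial.X 0 ^ b 0 := by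
    rw [X_pow_eq_monomial, monomial_mul, Finsupp.erase_add_single, mul_one]
  rw [hb, map_mul, map_pow, h _ (by simp), translate_X_zero]

theorem degreeOf_X_add_C_pow_sub_le (c : ℂ) (m : ℕ) :
    degreeOf 0 ((MvPolynomial.X 0 + C c) ^ m - MvPolynomial.X 0 ^ m :
      MvPolynomial (Fin n) ℂ) ≤ m - 1 := by
  induction m with
  | zero => simp
  | succ m ih =>
    have h : ((MvPolynomial.X 0 + C c) ^ (m + 1) - MvPolynomial.X 0 ^ (m + 1) :
        MvPolynomial (Fin n) ℂ) = C c * (MvPolynomial.X 0 + C c) ^ m +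
        ((MvPolynomial.X 0 + C c) ^ m - MvPolynomial.X 0 ^ m) * MvPolynomial.X 0 := by ring
    rw [h, Nat.add_sub_cancel]
    refine (degreeOf_add_le _ _ _).trans (max_le ?_ ?_)
    · refine (degreeOf_C_mul_le _ _ _).trans ((degreeOf_pow_le _ _ _).trans ?_)
      have : degreeOf 0 (MvPolynomial.X 0 + C c : MvPolynomial (Fin n) ℂ) ≤ 1 :=
        (degreeOf_add_le _ _ _).trans (by simp)
      nlinarith
    · cases m with
      | zero => simp
      | succ m =>
        refine (degreeOf_mul_le _ _ _).trans ?_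
        rw [degreeOf_X_self]
        omega

theorem translate_sub_self_eq_sum (c : ℂ) (p : MvPolynomial (Fin n) ℂ) :
    translate n c p - p = ∑ b ∈ p.support, monomial (b.erase 0) (coeff b p) *
      ((MvPolynomial.X 0 + C c) ^ b 0 - MvPolynomial.X 0 ^ b 0) := by
  conv_lhs => rw [← support_sum_monomial_coeff p, map_sum, ← Finset.sum_sub_distrib]
  refine Finset.sum_congr rfl fun b _ => ?_
  rw [translate_monomial, mul_sub, X_pow_eq_monomial, monomial_mul, Finsupp.erase_add_single,
    mul_one]

theorem degreeOf_monomial_le (n : ℕ) (b : Fin n →₀ ℕ) (a : ℂ) (j : Fin n) :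
    degreeOf j (monomial b a) ≤ b j := by
  by_cases h : a = 0
  · simp [h]
  · rw [degreeOf_monomial_eq b j h]

/-- A translation of `x₀` preserves leading terms in `x₀`. With truncated subtraction the bound
gives no strict drop in degree zero, where the difference vanishes instead. -/
theorem degreeOf_translate_sub_le (c : ℂ) (p : MvPolynomial (Fin n) ℂ) :
    degreeOf 0 (translate n c p - p) ≤ degreeOf 0 p - 1 := by
  rw [translate_sub_self_eq_sum]
  refine (degreeOf_sum_le _ _ _).trans (Finset.sup_le fun b hb => ?_)
  refine (degreeOf_mul_le _ _ _).trans ?_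
  have h1 := degreeOf_monomial_le n (b.erase 0) (coeff b p) 0
  have h2 := degreeOf_X_add_C_pow_sub_le n c (b 0)
  have h3 := monomial_le_degreeOf 0 hb
  rw [Finsupp.erase_same] at h1
  omega

theorem translate_eq_self {p : MvPolynomial (Fin n) ℂ} (h : degreeOf 0 p = 0) (c : ℂ) :
    translate n c p = p := by
  rw [← sub_eq_zero, translate_sub_self_eq_sum]
  refine Finset.sum_eq_zero fun b hb => ?_
  have h3 := monomial_le_degreeOf 0 hb
  rw [h, Nat.le_zero] at h3
  simp [h3]

theorem degreeOf_translate_le (c : ℂ) (p : MvPolynomial (Fin n) ℂ) :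
    degreeOf 0 (translate n c p) ≤ degreeOf 0 p := by
  have h := degreeOf_translate_sub_le n c p
  rw [← sub_add_cancel (translate n c p) p]
  exact (degreeOf_add_le _ _ _).trans (max_le (by omega) le_rfl)

/-- The product of symbols: `mulSymbol q p` is the symbol of `a * b`, when `p` is the symbol of `a`
and `q` that of `b`. -/
def mulSymbol : MvPolynomial (Fin n) ℂ →ₗ[ℂ] Module.End ℂ (MvPolynomial (Fin n) ℂ) :=
  (basisMonomials (Fin n) ℂ).constr ℂ fun b => LinearMap.mulLeft ℂ (monomial b 1) ∘ₗ
    (translate n (spaceDegree n b * (Complex.I * lam))).toLinearMap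

theorem mulSymbol_monomial (b : Fin n →₀ ℕ) (c : ℂ) (p : MvPolynomial (Fin n) ℂ) :
    mulSymbol n lam (monomial b c) p =
      monomial b c * translate n (spaceDegree n b * (Complex.I * lam)) p := by
  have h : (monomial b c : MvPolynomial (Fin n) ℂ) = c • basisMonomials (Fin n) ℂ b := by
    rw [coe_basisMonomials, smul_monomial, smul_eq_mul, mul_one]
  rw [h, map_smul, mulSymbol, Module.Basis.constr_basis, coe_basisMonomials]
  simp

theorem mulSymbol_eq_sum (q p : MvPolynomial (Fin n) ℂ) :
    mulSymbol n lam q p = ∑ b ∈ q.support, monomial b (coeff b q) *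
      translate n (spaceDegree n b * (Complex.I * lam)) p := by
  conv_lhs => rw [← support_sum_monomial_coeff q, map_sum, LinearMap.sum_apply]
  exact Finset.sum_congr rfl fun b _ => mulSymbol_monomial n lam b _ p

theorem spaceDegree_add_single_zero (b : Fin n →₀ ℕ) :
    spaceDegree n (b + Finsupp.single 0 1) = spaceDegree n b := by
  refine Finset.sum_congr rfl fun j hj => ?_
  simp [(Finset.ne_of_mem_erase hj).symm]

theorem spaceDegree_add_single {j : Fin n} (hj : j ≠ 0) (b : Fin n →₀ ℕ) :
    spaceDegree n (b + Finsupp.single j 1) = spaceDegree n b + 1 := by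
  simp only [spaceDegree, Finsupp.add_apply, Finset.sum_add_distrib]
  congr 1
  rw [Finset.sum_eq_single j (fun i _ hi => Finsupp.single_eq_of_ne hi)]
  · simp
  · intro h
    exact (h (Finset.mem_erase.2 ⟨hj, Finset.mem_univ _⟩)).elim

theorem mulSymbol_mul_X_zero (q p : MvPolynomial (Fin n) ℂ) :
    mulSymbol n lam (q * MvPolynomial.X 0) p = MvPolynomial.X 0 * mulSymbol n lam q p := by
  induction q using MvPolynomial.induction_on' with
  | monomial b c =>
    rw [MvPolynomial.X, monomial_mul, mulSymbol_monomial, mulSymbol_monomial,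
      spaceDegree_add_single_zero, ← mul_assoc (monomial _ _) (monomial _ _), monomial_mul,
      add_comm b, mul_comm c]
  | add q q' hq hq' => simp only [add_mul, map_add, LinearMap.add_apply, hq, hq', mul_add]

theorem mulSymbol_mul_X {j : Fin n} (hj : j ≠ 0) (q p : MvPolynomial (Fin n) ℂ) :
    mulSymbol n lam (q * MvPolynomial.X j) p =
      mulSymbol n lam q (MvPolynomial.X j * translate n (Complex.I * lam) p) := by
  induction q using MvPolynomial.induction_on' with
  | monomial b c =>
    rw [mulSymbol_monomial, map_mul (translate n _), translate_X n _ hj, translate_translate,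
      MvPolynomial.X, monomial_mul, mulSymbol_monomial, spaceDegree_add_single n hj,
      ← mul_assoc (monomial _ _) (monomial _ _), monomial_mul,
      Nat.cast_add, Nat.cast_one, add_mul, one_mul]
  | add q q' hq hq' => simp only [add_mul, map_add, LinearMap.add_apply, hq, hq']

/-- Induction on the right factor moves its variables one at a time into the left factor: `x₀` stays
last, and each `x_j` costs one translation by `i lam`. -/
theorem symbol_mul_eq (a b : Env n lam) :
    symbol n lam (a * b) = mulSymbol n lam (symbol n lam b) (symbol n lam a) := by
  obtain ⟨q, rfl⟩ : ∃ q, b = ofSymbol n lam q :=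
    ⟨symbol n lam b, ((symbol n lam).symm_apply_apply b).symm⟩
  have h2 : ∀ p, symbol n lam (ofSymbol n lam p) = p := (symbol n lam).apply_symm_apply
  rw [h2]
  induction q using MvPolynomial.induction_on generalizing a with
  | C c =>
    rw [ofSymbol_C, ← Algebra.commutes, ← Algebra.smul_def, map_smul]
    refine Eq.trans ?_ (mulSymbol_monomial n lam 0 c _).symm
    rw [smul_eq_C_mul]
    simp [spaceDegree]
  | add q q' hq hq' => simp only [map_add, mul_add, LinearMap.add_apply, hq, hq']
  | mul_X q j hq =>
    by_cases hj : j = 0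
    · subst hj
      rw [mulSymbol_mul_X_zero, mul_comm q, ofSymbol_X_zero_mul, ← mul_assoc, symbol_mul_X_zero, hq]
    · rw [mulSymbol_mul_X n lam hj, mul_comm q, ofSymbol_X_mul n lam hj, ← mul_assoc, hq,
        symbol_mul_X n lam hj]

theorem mulSymbol_of_degreeOf_eq_zero (q : MvPolynomial (Fin n) ℂ) {p : MvPolynomial (Fin n) ℂ}
    (hp : degreeOf 0 p = 0) : mulSymbol n lam q p = q * p := by
  rw [mulSymbol_eq_sum]
  conv_rhs => rw [← support_sum_monomial_coeff q, Finset.sum_mul]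
  exact Finset.sum_congr rfl fun b _ => by rw [translate_eq_self n hp]

/-- The star product of symbols and the ordinary product have the same leading part in `x₀`; this is
the filtration argument behind `eq_of_mul_eq`. -/
theorem degreeOf_mulSymbol_sub_le (q p : MvPolynomial (Fin n) ℂ) :
    degreeOf 0 (mulSymbol n lam q p - q * p) ≤ degreeOf 0 q + (degreeOf 0 p - 1) := by
  have h : mulSymbol n lam q p - q * p = ∑ b ∈ q.support, monomial b (coeff b q) *
      (translate n (spaceDegree n b * (Complex.I * lam)) p - p) := by
    conv_lhs => rw [mulSymbol_eq_sum]
    conv_lhs => enter [2, 1]; rw [← support_sum_monomial_coeff q]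
    rw [Finset.sum_mul, ← Finset.sum_sub_distrib]
    exact Finset.sum_congr rfl fun b _ => by rw [mul_sub]
  rw [h]
  refine (degreeOf_sum_le _ _ _).trans (Finset.sup_le fun b hb => ?_)
  refine (degreeOf_mul_le _ _ _).trans (add_le_add ?_ (degreeOf_translate_sub_le n _ p))
  exact (degreeOf_monomial_le n b _ 0).trans (monomial_le_degreeOf 0 hb)

theorem mulSymbol_X_zero (q : MvPolynomial (Fin n) ℂ) :
    mulSymbol n lam q (MvPolynomial.X 0) =
      MvPolynomial.X 0 * q + (Complex.I * lam) • polyEuler n q := by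
  have h := symbol_mul_eq n lam (Kappa.X n lam 0) (ofSymbol n lam q)
  have h2 : symbol n lam (ofSymbol n lam q) = q := (symbol n lam).apply_symm_apply q
  rw [h2, symbol_X, symbol_mul, h2, symbolHom_X_zero] at h
  exact h.symm

theorem coeff_polyEuler (p : MvPolynomial (Fin n) ℂ) (b : Fin n →₀ ℕ) :
    coeff b (polyEuler n p) = spaceDegree n b * coeff b p := by
  induction p using MvPolynomial.induction_on' with
  | monomial d c =>
    rw [polyEuler_monomial, coeff_smul, coeff_monomial, smul_eq_mul]
    split_ifs with h
    · rw [h]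
    · simp
  | add p q hp hq => simp only [map_add, coeff_add, hp, hq, mul_add]

theorem totalDegree_polyEuler_le (p : MvPolynomial (Fin n) ℂ) :
    totalDegree (polyEuler n p) ≤ totalDegree p := by
  refine Finset.sup_mono fun b hb => ?_
  rw [mem_support_iff, coeff_polyEuler] at hb
  exact mem_support_iff.2 (right_ne_zero_of_mul hb)

/-- An element `m ≠ 0` of the enveloping algebra that intertwines the generators with their images
`σ(x_j)` up to a constant forces the `σ(x_j)` to be the generators up to a shift of `x₀`. -/
theorem eq_of_mul_eq {m : Env n lam} (hm : m ≠ 0) {s : Fin n → Env n lam} {c : ℂ}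
    (h0 : s 0 * m = m * Kappa.X n lam 0 + c • m)
    (hs : ∀ j, j ≠ 0 → s j * m = m * Kappa.X n lam j) :
    (∀ j, j ≠ 0 → s j = Kappa.X n lam j) ∧ ∃ b : Fin n →₀ ℕ,
      s 0 = Kappa.X n lam 0 + algebraMap ℂ _ (c - Complex.I * lam * spaceDegree n b) := by
  set q := symbol n lam m with hq
  have hq0 : q ≠ 0 := by rwa [hq, ne_eq, LinearEquiv.map_eq_zero_iff]
  constructor
  · intro j hj
    set p := symbol n lam (s j) with hp
    have h := congrArg (symbol n lam) (hs j hj)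
    rw [symbol_mul_eq, symbol_mul_X n lam hj, ← hq, ← hp] at h
    have hX : degreeOf 0 (MvPolynomial.X j : MvPolynomial (Fin n) ℂ) = 0 := degreeOf_X_of_ne hj.symm
    -- The right-hand side has `x₀`-degree at most that of `q`. If `p` contained `x₀`, then `q * p`
    -- would have larger degree, and the noncommutative correction could not compensate.
    have hdeg : degreeOf 0 p = 0 := by
      by_contra hd
      have hp0 : p ≠ 0 := by
        rintro h
        exact hd (by rw [h, degreeOf_zero])
      have h1 := degreeOf_mulSymbol_sub_le n lam q p
      have h2 : q * p = MvPolynomial.X j * translate n (Complex.I * lam) q -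
          (mulSymbol n lam q p - q * p) := by rw [h]; ring
      have h3 := congrArg (degreeOf 0) h2
      rw [degreeOf_mul_eq hq0 hp0] at h3
      have h4 := degreeOf_sub_le 0 (MvPolynomial.X j * translate n (Complex.I * lam) q)
        (mulSymbol n lam q p - q * p)
      have h5 := degreeOf_mul_le 0 (MvPolynomial.X j) (translate n (Complex.I * lam) q)
      have h6 := degreeOf_translate_le n (Complex.I * lam) q
      rw [hX] at h5
      rcases le_max_iff.1 h4 with h7 | h7 <;> omega
    rw [mulSymbol_of_degreeOf_eq_zero n lam q hdeg] at h
    -- Now the product is the ordinary one. The right side has smaller `x₀`-degree than `q`, or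
    -- vanishes if `q` is free of `x₀`, so `p - X j` must be zero.
    have h1 : q * (p - MvPolynomial.X j) =
        MvPolynomial.X j * (translate n (Complex.I * lam) q - q) := by
      rw [mul_sub, h]; ring
    have h2 : p = MvPolynomial.X j := by
      by_contra hne
      have hne' : p - MvPolynomial.X j ≠ 0 := sub_ne_zero.2 hne
      by_cases he : degreeOf 0 q = 0
      · rw [translate_eq_self n he, sub_self, mul_zero] at h1
        exact mul_ne_zero hq0 hne' h1
      · have h3 := congrArg (degreeOf 0) h1
        rw [degreeOf_mul_eq hq0 hne'] at h3
        have h5 := degreeOf_mul_le 0 (MvPolynomial.X j) (translate n (Complex.I * lam) q - q)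
        have h6 := degreeOf_translate_sub_le n (Complex.I * lam) q
        rw [hX] at h5
        omega
    apply (symbol n lam).injective
    rw [← hp, h2, symbol_X]
  · set p := symbol n lam (s 0) with hp
    have h := congrArg (symbol n lam) h0
    rw [symbol_mul_eq, map_add, symbol_mul_X_zero, map_smul, ← hq, ← hp] at h
    have hX : degreeOf 0 (MvPolynomial.X 0 * q : MvPolynomial (Fin n) ℂ) = degreeOf 0 q + 1 := by
      rw [degreeOf_mul_eq (X_ne_zero 0) hq0, degreeOf_X_self, add_comm]
    have h1 := degreeOf_mulSymbol_sub_le n lam q p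
    have hsm : degreeOf 0 (c • q) ≤ degreeOf 0 q := by
      rw [smul_eq_C_mul]
      exact degreeOf_C_mul_le _ _ _
    have hdeg : degreeOf 0 p ≤ 1 := by
      by_contra! hd
      have hp0 : p ≠ 0 := by
        rintro h
        rw [h, degreeOf_zero] at hd
        omega
      have h2 : q * p = MvPolynomial.X 0 * q + c • q - (mulSymbol n lam q p - q * p) := by
        rw [h]; ring
      have h3 := congrArg (degreeOf 0) h2
      rw [degreeOf_mul_eq hq0 hp0] at h3
      have h4 := degreeOf_sub_le 0 (MvPolynomial.X 0 * q + c • q) (mulSymbol n lam q p - q * p)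
      have h5 := degreeOf_add_le 0 (MvPolynomial.X 0 * q) (c • q)
      rcases le_max_iff.1 h4 with h7 | h7
      · rcases le_max_iff.1 h5 with h8 | h8 <;> omega
      · omega
    set β := p - MvPolynomial.X 0 with hβ
    have hpβ : p = MvPolynomial.X 0 + β := by rw [hβ]; ring
    -- `p` has `x₀`-degree at most one. After the leading terms `X 0 * q` cancel, the remaining
    -- terms have degree at most that of `q`, so `β` is free of `x₀`.
    have hβ0 : degreeOf 0 β = 0 := by
      by_cases hb : β = 0
      · rw [hb, degreeOf_zero]
      have h2 : q * β = c • q - (mulSymbol n lam q p - q * p) := by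
        rw [h, hβ]; ring
      have h3 := congrArg (degreeOf 0) h2
      rw [degreeOf_mul_eq hq0 hb] at h3
      have h4 := degreeOf_sub_le 0 (c • q) (mulSymbol n lam q p - q * p)
      rcases le_max_iff.1 h4 with h7 | h7 <;> omega
    rw [hpβ, map_add, mulSymbol_X_zero, mulSymbol_of_degreeOf_eq_zero n lam q hβ0] at h
    have h2 : q * (C c - β) = (Complex.I * lam) • polyEuler n q := by
      rw [smul_eq_C_mul (q) c] at h
      linear_combination -h
    -- The Euler derivation does not raise the total degree, so the factor `c - β` is a constant:
    -- `q` is an eigenvector of the derivation up to the factor `i lam`.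
    have h3 : totalDegree (C c - β) = 0 := by
      by_cases hb : C c - β = 0
      · rw [hb, totalDegree_zero]
      have h4 := congrArg totalDegree h2
      rw [totalDegree_mul_of_isDomain hq0 hb] at h4
      have h5 := totalDegree_smul_le (Complex.I * lam) (polyEuler n q)
      have h6 := totalDegree_polyEuler_le n q
      omega
    rw [totalDegree_eq_zero_iff_eq_C] at h3
    set e := coeff 0 (C c - β) with he
    -- The eigenvalue is read off at any monomial `b` of `q`, where the Euler derivation acts by the
    -- space degree of `b`.
    obtain ⟨b, hb⟩ := ne_zero_iff.1 hq0
    refine ⟨b, ?_⟩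
    have h4 := congrArg (coeff b) h2
    rw [h3, mul_comm, coeff_C_mul, coeff_smul, coeff_polyEuler, smul_eq_mul, ← mul_assoc] at h4
    have h5 := mul_right_cancel₀ hb h4
    apply (symbol n lam).injective
    rw [← hp, hpβ, map_add, symbol_X, Algebra.algebraMap_eq_smul_one, map_smul, symbol_apply n lam 1,
      map_one (symbolHom n lam), Module.End.one_apply, ← h5, smul_eq_C_mul, mul_one, map_sub, ← h3]
    ring

/-- The left ideal generated by the `x_j` with `j ∈ s`. -/
def leftIdeal (s : Set (Fin n)) : Submodule (Env n lam) (Env n lam) :=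
  Submodule.span (Env n lam) (Kappa.X n lam '' s)

/-- The symbol of `a x_j` is `X j` times a translate of the symbol of `a`. Translations are
invertible, so the left ideal corresponds to the ordinary ideal. -/
theorem mem_leftIdeal_iff {s : Set (Fin n)} (hs : 0 ∉ s) (a : Env n lam) :
    a ∈ leftIdeal n lam s ↔ symbol n lam a ∈ Ideal.span (MvPolynomial.X '' s) := by
  constructor
  · intro ha
    obtain ⟨f, hf, rfl⟩ := (Finsupp.mem_span_image_iff_linearCombination _).1 ha
    rw [Finsupp.linearCombination_apply, Finsupp.sum, map_sum]
    refine Ideal.sum_mem _ fun j hj => ?_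
    have hjs : j ∈ s := hf hj
    rw [smul_eq_mul, symbol_mul_X n lam (fun h => hs (h ▸ hjs))]
    exact Ideal.mul_mem_right _ _ (Ideal.subset_span ⟨j, hjs, rfl⟩)
  · intro ha
    obtain ⟨f, hf, hfa⟩ := (Finsupp.mem_span_image_iff_linearCombination _).1 ha
    rw [← (symbol n lam).symm_apply_apply a, ← hfa, Finsupp.linearCombination_apply, Finsupp.sum,
      map_sum]
    refine Submodule.sum_mem _ fun j hj => ?_
    have hjs : j ∈ s := hf hj
    have hj0 : j ≠ 0 := fun h => hs (h ▸ hjs)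
    have h1 : (symbol n lam).symm (f j • MvPolynomial.X j) =
        (symbol n lam).symm (translate n (-(Complex.I * lam)) (f j)) • Kappa.X n lam j := by
      rw [LinearEquiv.symm_apply_eq, smul_eq_mul, smul_eq_mul, symbol_mul_X n lam hj0,
        LinearEquiv.apply_symm_apply, translate_translate, add_neg_cancel, translate_zero, mul_comm]
    rw [h1]
    exact Submodule.smul_mem _ _ (Submodule.subset_span ⟨j, hjs, rfl⟩)

theorem mem_span_X_of_X_mul_mem (n : ℕ) {s : Set (Fin n)} {j : Fin n} (hj : j ∉ s)
    {p : MvPolynomial (Fin n) ℂ} (hp : MvPolynomial.X j * p ∈ Ideal.span (MvPolynomial.X '' s)) :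
    p ∈ Ideal.span (MvPolynomial.X '' s : Set (MvPolynomial (Fin n) ℂ)) := by
  rw [mem_ideal_span_X_image] at hp ⊢
  intro b hb
  obtain ⟨i, hi, h⟩ := hp (Finsupp.single j 1 + b) (by
    rw [mem_support_iff, coeff_X_mul]
    exact mem_support_iff.1 hb)
  refine ⟨i, hi, fun h0 => h ?_⟩
  have : j ≠ i := fun h => hj (h ▸ hi)
  simp [h0, this]

/-- A variable outside `s` is regular modulo the variables in `s`. The translation that accompanies
a space generator is undone at the end; it preserves the ideal because it fixes the variables in
`s`. -/
theorem mem_leftIdeal_of_mul_X_mem {s : Set (Fin n)} (hs : 0 ∉ s) {j : Fin n} (hj : j ∉ s)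
    {a : Env n lam} (ha : a * Kappa.X n lam j ∈ leftIdeal n lam s) : a ∈ leftIdeal n lam s := by
  rw [mem_leftIdeal_iff n lam hs] at ha ⊢
  by_cases hj0 : j = 0
  · subst hj0
    rw [symbol_mul_X_zero] at ha
    exact mem_span_X_of_X_mul_mem n hj ha
  · rw [symbol_mul_X n lam hj0] at ha
    have h := Ideal.mem_map_of_mem (translate n (-(Complex.I * lam)))
      (mem_span_X_of_X_mul_mem n hj ha)
    rw [translate_translate, neg_add_cancel, translate_zero, Ideal.map_span, Set.image_image] at h
    rwa [Set.image_congr fun i hi => translate_X n _ (fun h : i = 0 => hs (h ▸ hi))] at h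

end Kappa
end

noncomputable section

/-! ### The top Hochschild homology of the enveloping algebra -/

namespace Kappa

open Hochschild UniversalEnvelopingAlgebra

variable (n : ℕ) [NeZero n] (lam : ℝ)

/-- The left ideal is two-sided as long as it avoids `x₀`, by `x_i x₀ = (x₀ - i lam) x_i`. With `x₀`
among the generators this can fail, which is why `x₀` is divided out last. -/
theorem mul_X_mem_leftIdeal (s : Set (Fin n)) (hs : 0 ∉ s) (j : Fin n) {a : Env n lam}
    (ha : a ∈ leftIdeal n lam s) : a * X n lam j ∈ leftIdeal n lam s := by
  obtain ⟨f, hf, rfl⟩ := (Finsupp.mem_span_image_iff_linearCombination _).1 ha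
  rw [Finsupp.linearCombination_apply, Finsupp.sum, Finset.sum_mul]
  refine Submodule.sum_mem _ fun i hi => ?_
  have his : i ∈ s := hf hi
  have hi0 : i ≠ 0 := fun h => hs (h ▸ his)
  have hX : X n lam i ∈ leftIdeal n lam s := Submodule.subset_span ⟨i, his, rfl⟩
  rw [smul_mul_assoc]
  refine Submodule.smul_mem _ _ ?_
  by_cases hj : j = 0
  · subst hj
    have h : X n lam i * X n lam 0 = (X n lam 0 - algebraMap ℂ _ (Complex.I * lam)) • X n lam i := by
      rw [smul_eq_mul, sub_mul, X_zero_mul_X n lam hi0, ← Algebra.smul_def, add_sub_cancel_right]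
    rw [h]
    exact Submodule.smul_mem _ _ hX
  · rw [X_mul_X_comm n lam hi0 hj]
    exact Submodule.smul_mem _ (X n lam j) hX

/-- The quotient of the enveloping algebra by the left ideal generated by the `x_j` with `j ∈ s`. -/
def EnvQuot (s : Set (Fin n)) : Type := Env n lam ⧸ leftIdeal n lam s

instance (s : Set (Fin n)) : AddCommGroup (EnvQuot n lam s) :=
  inferInstanceAs (AddCommGroup (Env n lam ⧸ leftIdeal n lam s))

instance (s : Set (Fin n)) : Module (Env n lam) (EnvQuot n lam s) :=
  inferInstanceAs (Module (Env n lam) (Env n lam ⧸ leftIdeal n lam s))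

instance (s : Set (Fin n)) : Module ℂ (EnvQuot n lam s) :=
  inferInstanceAs (Module ℂ (Env n lam ⧸ leftIdeal n lam s))

instance (s : Set (Fin n)) : IsScalarTower ℂ (Env n lam) (EnvQuot n lam s) :=
  inferInstanceAs (IsScalarTower ℂ (Env n lam) (Env n lam ⧸ leftIdeal n lam s))

/-- The quotient map. -/
def quotMk (s : Set (Fin n)) : Env n lam →ₗ[Env n lam] EnvQuot n lam s :=
  Submodule.mkQ (leftIdeal n lam s)

theorem quotMk_surjective (s : Set (Fin n)) : Function.Surjective (quotMk n lam s) :=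
  Submodule.mkQ_surjective _

theorem quotMk_eq_zero (s : Set (Fin n)) {a : Env n lam} :
    quotMk n lam s a = 0 ↔ a ∈ leftIdeal n lam s :=
  Submodule.Quotient.mk_eq_zero _

/-- Right multiplication by `x_j` on the quotient. -/
def quotMul (s : Set (Fin n)) (hs : 0 ∉ s) (j : Fin n) :
    EnvQuot n lam s →ₗ[Env n lam] EnvQuot n lam s :=
  Submodule.mapQ _ _ (LinearMap.toSpanSingleton (Env n lam) (Env n lam) (X n lam j))
    fun _ ha => mul_X_mem_leftIdeal n lam s hs j ha

theorem quotMul_mk (s : Set (Fin n)) (hs : 0 ∉ s) (j : Fin n) (a : Env n lam) :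
    quotMul n lam s hs j (quotMk n lam s a) = quotMk n lam s (a * X n lam j) := rfl

theorem quotMul_injective (s : Set (Fin n)) (hs : 0 ∉ s) {j : Fin n} (hj : j ∉ s) :
    Function.Injective (quotMul n lam s hs j) := by
  rw [injective_iff_map_eq_zero]
  intro a ha
  obtain ⟨a, rfl⟩ := quotMk_surjective n lam _ a
  rw [quotMul_mk, quotMk_eq_zero] at ha
  exact (quotMk_eq_zero n lam s).2 (mem_leftIdeal_of_mul_X_mem n lam hs hj ha)

/-- The projection of the quotient that kills `x_j` in addition. -/
def quotProj (s : Set (Fin n)) (j : Fin n) :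
    EnvQuot n lam s →ₗ[Env n lam] EnvQuot n lam (insert j s) :=
  Submodule.factor (Submodule.span_mono (Set.image_mono (Set.subset_insert j s)))

theorem quotProj_mk (s : Set (Fin n)) (j : Fin n) (a : Env n lam) :
    quotProj n lam s j (quotMk n lam s a) = quotMk n lam (insert j s) a := rfl

theorem quotProj_surjective (s : Set (Fin n)) (j : Fin n) :
    Function.Surjective (quotProj n lam s j) := by
  intro a
  obtain ⟨a, rfl⟩ := quotMk_surjective n lam _ a
  exact ⟨quotMk n lam s a, rfl⟩

theorem quot_exact (s : Set (Fin n)) (hs : 0 ∉ s) (j : Fin n) :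
    Function.Exact (quotMul n lam s hs j) (quotProj n lam s j) := by
  intro a
  obtain ⟨a, rfl⟩ := quotMk_surjective n lam _ a
  rw [quotProj_mk, quotMk_eq_zero, leftIdeal, Set.image_insert_eq,
    Submodule.mem_span_insert]
  constructor
  · rintro ⟨c, z, hz, rfl⟩
    refine ⟨quotMk n lam s c, ?_⟩
    rw [quotMul_mk, map_add, (quotMk_eq_zero n lam s).2 hz, add_zero, smul_eq_mul]
  · rintro ⟨c, hc⟩
    obtain ⟨c, rfl⟩ := quotMk_surjective n lam _ c
    rw [quotMul_mk, eq_comm, ← sub_eq_zero, ← map_sub, quotMk_eq_zero] at hc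
    exact ⟨c, _, hc, by rw [smul_eq_mul]; abel⟩

/-- The quotient by the left ideal generated by no element. -/
def quotEmptyEquiv : EnvQuot n lam ∅ ≃ₗ[Env n lam] Env n lam :=
  Submodule.quotEquivOfEqBot _ (by simp [leftIdeal])

theorem quotEmptyEquiv_mk (a : Env n lam) : quotEmptyEquiv n lam (quotMk n lam ∅ a) = a := rfl

attribute [irreducible] EnvQuot

variable {n lam}

section Koszul

variable {M : Type*} [AddCommGroup M] [Module ℂ M] {l r : Env n lam →ₗ[ℂ] Module.End ℂ M}

/-- The operator `x ↦ x x_j - x_j x` on a bimodule. -/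
def adjoint (l r : Env n lam →ₗ[ℂ] Module.End ℂ M) (j : Fin n) : Module.End ℂ M :=
  r (X n lam j) - l (X n lam j)

/-- The bimodule endomorphism of `(U / U (x_i)_{i ∈ s}) ⊗ M` given by right multiplication by
`x_j`. -/
def quotMulTensor (n : ℕ) [NeZero n] (lam : ℝ) (M : Type*) [AddCommGroup M] [Module ℂ M]
    (s : Set (Fin n)) (hs : 0 ∉ s) (j : Fin n) : EnvQuot n lam s ⊗[ℂ] M →ₗ[ℂ] EnvQuot n lam s ⊗[ℂ] M :=
  ((quotMul n lam s hs j).restrictScalars ℂ).rTensor M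

theorem quotMulTensor_tmul (s : Set (Fin n)) (hs : 0 ∉ s) (j : Fin n) (a : Env n lam) (x : M) :
    quotMulTensor n lam M s hs j (quotMk n lam s a ⊗ₜ x) =
      quotMk n lam s (a * X n lam j) ⊗ₜ x :=
  congrArg (· ⊗ₜ x) (quotMul_mk n lam s hs j a)

theorem quot_tmul_ext {N : Type*} [AddCommMonoid N] [Module ℂ N] {s : Set (Fin n)}
    {f g : EnvQuot n lam s ⊗[ℂ] M →ₗ[ℂ] N}
    (h : ∀ (a : Env n lam) x, f (quotMk n lam s a ⊗ₜ x) =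
      g (quotMk n lam s a ⊗ₜ x)) : f = g := by
  refine TensorProduct.ext' fun a x => ?_
  obtain ⟨a, rfl⟩ := quotMk_surjective n lam _ a
  exact h a x

theorem quotMulTensor_comm (s : Set (Fin n)) (hs : 0 ∉ s) {i j : Fin n} (hi : i ≠ 0) (hj : j ≠ 0)
    (z : EnvQuot n lam s ⊗[ℂ] M) : quotMulTensor n lam M s hs i (quotMulTensor n lam M s hs j z) =
      quotMulTensor n lam M s hs j (quotMulTensor n lam M s hs i z) := by
  refine LinearMap.congr_fun (f := quotMulTensor n lam M s hs i ∘ₗ quotMulTensor n lam M s hs j)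
    (g := quotMulTensor n lam M s hs j ∘ₗ quotMulTensor n lam M s hs i) (quot_tmul_ext fun a x => ?_) z
  simp only [LinearMap.comp_apply, quotMulTensor_tmul, mul_assoc, X_mul_X_comm n lam hi hj]

/-- This commutator is the source of the term `n - 1` in the twist: dividing out each space
generator moves the operator of `x₀` by `-i lam`. -/
theorem quotMulTensor_zero_comm (s : Set (Fin n)) (hs : 0 ∉ s) {j : Fin n} (hj : j ≠ 0)
    (z : EnvQuot n lam s ⊗[ℂ] M) : quotMulTensor n lam M s hs 0 (quotMulTensor n lam M s hs j z) =
      quotMulTensor n lam M s hs j ((quotMulTensor n lam M s hs 0 - (Complex.I * lam) • LinearMap.id :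
        Module.End ℂ (EnvQuot n lam s ⊗[ℂ] M)) z) := by
  refine LinearMap.congr_fun (f := quotMulTensor n lam M s hs 0 ∘ₗ quotMulTensor n lam M s hs j)
    (g := quotMulTensor n lam M s hs j ∘ₗ
      (quotMulTensor n lam M s hs 0 - (Complex.I * lam) • LinearMap.id))
    (quot_tmul_ext fun a x => ?_) z
  have h : a * X n lam j * X n lam 0 =
      a * X n lam 0 * X n lam j - (Complex.I * lam) • (a * X n lam j) := by
    rw [mul_assoc a (X n lam 0), X_zero_mul_X n lam hj, mul_add, mul_smul_comm, mul_assoc,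
      add_sub_cancel_right]
  have h' : quotMk n lam s ((Complex.I * lam) • (a * X n lam j)) =
      (Complex.I * lam) • quotMk n lam s (a * X n lam j) :=
    map_smul ((quotMk n lam s).restrictScalars ℂ) _ _
  rw [LinearMap.comp_apply, LinearMap.comp_apply, quotMulTensor_tmul, quotMulTensor_tmul, h,
    LinearMap.sub_apply, LinearMap.smul_apply, LinearMap.id_apply, map_sub, map_sub,
    LinearMap.map_smul (quotMulTensor n lam M s hs j), quotMulTensor_tmul, quotMulTensor_tmul,
    quotMulTensor_tmul, TensorProduct.sub_tmul, h', TensorProduct.smul_tmul']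

end Koszul
end Kappa
end

/-! ### Dividing out the space generators -/

noncomputable section

namespace Kappa

open Hochschild UniversalEnvelopingAlgebra

variable {n : ℕ} [NeZero n] {lam : ℝ}

section Koszul

variable {M : Type*} [AddCommGroup M] [Module ℂ M] {l r : Env n lam →ₗ[ℂ] Module.End ℂ M}

/-- The top homology of `(U / U (x_j)_{j ∈ s}) ⊗ M` lies in degree `d` and is identified with `R` by
`φ`; the right multiplications by the generators act on it through `x ↦ x x_j - x_j x`, up to a
shift for the time generator. -/
structure QuotTopHomology (h : IsBimodule l r) (s : Set (Fin n)) (hs : 0 ∉ s) (d : ℕ)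
    (R : Submodule ℂ M)
    (φ : (EnvQuot n lam s ⊗[ℂ] M) ⊗[ℂ] (⨂[ℂ]^d (Env n lam)) →ₗ[ℂ] M) : Prop where
  top : IsTopHomology (diagHom (EnvQuot n lam s) h).toLinearMap
    (tensorRight (Env n lam) (EnvQuot n lam s) r) d R φ
  space : ∀ j, j ≠ 0 → ∀ z ∈ cycles (diagHom (EnvQuot n lam s) h).toLinearMap
    (tensorRight (Env n lam) (EnvQuot n lam s) r) d,
    φ ((quotMulTensor n lam M s hs j).rTensor (⨂[ℂ]^d (Env n lam)) z) = adjoint l r j (φ z)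
  time : ∀ z ∈ cycles (diagHom (EnvQuot n lam s) h).toLinearMap
    (tensorRight (Env n lam) (EnvQuot n lam s) r) d,
    φ ((quotMulTensor n lam M s hs 0).rTensor (⨂[ℂ]^d (Env n lam)) z) =
      adjoint l r 0 (φ z) - ((d : ℂ) * (Complex.I * lam)) • φ z

/-- With no generator divided out the module is `U` itself, so this is the diagonal form of the free
bimodule, and the shift is zero. -/
theorem exists_quotTopHomology_empty (h : IsBimodule l r) (hr1 : ∀ x, r 1 x = x)
    (hs : (0 : Fin n) ∉ (∅ : Set (Fin n))) : ∃ φ, QuotTopHomology h ∅ hs 0 ⊤ φ := by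
  obtain ⟨φ, hφ, hφ'⟩ := exists_isTopHomology_diag h hr1
  let e' : (EnvQuot n lam ∅ ⊗[ℂ] M) ≃ₗ[ℂ] Env n lam ⊗[ℂ] M :=
    LinearEquiv.rTensor M ((quotEmptyEquiv n lam).restrictScalars ℂ)
  have he' : IsBimoduleHom (diagHom _ h).toLinearMap (tensorRight (Env n lam) _ r)
      (diagHom (Env n lam) h).toLinearMap (tensorRight (Env n lam) (Env n lam) r)
      e'.toLinearMap := diagHom_map h (quotEmptyEquiv n lam).toLinearMap
  have key : ∀ j z, φ (e'.toLinearMap.rTensor _ ((quotMulTensor n lam M ∅ hs j).rTensor _ z)) =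
      adjoint l r j (φ (e'.toLinearMap.rTensor _ z)) := by
    intro j z
    rw [← LinearMap.rTensor_comp_apply]
    refine Eq.trans ?_ (hφ' (gen j) _)
    rw [← LinearMap.rTensor_comp_apply]
    refine congrArg (fun f => φ (LinearMap.rTensor _ f z)) (quot_tmul_ext
      (f := e'.toLinearMap ∘ₗ quotMulTensor n lam M ∅ hs j)
      (g := (LinearMap.mulRight ℂ (ι ℂ (gen j))).rTensor M ∘ₗ e'.toLinearMap) fun a x => ?_)
    have h1 : ∀ b : Env n lam, e'.toLinearMap (quotMk n lam ∅ b ⊗ₜ x) = b ⊗ₜ x := fun b =>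
      congrArg (· ⊗ₜ x) (quotEmptyEquiv_mk n lam b)
    rw [LinearMap.comp_apply, LinearMap.comp_apply, quotMulTensor_tmul, h1, h1]
    rfl
  refine ⟨φ ∘ₗ e'.toLinearMap.rTensor _, hφ.congr e' he' he'.symm, fun j _ z _ => key j z,
    fun z _ => (key 0 z).trans ?_⟩
  simp

/-- The exact sequence given by right multiplication by `x_i` passes to homology. The other
operators descend because they commute with it, in the case of `x₀` up to the shift. -/
theorem QuotTopHomology.exists_insert {h : IsBimodule l r} {s : Set (Fin n)} {hs : 0 ∉ s} {d : ℕ}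
    {R : Submodule ℂ M}
    {φ : (EnvQuot n lam s ⊗[ℂ] M) ⊗[ℂ] (⨂[ℂ]^d (Env n lam)) →ₗ[ℂ] M}
    (hφ : QuotTopHomology h s hs d R φ) {i : Fin n} (hi : i ∉ s) (hs' : 0 ∉ insert i s) :
    ∃ φ', QuotTopHomology h (insert i s) hs' (d + 1) (R ⊓ LinearMap.ker (adjoint l r i)) φ' := by
  have hi0 : i ≠ 0 := by
    rintro rfl
    exact hs' (Set.mem_insert _ _)
  obtain ⟨φ', hφ', hΘ⟩ := hφ.top.exists_of_exact (diagHom_isBimodule _ h)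
    (θ := quotMulTensor n lam M s hs i)
    (π := ((quotProj n lam s i).restrictScalars ℂ).rTensor M)
    (diagHom_map h (quotMul n lam s hs i)) (diagHom_map h (quotProj n lam s i))
    (Module.Flat.rTensor_preserves_injective_linearMap _ (quotMul_injective n lam s hs hi))
    (LinearMap.rTensor_surjective _ (quotProj_surjective n lam s i))
    (rTensor_exact _ (quot_exact n lam s hs i) (quotProj_surjective n lam s i))
    (hφ.space i hi0)
  have hπ : ∀ (j : Fin n) (z : EnvQuot n lam s ⊗[ℂ] M),
      ((quotProj n lam s i).restrictScalars ℂ).rTensor M (quotMulTensor n lam M s hs j z) =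
        quotMulTensor n lam M (insert i s) hs' j
          (((quotProj n lam s i).restrictScalars ℂ).rTensor M z) := by
    intro j z
    refine LinearMap.congr_fun
      (f := ((quotProj n lam s i).restrictScalars ℂ).rTensor M ∘ₗ quotMulTensor n lam M s hs j)
      (g := quotMulTensor n lam M (insert i s) hs' j ∘ₗ
        ((quotProj n lam s i).restrictScalars ℂ).rTensor M) (quot_tmul_ext fun a x => ?_) z
    have h1 : ∀ b : Env n lam, ((quotProj n lam s i).restrictScalars ℂ).rTensor M
        (quotMk n lam s b ⊗ₜ x) = quotMk n lam (insert i s) b ⊗ₜ x := fun b =>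
      congrArg (· ⊗ₜ x) (quotProj_mk n lam s i b)
    rw [LinearMap.comp_apply, LinearMap.comp_apply, quotMulTensor_tmul, h1, h1, quotMulTensor_tmul]
  refine ⟨φ', hφ', fun j hj => ?_, ?_⟩
  · exact hΘ (quotMulTensor n lam M s hs j) (quotMulTensor n lam M s hs j) _ (adjoint l r j)
      (diagHom_map h (quotMul n lam s hs j)) (quotMulTensor_comm s hs hj hi0) (hπ j)
      (hφ.space j hj)
  -- Here `Θ₀` is the operator of `x₀` minus `i lam`, so the shift grows from `d` to `d + 1`.
  · refine hΘ (quotMulTensor n lam M s hs 0)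
      (quotMulTensor n lam M s hs 0 - (Complex.I * lam) • LinearMap.id) _
      (adjoint l r 0 - (((d + 1 : ℕ) : ℂ) * (Complex.I * lam)) • LinearMap.id)
      (diagHom_map h (quotMul n lam s hs 0)) (quotMulTensor_zero_comm s hs hi0) (hπ 0) ?_
    intro z hz
    rw [LinearMap.rTensor_sub, LinearMap.rTensor_smul, LinearMap.rTensor_id, LinearMap.sub_apply,
      map_sub, hφ.time z hz]
    simp only [LinearMap.sub_apply, LinearMap.smul_apply, LinearMap.id_apply, map_smul]
    push_cast
    module

theorem exists_quotTopHomology (h : IsBimodule l r) (hr1 : ∀ x, r 1 x = x) (s : Finset (Fin n))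
    (hs : 0 ∉ (s : Set (Fin n))) :
    ∃ φ, QuotTopHomology h s hs s.card (⨅ j ∈ s, LinearMap.ker (adjoint l r j)) φ := by
  induction s using Finset.induction_on with
  | empty =>
    have hR : (⨅ j ∈ (∅ : Finset (Fin n)), LinearMap.ker (adjoint l r j)) = ⊤ := by simp
    rw [hR]
    generalize hS : ((∅ : Finset (Fin n)) : Set (Fin n)) = S at hs
    rw [Finset.coe_empty] at hS
    subst hS
    exact exists_quotTopHomology_empty h hr1 hs
  | insert i s his ih =>
    have hs' : (0 : Fin n) ∉ (s : Set (Fin n)) := fun h0 => hs (by simpa using Or.inr h0)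
    obtain ⟨φ, hφ⟩ := ih hs'
    rw [Finset.iInf_insert, inf_comm, Finset.card_insert_of_notMem his]
    generalize hS : ((insert i s : Finset (Fin n)) : Set (Fin n)) = S at hs
    rw [Finset.coe_insert] at hS
    subst hS
    exact hφ.exists_insert (by simpa using his) hs

end Koszul

end Kappa

end

/-! ### The trivial module and the time generator -/

noncomputable section

namespace Kappa

open Hochschild UniversalEnvelopingAlgebra

variable {n : ℕ} [NeZero n] {lam : ℝ}

section Counit

attribute [local instance] LieRing.ofAssociativeRing

variable (n lam) in
/-- The counit of the enveloping algebra. -/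
def counit : Env n lam →ₐ[ℂ] ℂ := lift ℂ 0

theorem counit_X (j : Fin n) : counit n lam (X n lam j) = 0 := by
  rw [counit, X, lift_ι_apply]; rfl

end Counit

theorem sub_counit_mem (a : Env n lam) :
    a - algebraMap ℂ _ (counit n lam a) ∈ leftIdeal n lam Set.univ := by
  induction a using env_induction with
  | algebraMap c =>
    rw [AlgHom.commutes, Algebra.algebraMap_self, RingHom.id_apply, sub_self]
    exact Submodule.zero_mem _
  | X j =>
    rw [counit_X, map_zero, sub_zero]
    exact Submodule.subset_span ⟨j, trivial, rfl⟩
  | add a b ha hb =>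
    rw [map_add, map_add, add_sub_add_comm]
    exact Submodule.add_mem _ ha hb
  | mul a b ha hb =>
    have h : a * b - algebraMap ℂ _ (counit n lam (a * b)) =
        a • (b - algebraMap ℂ _ (counit n lam b)) + algebraMap ℂ (Env n lam) (counit n lam b) •
          (a - algebraMap ℂ _ (counit n lam a)) := by
      rw [map_mul, map_mul, smul_eq_mul, smul_eq_mul, mul_sub, mul_sub, Algebra.commutes _ a,
        ← Algebra.commutes _ (algebraMap ℂ (Env n lam) (counit n lam b))]
      abel
    rw [h]
    exact Submodule.add_mem _ (Submodule.smul_mem _ _ hb) (Submodule.smul_mem _ _ ha)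

theorem counit_of_mem {a : Env n lam} (ha : a ∈ leftIdeal n lam Set.univ) :
    counit n lam a = 0 := by
  induction ha using Submodule.span_induction with
  | mem x hx =>
    obtain ⟨j, -, rfl⟩ := hx
    exact counit_X j
  | zero => exact map_zero _
  | add a b _ _ ha hb => rw [map_add, ha, hb, add_zero]
  | smul c a _ ha => rw [smul_eq_mul, map_mul, ha, mul_zero]

/-- The left ideal generated by all `x_j` is the augmentation ideal, so the counit identifies the
quotient with `ℂ`. -/
theorem bijective_toSpanSingleton_quotMk_one :
    Function.Bijective (LinearMap.toSpanSingleton ℂ _ (quotMk n lam Set.univ 1)) := by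
  have h : ∀ c : ℂ, c • quotMk n lam Set.univ 1 = quotMk n lam Set.univ (algebraMap ℂ _ c) := by
    intro c
    rw [Algebra.algebraMap_eq_smul_one]
    exact (map_smul ((quotMk n lam Set.univ).restrictScalars ℂ) c 1).symm
  constructor
  · rw [injective_iff_map_eq_zero]
    intro c hc
    rw [LinearMap.toSpanSingleton_apply, h, quotMk_eq_zero] at hc
    simpa using counit_of_mem hc
  · intro a
    obtain ⟨a, rfl⟩ := quotMk_surjective n lam _ a
    refine ⟨counit n lam a, ?_⟩
    rw [LinearMap.toSpanSingleton_apply, h, eq_comm, ← sub_eq_zero, ← map_sub, quotMk_eq_zero]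
    exact sub_counit_mem a

section Koszul

variable {M : Type*} [AddCommGroup M] [Module ℂ M] {l r : Env n lam →ₗ[ℂ] Module.End ℂ M}

variable (n lam M) in
/-- The isomorphism `x ↦ 1 ⊗ x` of `M` with `(U / U (x_j)_j) ⊗ M`. -/
def quotUnivEquiv : M ≃ₗ[ℂ] EnvQuot n lam Set.univ ⊗[ℂ] M :=
  (TensorProduct.lid ℂ M).symm ≪≫ₗ
    LinearEquiv.rTensor M (LinearEquiv.ofBijective _ bijective_toSpanSingleton_quotMk_one)

theorem quotUnivEquiv_apply (x : M) :
    quotUnivEquiv n lam M x = quotMk n lam Set.univ 1 ⊗ₜ x := by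
  simp [quotUnivEquiv]

theorem quotUnivEquiv_isBimoduleHom (h : IsBimodule l r) :
    IsBimoduleHom l r (diagHom (EnvQuot n lam Set.univ) h).toLinearMap
      (tensorRight (Env n lam) (EnvQuot n lam Set.univ) r)
      (quotUnivEquiv n lam M).toLinearMap where
  left a x := by
    let l' : Env n lam →ₐ[ℂ] Module.End ℂ M :=
      AlgHom.ofLinearMap l (LinearMap.ext h.left_one)
        (fun a b => LinearMap.ext (h.left_mul a b))
    refine intertwines_of_ι l' (diagHom (EnvQuot n lam Set.univ) h) _ (fun u x => ?_) a x
    -- The Lie algebra kills the class of `1`, so the diagonal action on `1 ⊗ M` is the action on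
    -- `M`.
    have hu : ι ℂ u • quotMk n lam Set.univ 1 = 0 := by
      rw [← map_smul, quotMk_eq_zero, smul_eq_mul, mul_one, ι_eq_sum]
      refine Submodule.sum_mem _ fun j _ => ?_
      rw [Algebra.smul_def]
      exact Submodule.smul_mem _ _ (Submodule.subset_span ⟨j, trivial, rfl⟩)
    change quotUnivEquiv n lam M (l (ι ℂ u) x) = diagHom _ h (ι ℂ u) (quotUnivEquiv n lam M x)
    rw [quotUnivEquiv_apply, quotUnivEquiv_apply, diagHom_ι, hu, TensorProduct.zero_tmul, zero_add]
  right a x := by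
    change quotUnivEquiv n lam M (r a x) = tensorRight _ _ r a (quotUnivEquiv n lam M x)
    rw [quotUnivEquiv_apply, quotUnivEquiv_apply, tensorRight_tmul]

/-- Once all space generators are gone, dividing out `x₀` leaves the trivial module, whose diagonal
bimodule is `M`. -/
theorem QuotTopHomology.exists_isTopHomology {h : IsBimodule l r} {s : Set (Fin n)} {hs : 0 ∉ s}
    {d : ℕ} {R : Submodule ℂ M}
    {φ : (EnvQuot n lam s ⊗[ℂ] M) ⊗[ℂ] (⨂[ℂ]^d (Env n lam)) →ₗ[ℂ] M}
    (hφ : QuotTopHomology h s hs d R φ) (hu : insert 0 s = Set.univ) :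
    ∃ φ' : M ⊗[ℂ] (⨂[ℂ]^(d + 1) (Env n lam)) →ₗ[ℂ] M, IsTopHomology l r (d + 1)
      (R ⊓ LinearMap.ker (adjoint l r 0 - ((d : ℂ) * (Complex.I * lam)) • LinearMap.id)) φ' := by
  obtain ⟨φ', hφ', -⟩ := hφ.top.exists_of_exact (diagHom_isBimodule _ h)
    (θ := quotMulTensor n lam M s hs 0)
    (π := ((quotProj n lam s 0).restrictScalars ℂ).rTensor M)
    (D := adjoint l r 0 - ((d : ℂ) * (Complex.I * lam)) • LinearMap.id)
    (diagHom_map h (quotMul n lam s hs 0)) (diagHom_map h (quotProj n lam s 0))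
    (Module.Flat.rTensor_preserves_injective_linearMap _ (quotMul_injective n lam s hs hs))
    (LinearMap.rTensor_surjective _ (quotProj_surjective n lam s 0))
    (rTensor_exact _ (quot_exact n lam s hs 0) (quotProj_surjective n lam s 0))
    hφ.time
  have key : ∃ φ', IsTopHomology (diagHom (EnvQuot n lam (insert 0 s)) h).toLinearMap
      (tensorRight (Env n lam) (EnvQuot n lam (insert 0 s)) r) (d + 1)
      (R ⊓ LinearMap.ker (adjoint l r 0 - ((d : ℂ) * (Complex.I * lam)) • LinearMap.id)) φ' :=
    ⟨φ', hφ'⟩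
  rw [hu] at key
  obtain ⟨φ'', hφ''⟩ := key
  have he := quotUnivEquiv_isBimoduleHom h
  exact ⟨_, hφ''.congr (quotUnivEquiv n lam M) he he.symm⟩

/-- The top homology of the enveloping algebra with coefficients in a bimodule `M`: the elements of
`M` that commute with the generators, up to a shift for the time generator. -/
theorem exists_isTopHomology (h : IsBimodule l r) (hr1 : ∀ x, r 1 x = x) :
    ∃ φ : M ⊗[ℂ] (⨂[ℂ]^n (Env n lam)) →ₗ[ℂ] M, IsTopHomology l r n
      ((⨅ j ∈ Finset.univ.erase (0 : Fin n), LinearMap.ker (adjoint l r j)) ⊓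
        LinearMap.ker (adjoint l r 0 - (((n : ℂ) - 1) * (Complex.I * lam)) • LinearMap.id)) φ := by
  have hs : (0 : Fin n) ∉ ((Finset.univ.erase (0 : Fin n) : Finset (Fin n)) : Set (Fin n)) := by
    simp
  obtain ⟨φ, hφ⟩ := exists_quotTopHomology h hr1 (Finset.univ.erase 0) hs
  have hu : insert 0 ((Finset.univ.erase (0 : Fin n) : Finset (Fin n)) : Set (Fin n)) =
      Set.univ := by
    ext j
    simp
  have hc : (Finset.univ.erase (0 : Fin n)).card + 1 = n := by
    rw [Finset.card_erase_add_one (Finset.mem_univ _), Finset.card_univ, Fintype.card_fin]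
  have hc' : ((Finset.univ.erase (0 : Fin n)).card : ℂ) = (n : ℂ) - 1 := by
    rw [eq_sub_iff_add_eq]
    exact_mod_cast hc
  have key := hφ.exists_isTopHomology hu
  rw [hc'] at key
  generalize (Finset.univ.erase (0 : Fin n)).card + 1 = d at hc key
  subst hc
  exact key

end Koszul

/-! ### The twisted homology -/

theorem twisted_isBimodule {A : Type*} [Ring A] [Algebra ℂ A] (σ : A ≃ₐ[ℂ] A) :
    IsBimodule ((LinearMap.mul ℂ A) ∘ₗ σ.toLinearMap) (LinearMap.mul ℂ A).flip where
  left_one x := by simp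
  left_mul a b x := by simp [mul_assoc]
  right_mul a b x := by simp [mul_assoc]
  comm a b x := by simp [mul_assoc]

theorem exists_isTopHomology_twisted (σ : Env n lam ≃ₐ[ℂ] Env n lam) :
    ∃ (R : Submodule ℂ (Env n lam)) (φ : Env n lam ⊗[ℂ] (⨂[ℂ]^n (Env n lam)) →ₗ[ℂ] Env n lam),
      IsTopHomology ((LinearMap.mul ℂ (Env n lam)) ∘ₗ σ.toLinearMap)
        (LinearMap.mul ℂ (Env n lam)).flip n R φ ∧
      ∀ m, m ∈ R ↔ (∀ j, j ≠ 0 → σ (X n lam j) * m = m * X n lam j) ∧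
        σ (X n lam 0) * m = m * X n lam 0 + (-(((n : ℂ) - 1) * (Complex.I * lam))) • m := by
  obtain ⟨φ, hφ⟩ := exists_isTopHomology (twisted_isBimodule σ) (fun x => by simp)
  refine ⟨_, φ, hφ, fun m => ?_⟩
  have h1 : ∀ j, adjoint ((LinearMap.mul ℂ (Env n lam)) ∘ₗ σ.toLinearMap)
      (LinearMap.mul ℂ (Env n lam)).flip j m = m * X n lam j - σ (X n lam j) * m := fun j => rfl
  simp only [Submodule.mem_inf, Submodule.mem_iInf, LinearMap.mem_ker, LinearMap.sub_apply, h1,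
    LinearMap.smul_apply, LinearMap.id_apply, Finset.mem_erase, Finset.mem_univ, and_true]
  refine and_congr (forall₂_congr fun j _ => ?_) ?_
  · rw [sub_eq_zero, eq_comm]
  · rw [neg_smul, ← sub_eq_add_neg, sub_right_comm, sub_eq_zero, eq_comm]

/-- A nonzero solution of the commutation equations determines `σ`, with the exponents of one of its
monomials as the `a_j`. Conversely the monomial with exponents `a_j` solves the equations for the
corresponding shift. -/
theorem nontrivial_twistedHomology_iff (σ : Env n lam ≃ₐ[ℂ] Env n lam) :
    Nontrivial (TwistedHomology σ n) ↔ ∃ a : {j : Fin n // j ≠ 0} → ℕ,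
      σ = shift n lam (-(lam * ((n : ℂ) - 1 + ∑ j, (a j : ℂ)))) := by
  obtain ⟨R, φ, hφ, hR⟩ := exists_isTopHomology_twisted σ
  have hsum : ∀ f : Fin n → ℂ,
      ∑ j : {j : Fin n // j ≠ 0}, f j = ∑ j ∈ Finset.univ.erase 0, f j := by
    intro f
    exact (Finset.sum_subtype _ (by simp) f).symm
  rw [hφ.nontrivial_iff]
  constructor
  · rintro ⟨m, hm, hm0⟩
    obtain ⟨hm1, hm2⟩ := (hR m).1 hm
    obtain ⟨hj, b, hb⟩ := eq_of_mul_eq n lam hm0 (s := fun j => σ (X n lam j)) hm2 hm1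
    refine ⟨fun j => b j, ?_⟩
    have h : σ.toAlgHom = (shift n lam (-(lam * ((n : ℂ) - 1 + ∑ j : {j : Fin n // j ≠ 0},
        ((b j : ℕ) : ℂ))))).toAlgHom := by
      refine env_algHom_ext n lam fun j => ?_
      by_cases h0 : j = 0
      · subst h0
        refine hb.trans ((shift_X_zero n lam _).trans ?_).symm
        rw [hsum (fun j => (b j : ℂ)), spaceDegree]
        refine congrArg (X n lam 0 + algebraMap ℂ (Env n lam) ·) ?_
        rw [Nat.cast_sum]
        ring
      · exact (hj j h0).trans (shift_X n lam _ j h0).symm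
    exact AlgEquiv.ext fun a => AlgHom.congr_fun h a
  · rintro ⟨a, rfl⟩
    -- Exponent zero at the time variable makes the monomial commute with the space generators.
    -- Commuting it with `x₀` yields `i lam ∑ a_j`, which cancels that part of the shift.
    let b : Fin n →₀ ℕ := Finsupp.equivFunOnFinite.symm fun j => if h : j = 0 then 0 else a ⟨j, h⟩
    have hb0 : b 0 = 0 := by simp [b]
    have hb : ∑ j : {j : Fin n // j ≠ 0}, (a j : ℂ) = spaceDegree n b := by
      rw [spaceDegree, Nat.cast_sum, ← hsum (fun j => (b j : ℂ))]
      refine Finset.sum_congr rfl fun j _ => ?_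
      simp [b, j.2]
    refine ⟨ofSymbol n lam (MvPolynomial.monomial b 1), (hR _).2 ⟨fun j hj => ?_, ?_⟩, ?_⟩
    · rw [shift_X n lam _ j hj]
      apply (symbol n lam).injective
      have h2 : ∀ p, symbol n lam (ofSymbol n lam p) = p := (symbol n lam).apply_symm_apply
      rw [symbol_mul_X n lam hj, symbol_mul, symbolHom_X n lam hj, h2, translate_eq_self]
      rw [MvPolynomial.degreeOf_monomial_eq _ _ one_ne_zero, hb0]
    · rw [shift_X_zero, add_mul, X_zero_mul_ofSymbol, polyEuler_monomial, map_smul, hb, smul_smul,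
        ← Algebra.smul_def, add_assoc, ← add_smul]
      congr 2
      ring
    · rw [← symbol_symm_apply, ne_eq, LinearEquiv.map_eq_zero_iff, MvPolynomial.monomial_eq_zero]
      exact one_ne_zero

/-- Homology vanishes above degree `n` for every twist; the twist with all `a_j = 0` attains degree
`n`. -/
theorem twistedDim_eq : twistedDim ℂ (Env n lam) = ((n : ℕ∞) : WithBot ℕ∞) := by
  refine le_antisymm (iSup_le fun σ => iSup_le fun m => iSup_le fun hm => ?_) ?_
  · obtain ⟨R, φ, hφ, -⟩ := exists_isTopHomology_twisted σ
    by_contra hlt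
    have h : n < m := by
      by_contra hle
      exact hlt (by exact_mod_cast not_lt.1 hle)
    exact not_subsingleton_iff_nontrivial.2 hm (hφ.subsingleton_of_lt h)
  · have h : Nontrivial (TwistedHomology
        (shift n lam (-(lam * ((n : ℂ) - 1 + ∑ j : {j : Fin n // j ≠ 0}, ((0 : ℕ) : ℂ))))) n) :=
      (nontrivial_twistedHomology_iff _).2 ⟨fun _ => 0, rfl⟩
    exact le_iSup_of_le _ (le_iSup₂_of_le n h le_rfl)

end Kappa

end

noncomputable section

/-! ### Translations and the left action of the enveloping algebra -/

namespace Kappa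

open UniversalEnvelopingAlgebra MeasureTheory

variable {n : ℕ} [NeZero n] {lam : ℝ}

theorem mem_alg_iff {f : 𝓢(Space n, ℂ)} : f ∈ alg n ↔ ∃ φ ∈ compactTime n, 𝓕 φ = f := Iff.rfl

/-- The inverse Fourier transform turns a translation into multiplication by a phase, which does not
enlarge the support. -/
theorem compSubConst_mem_alg {f : 𝓢(Space n, ℂ)} (hf : f ∈ alg n) (v : Space n) :
    SchwartzMap.compSubConstCLM ℂ v f ∈ alg n := by
  obtain ⟨φ, ⟨K, hK, hφ⟩, rfl⟩ := mem_alg_iff.1 hf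
  refine mem_alg_iff.2 ⟨𝓕⁻ (SchwartzMap.compSubConstCLM ℂ v (𝓕 φ)),
    ⟨K, hK, fun p hp => hφ p fun h0 => hp ?_⟩, FourierTransform.fourier_fourierInv_eq _⟩
  have h1 : 𝓕⁻ (𝓕 φ) p = 0 := by rw [FourierTransform.fourierInv_fourier_eq, h0]
  rw [SchwartzMap.fourierInv_coe, Real.fourierInv_eq'] at h1 ⊢
  rw [← integral_add_right_eq_self _ v]
  simp only [SchwartzMap.compSubConstCLM_apply, add_sub_cancel_right, inner_add_left, mul_add,
    Complex.ofReal_add, add_mul, Complex.exp_add, smul_eq_mul]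
  simp only [mul_right_comm _ (Complex.exp (((2 * Real.pi * inner ℝ v p : ℝ) : ℂ) * Complex.I))]
  rw [integral_mul_const]
  simp only [smul_eq_mul] at h1
  rw [h1, zero_mul]

/-- The translation `f ↦ f(x₀ + c, x_1, …)`. -/
def timeShift (n : ℕ) [NeZero n] (c : ℝ) : 𝓢(Space n, ℂ) →L[ℂ] 𝓢(Space n, ℂ) :=
  SchwartzMap.compSubConstCLM ℂ (-(c • EuclideanSpace.single 0 1))

theorem timeShift_apply (c : ℝ) (f : 𝓢(Space n, ℂ)) (x : Space n) :
    timeShift n c f x = f (x + c • EuclideanSpace.single 0 1) := by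
  simp [timeShift]

theorem timeShift_mem_alg {f : 𝓢(Space n, ℂ)} (hf : f ∈ alg n) (c : ℝ) :
    timeShift n c f ∈ alg n := compSubConst_mem_alg hf _

theorem timeShift_timeShift_neg (c : ℝ) (f : 𝓢(Space n, ℂ)) :
    timeShift n c (timeShift n (-c) f) = f := by
  ext x
  simp [timeShift_apply]

theorem euler_timeShift (c : ℝ) (f : 𝓢(Space n, ℂ)) :
    euler n (timeShift n c f) = timeShift n c (euler n f) := by
  ext x
  have h : (timeShift n c f : Space n → ℂ) = fun x => f (x + c • EuclideanSpace.single 0 1) :=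
    funext fun x => timeShift_apply c f x
  rw [timeShift_apply, euler_apply, euler_apply, h]
  refine Finset.sum_congr rfl fun j hj => ?_
  rw [fderiv_comp_add_right]
  simp [Finset.ne_of_mem_erase hj]

theorem leftAct_ι (v : LieAlg n lam) : leftAct (ι ℂ v) = leftLin v :=
  lift_ι_apply ℂ _ v

/-- Translating by `c` turns multiplication by `x₀` into multiplication by `x₀ + c` and commutes
with the Euler operator in the space variables. -/
theorem timeShift_leftAct (c : ℝ) (u : Env n lam) (f : 𝓢(Space n, ℂ)) :
    timeShift n c (leftAct u f) = leftAct (shiftHom n lam c u) (timeShift n c f) := by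
  refine intertwines_of_ι (leftAct : Env n lam →ₐ[ℂ] _)
    ((leftAct : Env n lam →ₐ[ℂ] _).comp (shiftHom n lam c)) (timeShift n c).toLinearMap
    (fun v f => ?_) u f
  ext x
  change timeShift n c (leftAct (ι ℂ v) f) x =
    leftAct (shiftHom n lam c (ι ℂ v)) (timeShift n c f) x
  rw [shiftHom_ι, map_add, AlgHom.commutes, leftAct_ι, LinearMap.add_apply,
    Module.algebraMap_end_apply, timeShift_apply, leftLin_apply, add_apply,
    leftLin_apply, euler_timeShift, timeShift_apply, timeShift_apply, smul_apply,
    timeShift_apply, smul_eq_mul]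
  have h : ∑ j, coord j v * (((x + c • EuclideanSpace.single 0 1 : Space n) j : ℝ) : ℂ) =
      ∑ j, coord j v * (x j : ℂ) + c * coord 0 v := by
    simp [apply_ite Complex.ofReal, mul_add, Finset.sum_add_distrib, mul_comm (c : ℂ)]
  rw [h]
  ring

theorem symbol_shiftHom (c : ℂ) (u : Env n lam) :
    symbol n lam (shiftHom n lam c u) = translate n c (symbol n lam u) := by
  rw [symbol_apply, symbol_apply]
  have key : ∀ p, translate n c (symbolHom n lam u p) =
      symbolHom n lam (shiftHom n lam c u) (translate n c p) := by
    intro p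
    induction u using env_induction generalizing p with
    | algebraMap a => simp [Module.algebraMap_end_apply]
    | X j =>
      have hX : shiftHom n lam c (X n lam j) =
          X n lam j + algebraMap ℂ _ (c * if 0 = j then 1 else 0) := by
        rw [X, shiftHom_ι, coord_gen]
      by_cases hj : j = 0
      · subst hj
        have hE : polyEuler n (translate n c p) = translate n c (polyEuler n p) := by
          induction p using MvPolynomial.induction_on with
          | C a => simp [← MvPolynomial.algebraMap_eq]
          | add p q hp hq => simp [hp, hq]
          | mul_X p j hp =>
            by_cases hj : j = 0
            · subst hj
              simp [Derivation.leibniz, hp, ← MvPolynomial.algebraMap_eq]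
            · simp [Derivation.leibniz, hp, translate_X n _ hj, polyEuler_X n hj]
        rw [hX, map_add, AlgHom.commutes, LinearMap.add_apply, Module.algebraMap_end_apply,
          symbolHom_X_zero, symbolHom_X_zero, map_add, map_mul, translate_X_zero, hE, map_smul,
          if_pos rfl, mul_one, MvPolynomial.smul_eq_C_mul, MvPolynomial.smul_eq_C_mul]
        ring
      · rw [hX, if_neg (Ne.symm hj), mul_zero, map_zero, add_zero, symbolHom_X n lam hj,
          symbolHom_X n lam hj, map_mul, translate_X n _ hj]
    | add a b ha hb => simp [ha, hb]
    | mul a b ha hb => simp [ha, hb]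
  rw [key, map_one (translate n c)]

/-- The substitution `x₀ ↦ 0`. -/
def zeroTime (n : ℕ) [NeZero n] : MvPolynomial (Fin n) ℂ →ₐ[ℂ] MvPolynomial (Fin n) ℂ :=
  MvPolynomial.aeval fun j => if j = 0 then 0 else MvPolynomial.X j

/-- Invariance under one step gives invariance under all natural numbers. For fixed values of the
variables the translate is a polynomial in the step, hence constant, and the step `-x₀` sets the
time variable to zero. -/
theorem zeroTime_eq_of_translate {p : MvPolynomial (Fin n) ℂ} (hp : translate n 1 p = p) :
    zeroTime n p = p := by
  have hm : ∀ m : ℕ, translate n m p = p := by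
    intro m
    induction m with
    | zero => simp
    | succ m ih => rw [Nat.cast_succ, ← translate_translate, hp, ih]
  refine MvPolynomial.funext fun x => ?_
  let g : Polynomial ℂ := MvPolynomial.aeval (fun j => if j = 0 then Polynomial.C (x 0) +
    Polynomial.X else Polynomial.C (x j)) p
  have hg : ∀ c : ℂ, g.eval c = MvPolynomial.eval x (translate n c p) := by
    intro c
    refine AlgHom.congr_fun (φ₁ := (Polynomial.aeval c).comp (MvPolynomial.aeval (fun j =>
      if j = 0 then Polynomial.C (x 0) + Polynomial.X else Polynomial.C (x j))))
      (φ₂ := (MvPolynomial.aeval x).comp (translate n c))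
      (MvPolynomial.algHom_ext fun j => ?_) p
    by_cases hj : j = 0
    · subst hj
      simp
    · simp [hj, translate_X n _ hj]
  have hz : g.eval (-(x 0)) = MvPolynomial.eval x (zeroTime n p) := by
    refine AlgHom.congr_fun (φ₁ := (Polynomial.aeval (-(x 0))).comp (MvPolynomial.aeval (fun j =>
      if j = 0 then Polynomial.C (x 0) + Polynomial.X else Polynomial.C (x j))))
      (φ₂ := (MvPolynomial.aeval x).comp (zeroTime n)) (MvPolynomial.algHom_ext fun j => ?_) p
    by_cases hj : j = 0
    · subst hj
      simp [zeroTime]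
    · simp [hj, zeroTime]
  have hc : g = Polynomial.C (MvPolynomial.eval x p) := by
    refine Polynomial.eq_of_infinite_eval_eq _ _
      (Set.Infinite.mono ?_ (Set.infinite_range_of_injective (Nat.cast_injective (R := ℂ))))
    rintro _ ⟨m, rfl⟩
    change g.eval (m : ℂ) = _
    rw [hg, hm, Polynomial.eval_C]
  rw [← hz, hc, Polynomial.eval_C]

theorem leftAct_X_of_ne {j : Fin n} (hj : j ≠ 0) (f : 𝓢(Space n, ℂ)) (x : Space n) :
    leftAct (X n lam j) f x = x j * f x := by
  rw [X, leftAct_ι, leftLin_apply]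
  simp [coord_gen, hj.symm]

theorem leftAct_ofSymbol_zeroTime (p : MvPolynomial (Fin n) ℂ) (f : 𝓢(Space n, ℂ)) (x : Space n) :
    leftAct (ofSymbol n lam (zeroTime n p)) f x =
      MvPolynomial.eval (fun j => (x j : ℂ)) (zeroTime n p) * f x := by
  induction p using MvPolynomial.induction_on with
  | C c =>
    rw [← MvPolynomial.algebraMap_eq, AlgHom.commutes, MvPolynomial.algebraMap_eq, ofSymbol_C,
      AlgHom.commutes, Module.algebraMap_end_apply, MvPolynomial.eval_C]
    rfl
  | add p q hp hq => simp [hp, hq, add_mul]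
  | mul_X p j hp =>
    by_cases hj : j = 0
    · subst hj
      simp [zeroTime]
    · have h : zeroTime n (p * MvPolynomial.X j) = MvPolynomial.X j * zeroTime n p := by
        rw [map_mul, mul_comm]
        simp [zeroTime, hj]
      rw [h, ofSymbol_X_mul n lam hj, map_mul, Module.End.mul_apply, leftAct_X_of_ne hj, hp,
        map_mul, MvPolynomial.eval_X, mul_assoc]

variable (n) in
theorem exists_mem_alg_ne_zero : ∃ f ∈ alg n, f ≠ 0 := by
  let b : ContDiffBump (0 : Space n) := ⟨1, 2, one_pos, one_lt_two⟩
  have hb : HasCompactSupport (fun x => ((b x : ℝ) : ℂ)) :=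
    b.hasCompactSupport.comp_left Complex.ofReal_zero
  let φ : 𝓢(Space n, ℂ) := hb.toSchwartzMap (Complex.ofRealCLM.contDiff.comp b.contDiff)
  have hφ : ∀ x, φ x = b x := fun x => rfl
  have h1 : φ ∈ compactTime n := by
    refine ⟨(fun x : Space n => x 0) '' tsupport (fun x => ((b x : ℝ) : ℂ)),
      hb.isCompact.image (by fun_prop), fun p hp => ⟨p, subset_tsupport _ hp, rfl⟩⟩
  refine ⟨𝓕 φ, mem_alg_iff.2 ⟨φ, h1, rfl⟩, fun h0 => ?_⟩
  have h2 : φ = 0 := by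
    rw [← FourierTransform.fourierInv_fourier_eq (F := 𝓢(Space n, ℂ)) φ, h0]
    exact FourierTransform.fourierInv_zero ..
  have h3 := hφ 0
  rw [h2, b.one_of_mem_closedBall (by simp [b])] at h3
  simp at h3

theorem exists_mem_alg_apply_ne_zero (x : Space n) : ∃ f ∈ alg n, f x ≠ 0 := by
  obtain ⟨f, hf, hf0⟩ := exists_mem_alg_ne_zero n
  obtain ⟨y, hy⟩ : ∃ y, f y ≠ 0 := by
    by_contra! h
    exact hf0 (SchwartzMap.ext h)
  refine ⟨SchwartzMap.compSubConstCLM ℂ (x - y) f, compSubConst_mem_alg hf _, ?_⟩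
  simpa using hy

/-- The action of the enveloping algebra on the function algebra is faithful. -/
theorem eq_zero_of_leftAct {u : Env n lam} (hu : ∀ f ∈ alg n, leftAct u f = 0) : u = 0 := by
  induction h : MvPolynomial.degreeOf 0 (symbol n lam u) using Nat.strong_induction_on
    generalizing u with
  | _ d ih =>
  -- The difference of `u` and its shift also annihilates `𝒜`, since translations preserve `𝒜`, and
  -- has smaller `x₀`-degree. By induction it vanishes, so the symbol is invariant. In degree zero
  -- there is no strict drop, but invariance is immediate.
  have ht : translate n 1 (symbol n lam u) = symbol n lam u := by
    by_cases hd : d = 0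
    · exact translate_eq_self n (h.trans hd) 1
    · have hs : symbol n lam (shiftHom n lam (1 : ℝ) u - u) =
          translate n 1 (symbol n lam u) - symbol n lam u := by
        rw [map_sub, symbol_shiftHom, Complex.ofReal_one]
      have h0 := ih _ ?_ (u := shiftHom n lam (1 : ℝ) u - u) (fun f hf => ?_) rfl
      · rwa [h0, map_zero, eq_comm, sub_eq_zero] at hs
      · rw [hs]
        have := degreeOf_translate_sub_le n 1 (symbol n lam u)
        omega
      · rw [map_sub, LinearMap.sub_apply, hu f hf, sub_zero, ← timeShift_timeShift_neg 1 f,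
          ← timeShift_leftAct, hu _ (timeShift_mem_alg hf _), map_zero]
  have hz := zeroTime_eq_of_translate ht
  have hus : u = ofSymbol n lam (zeroTime n (symbol n lam u)) := by
    rw [hz, ← symbol_symm_apply, LinearEquiv.symm_apply_apply]
  -- A symbol free of `x₀` acts as multiplication by a polynomial function. At each real point some
  -- function of `𝒜` is nonzero, so the polynomial vanishes on `ℝⁿ`.
  have hp : zeroTime n (symbol n lam u) = 0 := by
    refine MvPolynomial.funext_set (fun _ => Set.range ((↑) : ℝ → ℂ))
      (fun _ => Set.infinite_range_of_injective Complex.ofReal_injective) fun x hx => ?_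
    choose y hy using fun j => hx j trivial
    obtain rfl : (fun j => (y j : ℂ)) = x := funext hy
    obtain ⟨f, hf, hf0⟩ := exists_mem_alg_apply_ne_zero (WithLp.toLp 2 y)
    have h1 := leftAct_ofSymbol_zeroTime (lam := lam) (symbol n lam u) f (WithLp.toLp 2 y)
    rw [← hus, hu f hf] at h1
    rw [map_zero]
    exact (mul_eq_zero.1 h1.symm).resolve_right hf0
  rw [hus, hp, map_zero]

/-! ### The extension of the modular group -/

theorem shift_symm (μ : ℂ) : (shift n lam μ).symm = shift n lam (-μ) := by
  refine AlgEquiv.ext fun a => ?_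
  change shiftHom n lam (-(Complex.I * μ)) a = shiftHom n lam (Complex.I * -μ) a
  rw [mul_neg]

/-- Scalars are central, so evaluation at them is multiplicative although the coefficients do not
commute. -/
theorem polynomial_eval_mul_central {B : Type*} [Ring B] [Algebra ℂ B] (P Q : Polynomial B) (z : ℂ) :
    (P * Q).eval (algebraMap ℂ B z) = P.eval (algebraMap ℂ B z) * Q.eval (algebraMap ℂ B z) :=
  Polynomial.eval₂_mul_noncomm _ _ fun k => (Algebra.commutes z (Q.coeff k)).symm

theorem isModularExtension_shift :
    IsModularExtension fun z => shift n lam (-(Complex.I * (z * ((n : ℂ) - 1) * lam))) where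
  intertwines t u f _ := by
    have h : (((t * (n - 1) * lam : ℝ)) : ℂ) =
        Complex.I * (-(Complex.I * (t * ((n : ℂ) - 1) * lam))) := by
      rw [mul_neg, ← mul_assoc, Complex.I_mul_I]
      push_cast
      ring
    have key := timeShift_leftAct (t * (n - 1) * lam) u f
    rw [h] at key
    exact key
  polynomial u := by
    induction u using env_induction with
    | algebraMap c =>
      refine ⟨Polynomial.C (algebraMap ℂ _ c), fun z => ?_⟩
      rw [AlgEquiv.commutes, Polynomial.eval_C]
    | X j =>
      by_cases hj : j = 0
      · subst hj
        refine ⟨Polynomial.C (X n lam 0) +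
          Polynomial.C (algebraMap ℂ _ (((n : ℂ) - 1) * lam)) * Polynomial.X, fun z => ?_⟩
        rw [shift_X_zero, Polynomial.eval_add, Polynomial.eval_C, Polynomial.eval_C_mul,
          Polynomial.eval_X, ← map_mul]
        refine congrArg (X n lam 0 + algebraMap ℂ (Env n lam) ·) ?_
        linear_combination (-(z * ((n : ℂ) - 1) * lam)) * Complex.I_mul_I
      · refine ⟨Polynomial.C (X n lam j), fun z => ?_⟩
        rw [shift_X n lam _ j hj, Polynomial.eval_C]
    | add a b ha hb =>
      obtain ⟨P, hP⟩ := ha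
      obtain ⟨Q, hQ⟩ := hb
      exact ⟨P + Q, fun z => by rw [map_add, hP, hQ, Polynomial.eval_add]⟩
    | mul a b ha hb =>
      obtain ⟨P, hP⟩ := ha
      obtain ⟨Q, hQ⟩ := hb
      exact ⟨P * Q, fun z => by rw [map_mul, hP, hQ, polynomial_eval_mul_central]⟩

/-- A polynomial over an algebra is determined by its values at the real scalars, as far as its
values at complex scalars are concerned. -/
theorem polynomial_eval_eq_zero {B : Type*} [Ring B] [Algebra ℂ B] (P : Polynomial B)
    (hP : ∀ t : ℝ, P.eval (algebraMap ℂ B t) = 0) (z : ℂ) : P.eval (algebraMap ℂ B z) = 0 := by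
  rw [← Module.forall_dual_apply_eq_zero_iff ℂ]
  intro ℓ
  let g : Polynomial ℂ := ∑ i ∈ Finset.range (P.natDegree + 1), Polynomial.monomial i (ℓ (P.coeff i))
  have hg : ∀ w : ℂ, g.eval w = ℓ (P.eval (algebraMap ℂ B w)) := by
    intro w
    rw [Polynomial.eval_finsetSum, Polynomial.eval_eq_sum_range, map_sum]
    refine Finset.sum_congr rfl fun i _ => ?_
    rw [Polynomial.eval_monomial, ← map_pow, ← Algebra.commutes, ← Algebra.smul_def, map_smul,
      smul_eq_mul, mul_comm]
  have h0 : g = 0 := by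
    refine Polynomial.eq_of_infinite_eval_eq _ _
      (Set.Infinite.mono ?_ (Set.infinite_range_of_injective Complex.ofReal_injective))
    rintro _ ⟨t, rfl⟩
    change g.eval (t : ℂ) = _
    rw [hg, hP, map_zero, Polynomial.eval_zero]
  rw [← hg, h0, Polynomial.eval_zero]

/-- For real times the intertwining relation determines the action of `α_t(u)` on `𝒜`, hence
`α_t(u)` by faithfulness; polynomiality carries the equality to complex times. -/
theorem IsModularExtension.unique {α β : ℂ → Env n lam ≃ₐ[ℂ] Env n lam}
    (hα : IsModularExtension α) (hβ : IsModularExtension β) : α = β := by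
  have hreal : ∀ (t : ℝ) (u : Env n lam), α t u = β t u := by
    intro t u
    rw [← sub_eq_zero]
    refine eq_zero_of_leftAct fun f hf => ?_
    have hg := timeShift_mem_alg hf (-(t * (n - 1) * lam))
    have hgf : modularGroupSchwartz lam t (timeShift n (-(t * (n - 1) * lam)) f) = f :=
      timeShift_timeShift_neg _ f
    have h1 := hα.intertwines t u _ hg
    have h2 := hβ.intertwines t u _ hg
    rw [hgf] at h1 h2
    rw [map_sub, LinearMap.sub_apply, ← h1, ← h2, sub_self]
  funext z
  refine AlgEquiv.ext fun u => ?_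
  obtain ⟨P, hP⟩ := hα.polynomial u
  obtain ⟨Q, hQ⟩ := hβ.polynomial u
  rw [← sub_eq_zero, hP, hQ, ← Polynomial.eval_sub]
  refine polynomial_eval_eq_zero _ (fun t => ?_) z
  rw [Polynomial.eval_sub, ← hP, ← hQ, hreal, sub_self]

theorem existsUnique_isModularExtension :
    ∃! α : ℂ → Env n lam ≃ₐ[ℂ] Env n lam, IsModularExtension α :=
  ⟨_, isModularExtension_shift, fun _ hα => hα.unique isModularExtension_shift⟩

theorem IsModularExtension.symm_apply_I {α : ℂ → Env n lam ≃ₐ[ℂ] Env n lam}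
    (hα : IsModularExtension α) : shift n lam (-(lam * ((n : ℂ) - 1))) = (α Complex.I).symm := by
  rw [hα.unique isModularExtension_shift, shift_symm]
  congr 1
  linear_combination (-(((n : ℂ) - 1) * lam)) * Complex.I_mul_I

end Kappa

end

noncomputable section

/-! ### Decaying functions of time and space -/

namespace Kappa

open MeasureTheory

/-- The weight `(1 + y²)⁻¹` in the time variable. -/
def timeDecay (y : ℝ) : ℝ := (1 + y ^ 2)⁻¹

/-- An integrable weight in the space variables. -/
def spaceDecay {m : ℕ} (v : Fin m → ℝ) : ℝ := (1 + ‖v‖) ^ (-((m : ℝ) + 1))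

theorem timeDecay_nonneg (y : ℝ) : 0 ≤ timeDecay y := by
  unfold timeDecay; positivity

theorem timeDecay_le_one (y : ℝ) : timeDecay y ≤ 1 :=
  inv_le_one_of_one_le₀ (by nlinarith [sq_nonneg y])

theorem integrable_timeDecay : Integrable timeDecay := integrable_inv_one_add_sq

section

variable {m : ℕ}

theorem spaceDecay_nonneg (v : Fin m → ℝ) : 0 ≤ spaceDecay v := by
  unfold spaceDecay; positivity

theorem spaceDecay_le_one (v : Fin m → ℝ) : spaceDecay v ≤ 1 :=
  Real.rpow_le_one_of_one_le_of_nonpos (by linarith [norm_nonneg v]) (by linarith [m.cast_nonneg (α := ℝ)])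

theorem integrable_spaceDecay : Integrable (spaceDecay (m := m)) :=
  integrable_one_add_norm (by simp)

theorem norm_exp_I_mul_mul (p y : ℝ) : ‖Complex.exp (Complex.I * p * y)‖ = 1 := by
  rw [Complex.norm_exp]; simp

theorem norm_exp_neg_I_mul_mul (p y : ℝ) : ‖Complex.exp (-(Complex.I * p * y))‖ = 1 := by
  rw [Complex.norm_exp]; simp

/-- A continuous function of time and space with integrable decay. -/
structure HasDecay (f : ℝ → (Fin m → ℝ) → ℂ) : Prop where
  continuous : Continuous fun z : ℝ × (Fin m → ℝ) => f z.1 z.2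
  bound : ∃ C, 0 ≤ C ∧ ∀ y v, ‖f y v‖ ≤ C * (timeDecay y * spaceDecay v)

/-- The Fourier transform in the time variable. -/
def sliceFourier (f : ℝ → (Fin m → ℝ) → ℂ) (p : ℝ) (v : Fin m → ℝ) : ℂ :=
  ∫ y : ℝ, Complex.exp (-(Complex.I * p * y)) * f y v

variable {f g : ℝ → (Fin m → ℝ) → ℂ}

theorem HasDecay.integrable (hf : HasDecay f) :
    Integrable fun z : ℝ × (Fin m → ℝ) => f z.1 z.2 := by
  obtain ⟨C, -, hC⟩ := hf.bound
  exact ((integrable_timeDecay.mul_prod integrable_spaceDecay).const_mul C).mono'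
    hf.continuous.aestronglyMeasurable (Filter.Eventually.of_forall fun z => hC z.1 z.2)

theorem HasDecay.integrable_slice (hf : HasDecay f) (v : Fin m → ℝ) :
    Integrable fun y => f y v := by
  obtain ⟨C, hC0, hC⟩ := hf.bound
  refine (integrable_timeDecay.const_mul C).mono'
    (hf.continuous.comp (by fun_prop : Continuous fun y => (y, v))).aestronglyMeasurable
    (Filter.Eventually.of_forall fun y => (hC y v).trans ?_)
  exact mul_le_mul_of_nonneg_left (mul_le_of_le_one_right (timeDecay_nonneg y)
    (spaceDecay_le_one v)) hC0

theorem HasDecay.continuous_sliceFourier (hf : HasDecay f) :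
    Continuous fun z : ℝ × (Fin m → ℝ) => sliceFourier f z.1 z.2 := by
  obtain ⟨C, hC0, hC⟩ := hf.bound
  have hc := hf.continuous
  have hcont : Continuous fun w : (ℝ × (Fin m → ℝ)) × ℝ =>
      Complex.exp (-(Complex.I * w.1.1 * w.2)) * f w.2 w.1.2 :=
    (by fun_prop : Continuous fun w : (ℝ × (Fin m → ℝ)) × ℝ =>
      Complex.exp (-(Complex.I * w.1.1 * w.2))).mul
      (hc.comp (by fun_prop : Continuous fun w : (ℝ × (Fin m → ℝ)) × ℝ => (w.2, w.1.2)))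
  refine continuous_of_dominated (F := fun (z : ℝ × (Fin m → ℝ)) (y : ℝ) =>
    Complex.exp (-(Complex.I * z.1 * y)) * f y z.2) (bound := fun y => C * timeDecay y)
    (fun z => ?_) (fun z => ?_) (integrable_timeDecay.const_mul C) (Filter.Eventually.of_forall fun y => ?_)
  · exact (hcont.comp (by fun_prop : Continuous fun y => (z, y))).aestronglyMeasurable
  · refine Filter.Eventually.of_forall fun y => ?_
    rw [norm_mul, norm_exp_neg_I_mul_mul, one_mul]
    exact (hC y z.2).trans (mul_le_mul_of_nonneg_left (mul_le_of_le_one_right (timeDecay_nonneg y)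
      (spaceDecay_le_one _)) hC0)
  · have h : Continuous fun z : ℝ × (Fin m → ℝ) => (z, y) := by fun_prop
    have h' := hcont.comp h
    exact h'

theorem HasDecay.norm_sliceFourier_le (hf : HasDecay f) :
    ∃ C, 0 ≤ C ∧ ∀ p v, ‖sliceFourier f p v‖ ≤ C * spaceDecay v := by
  obtain ⟨C, hC0, hC⟩ := hf.bound
  refine ⟨∫ y, C * timeDecay y,
    integral_nonneg fun y => mul_nonneg hC0 (timeDecay_nonneg y), fun p v => ?_⟩
  rw [← integral_mul_const]
  refine norm_integral_le_of_norm_le ((integrable_timeDecay.const_mul C).mul_const _)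
    (Filter.Eventually.of_forall fun y => ?_)
  rw [norm_mul, norm_exp_neg_I_mul_mul, one_mul, mul_assoc]
  exact hC y v

/-- The integrand of the star product, as a function of momentum, time and space. -/
def starIntegrand (lam : ℝ) (f g : ℝ → (Fin m → ℝ) → ℂ) (w : ℝ × ℝ × (Fin m → ℝ)) : ℂ :=
  Complex.exp (Complex.I * w.1 * w.2.1) * sliceFourier f w.1 w.2.2 *
    g w.2.1 (Real.exp (-(lam * w.1)) • w.2.2)

theorem continuous_starIntegrand (lam : ℝ) (hf : HasDecay f) (hg : HasDecay g) :
    Continuous (starIntegrand lam f g) := by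
  have h1 : Continuous fun w : ℝ × ℝ × (Fin m → ℝ) => Complex.exp (Complex.I * w.1 * w.2.1) := by
    fun_prop
  have h2 : Continuous fun w : ℝ × ℝ × (Fin m → ℝ) => (w.1, w.2.2) := by fun_prop
  have h3 : Continuous fun w : ℝ × ℝ × (Fin m → ℝ) =>
      (w.2.1, Real.exp (-(lam * w.1)) • w.2.2) := by fun_prop
  have h4 := hf.continuous_sliceFourier.comp h2
  have h5 := hg.continuous.comp h3
  exact (h1.mul h4).mul h5

/-- Time decay comes from `g` and space decay from `f`, so the dilation inside `g`, which is not
bounded in `p`, does no harm. -/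
theorem norm_starIntegrand_le (lam : ℝ) (hf : HasDecay f) (hg : HasDecay g) :
    ∃ C, 0 ≤ C ∧ ∀ w, ‖starIntegrand lam f g w‖ ≤ C * (timeDecay w.2.1 * spaceDecay w.2.2) := by
  obtain ⟨C, hC0, hC⟩ := hf.norm_sliceFourier_le
  obtain ⟨D, hD0, hD⟩ := hg.bound
  refine ⟨C * D, mul_nonneg hC0 hD0, fun w => ?_⟩
  rw [starIntegrand, norm_mul, norm_mul, norm_exp_I_mul_mul, one_mul]
  have h1 : ‖g w.2.1 (Real.exp (-(lam * w.1)) • w.2.2)‖ ≤ D * timeDecay w.2.1 :=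
    (hD _ _).trans (mul_le_mul_of_nonneg_left (mul_le_of_le_one_right (timeDecay_nonneg _)
      (spaceDecay_le_one _)) hD0)
  refine (mul_le_mul (hC w.1 w.2.2) h1 (norm_nonneg _)
    (mul_nonneg hC0 (spaceDecay_nonneg _))).trans (le_of_eq ?_)
  ring

/-- Nothing in the estimate decays in the momentum; integrability in `p` rests on the bounded
frequencies of `f`. -/
theorem integrable_starIntegrand (lam : ℝ) (hf : HasDecay f) (hg : HasDecay g) {R : ℝ}
    (hR : ∀ p v, R < |p| → sliceFourier f p v = 0) : Integrable (starIntegrand lam f g) := by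
  obtain ⟨C, hC0, hC⟩ := norm_starIntegrand_le lam hf hg
  have h1 : Integrable ((Set.Icc (-R) R).indicator fun _ : ℝ => C) :=
    (integrable_indicator_iff measurableSet_Icc).2
      (integrableOn_const (by simp [Real.volume_Icc]))
  refine (h1.mul_prod (integrable_timeDecay.mul_prod (integrable_spaceDecay (m := m)))).mono'
    (continuous_starIntegrand lam hf hg).aestronglyMeasurable
    (Filter.Eventually.of_forall fun w => ?_)
  by_cases hw : w.1 ∈ Set.Icc (-R) R
  · rw [Set.indicator_of_mem hw]
    exact hC w
  · have h0 : starIntegrand lam f g w = 0 := by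
      rw [starIntegrand, hR _ _ (by rw [Set.mem_Icc, ← abs_le] at hw; exact not_le.1 hw)]
      simp
    rw [Set.indicator_of_notMem hw, h0]
    simp

/-- The momentum density of the weight of the star product. -/
def density (lam : ℝ) (f g : ℝ → (Fin m → ℝ) → ℂ) (p : ℝ) : ℂ :=
  ∫ v, sliceFourier f p v * sliceFourier g (-p) (Real.exp (-(lam * p)) • v)

/-- Integrating over time first turns `e^{ipy} g(y, ·)` into the Fourier transform of `g` at `-p`.
-/
theorem integral_starIntegrand (lam : ℝ) (hf : HasDecay f) (hg : HasDecay g) (p : ℝ) :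
    ∫ z, starIntegrand lam f g (p, z) = density lam f g p := by
  obtain ⟨C, hC0, hC⟩ := norm_starIntegrand_le lam hf hg
  have hi : Integrable fun z => starIntegrand lam f g (p, z) :=
    ((integrable_timeDecay.mul_prod (integrable_spaceDecay (m := m))).const_mul C).mono'
      ((continuous_starIntegrand lam hf hg).comp
        (by fun_prop : Continuous fun z => (p, z))).aestronglyMeasurable
      (Filter.Eventually.of_forall fun z => hC (p, z))
  rw [Measure.volume_eq_prod, integral_prod_symm _ hi, density]
  refine integral_congr_ae (Filter.Eventually.of_forall fun v => ?_)
  change _ = sliceFourier f p v * ∫ y : ℝ, _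
  rw [← integral_const_mul]
  refine integral_congr_ae (Filter.Eventually.of_forall fun y => ?_)
  simp only [starIntegrand]
  push_cast
  ring_nf

theorem integrable_density (lam : ℝ) (hf : HasDecay f) (hg : HasDecay g) {R : ℝ}
    (hR : ∀ p v, R < |p| → sliceFourier f p v = 0) : Integrable (density lam f g) := by
  refine (integrable_starIntegrand lam hf hg hR).integral_prod_left.congr
    (Filter.Eventually.of_forall fun p => ?_)
  exact integral_starIntegrand lam hf hg p

theorem integral_integral_starIntegrand (lam : ℝ) (hf : HasDecay f) (hg : HasDecay g) {R : ℝ}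
    (hR : ∀ p v, R < |p| → sliceFourier f p v = 0) :
    ∫ z, ∫ p, starIntegrand lam f g (p, z) = ∫ p, density lam f g p := by
  rw [← integral_integral_swap (f := fun p z => starIntegrand lam f g (p, z))
    (integrable_starIntegrand lam hf hg hR)]
  exact integral_congr_ae (Filter.Eventually.of_forall (integral_starIntegrand lam hf hg))

theorem integrable_integral_starIntegrand (lam : ℝ) (hf : HasDecay f) (hg : HasDecay g) {R : ℝ}
    (hR : ∀ p v, R < |p| → sliceFourier f p v = 0) :
    Integrable fun z => ∫ p, starIntegrand lam f g (p, z) :=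
  (integrable_starIntegrand lam hf hg hR).integral_prod_right

/-- The exchange of `f` and `g` is undone by the dilation `v ↦ e^{-lam p} v` of the `m` space
variables, whose Jacobian is the exponential factor. This is where `ω` fails to be a trace. -/
theorem density_neg (lam : ℝ) (f g : ℝ → (Fin m → ℝ) → ℂ) (p : ℝ) :
    density lam g f (-p) = Complex.exp (-(m * lam * p)) * density lam f g p := by
  have h := Measure.integral_comp_smul (volume : Measure (Fin m → ℝ))
    (fun v => sliceFourier g (-p) v * sliceFourier f p (Real.exp (lam * p) • v))
    (Real.exp (-(lam * p)))
  simp only [smul_smul, ← Real.exp_add, add_neg_cancel, Real.exp_zero, one_smul] at h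
  rw [density, density, neg_neg, mul_neg, neg_neg]
  have h2 : ∫ v, sliceFourier f p v * sliceFourier g (-p) (Real.exp (-(lam * p)) • v) =
      ∫ v, sliceFourier g (-p) (Real.exp (-(lam * p)) • v) * sliceFourier f p v := by
    simp only [mul_comm]
  rw [h2, h, abs_of_pos (by positivity), ← Real.exp_nat_mul, ← Real.exp_neg, Module.finrank_fin_fun,
    Complex.real_smul, ← mul_assoc, Complex.ofReal_exp, ← Complex.exp_add]
  push_cast
  ring_nf
  simp

theorem sliceFourier_translate (f : ℝ → (Fin m → ℝ) → ℂ) (c p : ℝ) (v : Fin m → ℝ) :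
    sliceFourier (fun y v => f (y + c) v) p v =
      Complex.exp (Complex.I * p * c) * sliceFourier f p v := by
  rw [sliceFourier, sliceFourier, ← integral_const_mul,
    ← integral_add_right_eq_self (fun y : ℝ => Complex.exp (Complex.I * p * c) *
      (Complex.exp (-(Complex.I * p * y)) * f y v)) c]
  refine integral_congr_ae (Filter.Eventually.of_forall fun y => ?_)
  simp only
  rw [← mul_assoc, ← Complex.exp_add]
  push_cast
  ring_nf

end

/-- A Fourier integral over a bounded interval is an entire function. -/
theorem differentiable_fourier {H : ℝ → ℂ} (hH : Integrable H) {R : ℝ}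
    (hR : ∀ p, R < |p| → H p = 0) (c : ℝ) :
    Differentiable ℂ fun z : ℂ => ∫ p : ℝ, Complex.exp (Complex.I * p * (c * z)) * H p := by
  intro z₀
  have hm : ∀ z : ℂ, AEStronglyMeasurable
      (fun p : ℝ => Complex.exp (Complex.I * p * (c * z)) * H p) := fun z =>
    (by fun_prop : Continuous fun p : ℝ => Complex.exp (Complex.I * p * (c * z))
      ).aestronglyMeasurable.mul hH.1
  have hexp : ∀ (z : ℂ) (p : ℝ), ‖z‖ ≤ ‖z₀‖ + 1 → ‖Complex.exp (Complex.I * p * (c * z)) * H p‖ ≤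
      Real.exp (R * (|c| * (‖z₀‖ + 1))) * ‖H p‖ := by
    intro z p hz
    by_cases hp : R < |p|
    · simp [hR p hp]
    · rw [norm_mul]
      refine mul_le_mul_of_nonneg_right ((Complex.norm_exp_le_exp_norm _).trans
        (Real.exp_le_exp.2 ?_)) (norm_nonneg _)
      simp only [norm_mul, Complex.norm_I, one_mul, Complex.norm_real, Real.norm_eq_abs]
      have h1 := not_lt.1 hp
      have h2 := (abs_nonneg p).trans h1
      gcongr
  refine (hasDerivAt_integral_of_dominated_loc_of_deriv_le (Metric.ball_mem_nhds z₀ one_pos)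
    (F' := fun z p => Complex.I * p * c * (Complex.exp (Complex.I * p * (c * z)) * H p))
    (bound := fun p => R * |c| * (Real.exp (R * (|c| * (‖z₀‖ + 1))) * ‖H p‖))
    (Filter.Eventually.of_forall hm) ?_ ?_ ?_ ?_ ?_).2.differentiableAt
  · exact (hH.norm.const_mul _).mono' (hm z₀)
      (Filter.Eventually.of_forall fun p => hexp z₀ p (by linarith))
  · exact (by fun_prop : Continuous fun p : ℝ => Complex.I * p * c).aestronglyMeasurable.mul (hm z₀)
  · refine Filter.Eventually.of_forall fun p z hz => ?_
    have hz' : ‖z‖ ≤ ‖z₀‖ + 1 := by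
      have h1 : ‖z - z₀‖ < 1 := by simpa [dist_eq_norm] using hz
      linarith [norm_le_norm_add_norm_sub z₀ z, norm_sub_rev z₀ z]
    by_cases hp : R < |p|
    · simp [hR p hp]
    · rw [norm_mul]
      have := not_lt.1 hp
      refine mul_le_mul ?_ (hexp z p hz') (norm_nonneg _)
        (mul_nonneg ((abs_nonneg p).trans this) (abs_nonneg c))
      simp only [norm_mul, Complex.norm_I, one_mul, Complex.norm_real, Real.norm_eq_abs]
      gcongr
  · exact (hH.norm.const_mul _).const_mul _
  · refine Filter.Eventually.of_forall fun p z _ => ?_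
    have h1 : HasDerivAt (fun z : ℂ => Complex.I * p * (c * z)) (Complex.I * p * c) z := by
      have := ((hasDerivAt_id z).const_mul (c : ℂ)).const_mul (Complex.I * p)
      simpa using this
    have := h1.cexp.mul_const (H p)
    exact this.congr_deriv (by ring)

/-- The exponential has modulus `e^{-p c Im z}`, which is bounded for `|p| ≤ R` and `z` in the
strip. -/
theorem norm_fourier_le {H : ℝ → ℂ} (hH : Integrable H) {R : ℝ} (hR : ∀ p, R < |p| → H p = 0)
    (c : ℝ) {z : ℂ} (h0 : 0 ≤ z.im) (h1 : z.im ≤ 1) :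
    ‖∫ p : ℝ, Complex.exp (Complex.I * p * (c * z)) * H p‖ ≤
      ∫ p : ℝ, Real.exp (R * |c|) * ‖H p‖ := by
  refine norm_integral_le_of_norm_le (hH.norm.const_mul _) (Filter.Eventually.of_forall fun p => ?_)
  by_cases hp : R < |p|
  · simp [hR p hp]
  · rw [norm_mul]
    refine mul_le_mul_of_nonneg_right ?_ (norm_nonneg _)
    rw [Complex.norm_exp]
    refine Real.exp_le_exp.2 ?_
    have h2 : (Complex.I * p * (c * z)).re = -(p * c * z.im) := by
      simp
      ring
    rw [h2]
    have h3 : |p * c * z.im| ≤ R * |c| := by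
      rw [abs_mul, abs_mul, abs_of_nonneg h0]
      have := not_lt.1 hp
      calc |p| * |c| * z.im ≤ |p| * |c| * 1 := by gcongr
        _ ≤ R * |c| := by rw [mul_one]; gcongr
    linarith [neg_abs_le (p * c * z.im)]

end Kappa

end

noncomputable section

/-! ### Splitting off the time variable -/

namespace Kappa

open MeasureTheory

section Join

variable {m : ℕ}

/-- The point of space-time with time coordinate `y` and space coordinates `v`. -/
def join (y : ℝ) (v : Fin m → ℝ) : Space (m + 1) := WithLp.toLp 2 (Fin.cons y v)

@[simp] theorem join_zero (y : ℝ) (v : Fin m → ℝ) : join y v 0 = y := rfl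

theorem join_succ (y : ℝ) (v : Fin m → ℝ) (i : Fin m) : join y v i.succ = v i := rfl

theorem point_join (s r y : ℝ) (v : Fin m → ℝ) : point s r (join y v) = join s (r • v) := by
  ext j
  refine Fin.cases ?_ (fun i => ?_) j
  · simp [point]
  · simp [point, join_succ, Fin.succ_ne_zero]

theorem continuous_join : Continuous fun z : ℝ × (Fin m → ℝ) => join z.1 z.2 := by
  unfold join
  fun_prop

variable (m) in
/-- Space-time as the product of time and space. -/
def joinEquiv : ℝ × (Fin m → ℝ) ≃ᵐ Space (m + 1) :=
  (MeasurableEquiv.piFinSuccAbove (fun _ : Fin (m + 1) => ℝ) 0).symm.trans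
    (MeasurableEquiv.toLp 2 (Fin (m + 1) → ℝ))

theorem joinEquiv_apply (z : ℝ × (Fin m → ℝ)) : joinEquiv m z = join z.1 z.2 := by
  ext j
  exact congrFun (Fin.insertNth_zero' z.1 z.2) j

theorem measurePreserving_joinEquiv : MeasurePreserving (joinEquiv m) :=
  (PiLp.volume_preserving_toLp (Fin (m + 1))).comp
    (volume_preserving_piFinSuccAbove (fun _ : Fin (m + 1) => ℝ) 0).symm

theorem integral_join {E : Type*} [NormedAddCommGroup E] [NormedSpace ℝ E] (f : Space (m + 1) → E) :
    ∫ x, f x = ∫ z : ℝ × (Fin m → ℝ), f (join z.1 z.2) := by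
  rw [← measurePreserving_joinEquiv.integral_comp (joinEquiv m).measurableEmbedding]
  simp only [joinEquiv_apply]

theorem integrable_of_join {f : Space (m + 1) → ℂ}
    (h : Integrable fun z : ℝ × (Fin m → ℝ) => f (join z.1 z.2)) : Integrable f := by
  rw [← measurePreserving_joinEquiv.integrable_comp_emb (joinEquiv m).measurableEmbedding]
  exact h.congr (Filter.Eventually.of_forall fun z => congrArg f (joinEquiv_apply z).symm)

theorem abs_le_norm_join (y : ℝ) (v : Fin m → ℝ) : |y| ≤ ‖join y v‖ :=
  PiLp.norm_apply_le (join y v) 0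

theorem norm_le_norm_join (y : ℝ) (v : Fin m → ℝ) : ‖v‖ ≤ ‖join y v‖ :=
  (pi_norm_le_iff_of_nonneg (norm_nonneg _)).2 fun i => PiLp.norm_apply_le (join y v) i.succ

theorem hasDecay_join (f : 𝓢(Space (m + 1), ℂ)) :
    HasDecay fun y (v : Fin m → ℝ) => f (join y v) where
  continuous := f.continuous.comp continuous_join
  bound := by
    -- The exponent `m + 3` provides two powers for the time weight and `m + 1` for the space
    -- weight.
    obtain ⟨C, hC⟩ : ∃ C, ∀ x, (1 + ‖x‖) ^ (m + 3) * ‖f x‖ ≤ C :=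
      ⟨_, fun x => by
        simpa using SchwartzMap.one_add_le_sup_seminorm_apply (𝕜 := ℂ) (m := (m + 3, 0)) le_rfl
          le_rfl f x⟩
    have hC0 : 0 ≤ C := le_trans (by positivity) (hC 0)
    refine ⟨C, hC0, fun y v => ?_⟩
    have h1 := abs_le_norm_join y v
    have h2 := norm_le_norm_join y v
    have h3 : (1 + y ^ 2) * (1 + ‖v‖) ^ (m + 1) ≤ (1 + ‖join y v‖) ^ (m + 3) := by
      have h4 : 1 + y ^ 2 ≤ (1 + ‖join y v‖) ^ 2 := by
        nlinarith [sq_abs y, abs_nonneg y, norm_nonneg (join y v)]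
      calc (1 + y ^ 2) * (1 + ‖v‖) ^ (m + 1)
          ≤ (1 + ‖join y v‖) ^ 2 * (1 + ‖join y v‖) ^ (m + 1) := by gcongr
        _ = _ := by ring
    have h5 : timeDecay y * spaceDecay v = ((1 + y ^ 2) * (1 + ‖v‖) ^ (m + 1))⁻¹ := by
      rw [timeDecay, spaceDecay, Real.rpow_neg (by positivity), mul_inv]
      norm_cast
    rw [h5, ← div_eq_mul_inv, le_div_iff₀ (by positivity), mul_comm]
    exact (mul_le_mul_of_nonneg_right h3 (norm_nonneg _)).trans (hC _)

theorem inner_join (q y : ℝ) (w v : Fin m → ℝ) :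
    inner ℝ (join q w) (join y v) = q * y + ∑ i, w i * v i := by
  simp [PiLp.inner_apply, Fin.sum_univ_succ, join_succ, mul_comm]

/-- The partial Fourier transform in the space variables. -/
def spaceFourier (φ : ℝ → (Fin m → ℝ) → ℂ) (v : Fin m → ℝ) (q : ℝ) : ℂ :=
  ∫ w, Complex.exp (((-2 * Real.pi * ∑ i, w i * v i : ℝ) : ℂ) * Complex.I) * φ q w

theorem continuous_spaceFourier {φ : ℝ → (Fin m → ℝ) → ℂ} (hφ : HasDecay φ) (v : Fin m → ℝ) :
    Continuous (spaceFourier φ v) := by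
  obtain ⟨C, hC0, hC⟩ := hφ.bound
  have hcont : Continuous fun z : ℝ × (Fin m → ℝ) =>
      Complex.exp (((-2 * Real.pi * ∑ i, z.2 i * v i : ℝ) : ℂ) * Complex.I) * φ z.1 z.2 :=
    (by fun_prop : Continuous fun z : ℝ × (Fin m → ℝ) =>
      Complex.exp (((-2 * Real.pi * ∑ i, z.2 i * v i : ℝ) : ℂ) * Complex.I)).mul hφ.continuous
  refine continuous_of_dominated (F := fun (q : ℝ) (w : Fin m → ℝ) =>
    Complex.exp (((-2 * Real.pi * ∑ i, w i * v i : ℝ) : ℂ) * Complex.I) * φ q w)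
    (bound := fun w => C * spaceDecay w) (fun q => ?_) (fun q => ?_)
    (integrable_spaceDecay.const_mul C) (Filter.Eventually.of_forall fun w => ?_)
  · have h : Continuous fun w : Fin m → ℝ => (q, w) := by fun_prop
    exact (hcont.comp h).aestronglyMeasurable
  · refine Filter.Eventually.of_forall fun w => ?_
    rw [norm_mul, Complex.norm_exp_ofReal_mul_I, one_mul]
    exact (hC q w).trans (mul_le_mul_of_nonneg_left (mul_le_of_le_one_left (spaceDecay_nonneg w)
      (timeDecay_le_one q)) hC0)
  · have h : Continuous fun q : ℝ => (q, w) := by fun_prop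
    have h' := hcont.comp h
    exact h'

/-- By Fubini the full Fourier transform is the space transform followed by the time transform.
Support in the time variable can therefore be examined one space point at a time. -/
theorem fourier_spaceFourier (φ : 𝓢(Space (m + 1), ℂ)) (v : Fin m → ℝ) :
    Integrable (spaceFourier (fun q w => φ (join q w)) v) ∧
      𝓕 (spaceFourier (fun q w => φ (join q w)) v) = fun y => 𝓕 φ (join y v) := by
  have hφ := hasDecay_join φ
  have hi : ∀ y : ℝ, Integrable fun z : ℝ × (Fin m → ℝ) =>
      Complex.exp (((-2 * Real.pi * z.1 * y : ℝ) : ℂ) * Complex.I) *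
      (Complex.exp (((-2 * Real.pi * ∑ i, z.2 i * v i : ℝ) : ℂ) * Complex.I) *
        φ (join z.1 z.2)) := by
    intro y
    refine hφ.integrable.norm.mono' ?_ (Filter.Eventually.of_forall fun z => ?_)
    · exact ((by fun_prop : Continuous fun z : ℝ × (Fin m → ℝ) =>
        Complex.exp (((-2 * Real.pi * z.1 * y : ℝ) : ℂ) * Complex.I)).mul
        ((by fun_prop : Continuous fun z : ℝ × (Fin m → ℝ) =>
        Complex.exp (((-2 * Real.pi * ∑ i, z.2 i * v i : ℝ) : ℂ) * Complex.I)).mul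
        hφ.continuous)).aestronglyMeasurable
    · rw [norm_mul, norm_mul, Complex.norm_exp_ofReal_mul_I, Complex.norm_exp_ofReal_mul_I, one_mul,
        one_mul]
  refine ⟨?_, ?_⟩
  · have h := (hi 0).integral_prod_left
    refine h.congr (Filter.Eventually.of_forall fun q => ?_)
    simp [spaceFourier]
  · funext y
    rw [Real.fourier_real_eq_integral_exp_smul, SchwartzMap.fourier_coe, Real.fourier_eq',
      integral_join, Measure.volume_eq_prod]
    have h1 : ∀ z : ℝ × (Fin m → ℝ),
        Complex.exp (((-2 * Real.pi * inner ℝ (join z.1 z.2) (join y v) : ℝ) : ℂ) * Complex.I) •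
          φ (join z.1 z.2) = Complex.exp (((-2 * Real.pi * z.1 * y : ℝ) : ℂ) * Complex.I) *
        (Complex.exp (((-2 * Real.pi * ∑ i, z.2 i * v i : ℝ) : ℂ) * Complex.I) *
          φ (join z.1 z.2)) := by
      intro z
      rw [inner_join, smul_eq_mul, ← mul_assoc, ← Complex.exp_add, ← add_mul, ← Complex.ofReal_add]
      ring_nf
    simp only [h1]
    rw [integral_prod _ (hi y)]
    refine integral_congr_ae (Filter.Eventually.of_forall fun q => ?_)
    simp only [smul_eq_mul]
    rw [integral_const_mul]
    rfl

/-- The functions of the function algebra have bounded frequencies in the time variable. -/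
theorem exists_sliceFourier_eq_zero {f : 𝓢(Space (m + 1), ℂ)} (hf : f ∈ alg (m + 1)) :
    ∃ R : ℝ, ∀ (p : ℝ) (v : Fin m → ℝ), R < |p| →
      sliceFourier (fun y v => f (join y v)) p v = 0 := by
  obtain ⟨φ, ⟨K, hK, hφ⟩, rfl⟩ := mem_alg_iff.1 hf
  obtain ⟨R, hR⟩ := hK.isBounded.exists_norm_le
  -- The factor `2π` converts between the kernels `e^{-ipy}` and `e^{-2πiqy}`. Fourier inversion in
  -- time then identifies the slice transform at `p` with `spaceFourier` at `-p / 2π`, which is zero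
  -- outside the support.
  refine ⟨2 * Real.pi * R, fun p v hp => ?_⟩
  obtain ⟨h1, h2⟩ := fourier_spaceFourier φ v
  have h3 := (continuous_spaceFourier (hasDecay_join φ) v).fourierInv_fourier_eq h1 (by
    rw [h2]
    exact (hasDecay_join (𝓕 φ)).integrable_slice v)
  have h4 := congrFun h3 (-(p / (2 * Real.pi)))
  rw [h2, Real.fourierInv_eq'] at h4
  have h5 : spaceFourier (fun q w => φ (join q w)) v (-(p / (2 * Real.pi))) = 0 := by
    have h6 : ∀ w : Fin m → ℝ, φ (join (-(p / (2 * Real.pi))) w) = 0 := by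
      intro w
      by_contra h0
      have h7 := hR _ (hφ _ h0)
      rw [join_zero, norm_neg, norm_div, Real.norm_eq_abs, Real.norm_of_nonneg (by positivity),
        div_le_iff₀ (by positivity)] at h7
      linarith
    simp [spaceFourier, h6]
  rw [h5] at h4
  rw [sliceFourier, ← h4]
  refine integral_congr_ae (Filter.Eventually.of_forall fun y => ?_)
  have h8 : ((2 * Real.pi * inner ℝ y (-(p / (2 * Real.pi))) : ℝ) : ℂ) * Complex.I =
      -(Complex.I * p * y) := by
    have h9 : 2 * Real.pi * inner ℝ y (-(p / (2 * Real.pi))) = -(p * y) := by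
      have := Real.pi_ne_zero
      simp only [RCLike.inner_apply, conj_trivial]
      field_simp
    rw [h9]
    push_cast
    ring
  simp only [h8, smul_eq_mul]

theorem timeFourier_join (f : Space (m + 1) → ℂ) (p y : ℝ) (v : Fin m → ℝ) :
    timeFourier f p (join y v) = sliceFourier (fun y v => f (join y v)) p v := by
  simp only [timeFourier, sliceFourier, point_join, one_smul]

theorem starMul_join (lam : ℝ) (f g : Space (m + 1) → ℂ) (y : ℝ) (v : Fin m → ℝ) :
    starMul lam f g (join y v) = (2 * Real.pi : ℂ)⁻¹ * ∫ p, starIntegrand lam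
      (fun y v => f (join y v)) (fun y v => g (join y v)) (p, y, v) := by
  simp only [starMul, starIntegrand, timeFourier_join, point_join, join_zero]

theorem integrable_starMul (lam : ℝ) {f g : 𝓢(Space (m + 1), ℂ)} (hf : f ∈ alg (m + 1)) :
    Integrable (starMul lam f g) := by
  obtain ⟨R, hR⟩ := exists_sliceFourier_eq_zero hf
  refine integrable_of_join ?_
  simp only [starMul_join]
  exact (integrable_integral_starIntegrand lam (hasDecay_join f) (hasDecay_join g) hR).const_mul _

theorem weight_starMul (lam : ℝ) {f g : 𝓢(Space (m + 1), ℂ)} (hf : f ∈ alg (m + 1)) :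
    weight (starMul lam f g) = (2 * Real.pi : ℂ)⁻¹ * ∫ p, density lam
      (fun y (v : Fin m → ℝ) => f (join y v)) (fun y v => g (join y v)) p := by
  obtain ⟨R, hR⟩ := exists_sliceFourier_eq_zero hf
  rw [weight, integral_join]
  simp only [starMul_join]
  rw [integral_const_mul, integral_integral_starIntegrand lam (hasDecay_join f) (hasDecay_join g) hR]

theorem join_add_smul_single (y c : ℝ) (v : Fin m → ℝ) :
    join y v + c • EuclideanSpace.single 0 1 = join (y + c) v := by
  ext j
  refine Fin.cases ?_ (fun i => ?_) j
  · simp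
  · simp [join_succ, Fin.succ_ne_zero]

theorem timeShift_join (c : ℝ) (f : 𝓢(Space (m + 1), ℂ)) (y : ℝ) (v : Fin m → ℝ) :
    timeShift (m + 1) c f (join y v) = f (join (y + c) v) := by
  rw [timeShift_apply, join_add_smul_single]

/-- The KMS condition for time translations. -/
theorem exists_kms (lam : ℝ) {f g : 𝓢(Space (m + 1), ℂ)} (hf : f ∈ alg (m + 1))
    (hg : g ∈ alg (m + 1)) : ∃ F : ℂ → ℂ, Differentiable ℂ F ∧
      (∃ C : ℝ, ∀ z : ℂ, 0 ≤ z.im → z.im ≤ 1 → ‖F z‖ ≤ C) ∧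
      (∀ t : ℝ, F t = weight (starMul lam (timeShift (m + 1) (m * lam * t) f) g)) ∧
      (∀ t : ℝ, F (t + Complex.I) =
        weight (starMul lam g (timeShift (m + 1) (m * lam * t) f))) := by
  obtain ⟨R, hR⟩ := exists_sliceFourier_eq_zero hf
  set f' : ℝ → (Fin m → ℝ) → ℂ := fun y v => f (join y v)
  set g' : ℝ → (Fin m → ℝ) → ℂ := fun y v => g (join y v)
  have hH : Integrable (density lam f' g') :=
    integrable_density lam (hasDecay_join f) (hasDecay_join g) hR
  have hH0 : ∀ p, R < |p| → density lam f' g' p = 0 := fun p hp => by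
    simp [density, hR p _ hp]
  have hshift : ∀ (c p : ℝ) (v : Fin m → ℝ),
      sliceFourier (fun y v => timeShift (m + 1) c f (join y v)) p v =
        Complex.exp (Complex.I * p * c) * sliceFourier f' p v := by
    intro c p v
    simp only [timeShift_join]
    exact sliceFourier_translate f' c p v
  have hdens : ∀ c p : ℝ, density lam (fun y v => timeShift (m + 1) c f (join y v)) g' p =
      Complex.exp (Complex.I * p * c) * density lam f' g' p := by
    intro c p
    simp only [density, hshift, mul_assoc]
    rw [integral_const_mul]
  -- The function on the strip is the weight with the translation parameter made complex. Bounded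
  -- support of the density makes it entire.
  refine ⟨fun z => (2 * Real.pi : ℂ)⁻¹ *
    ∫ p : ℝ, Complex.exp (Complex.I * p * (((m * lam : ℝ) : ℂ) * z)) * density lam f' g' p,
    (differentiable_fourier hH hH0 _).const_mul _, ⟨‖(2 * Real.pi : ℂ)⁻¹‖ *
    ∫ p : ℝ, Real.exp (R * |m * lam|) * ‖density lam f' g' p‖, fun z h0 h1 => ?_⟩,
    fun t => ?_, fun t => ?_⟩
  · rw [norm_mul]
    exact mul_le_mul_of_nonneg_left (norm_fourier_le hH hH0 _ h0 h1) (norm_nonneg _)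
  · rw [weight_starMul lam (timeShift_mem_alg hf _)]
    refine congrArg ((2 * Real.pi : ℂ)⁻¹ * ·)
      (integral_congr_ae (Filter.Eventually.of_forall fun p => ?_))
    refine Eq.trans ?_ (hdens (m * lam * t) p).symm
    push_cast
    ring_nf
  -- After `p ↦ -p` the density of `g ⋆ f` is `e^{-m lam p}` times that of `f ⋆ g`; the same factor
  -- arises from `e^{i p m lam z}` at `z = t + i`.
  · rw [weight_starMul lam hg, ← integral_neg_eq_self]
    refine congrArg ((2 * Real.pi : ℂ)⁻¹ * ·)
      (integral_congr_ae (Filter.Eventually.of_forall fun p => ?_))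
    simp only
    rw [density_neg]
    refine Eq.trans ?_ (congrArg (Complex.exp (-(m * lam * p)) * ·) (hdens (m * lam * t) p)).symm
    rw [← mul_assoc (Complex.exp _) (Complex.exp _), ← Complex.exp_add]
    congr 2
    push_cast
    linear_combination ((m : ℂ) * lam * p) * Complex.I_mul_I

end Join

/-! ### The modular group -/

section ModularGroup

variable {n : ℕ} [NeZero n]

theorem point_add_smul_single (s r c : ℝ) (x : Space n) :
    point s r x + c • EuclideanSpace.single 0 1 = point (s + c) r x := by
  ext j
  by_cases hj : j = 0
  · subst hj
    simp [point]
  · simp [point, hj]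

theorem point_of_add_smul_single (s r c : ℝ) (x : Space n) :
    point s r (x + c • EuclideanSpace.single 0 1) = point s r x := by
  ext j
  by_cases hj : j = 0
  · subst hj
    simp [point]
  · simp [point, hj]

theorem timeFourier_comp_add (f : Space n → ℂ) (c p : ℝ) (x : Space n) :
    timeFourier (fun x => f (x + c • EuclideanSpace.single 0 1)) p x =
      Complex.exp (Complex.I * p * c) * timeFourier f p x := by
  simp only [timeFourier, point_add_smul_single]
  rw [← integral_const_mul, ← integral_add_right_eq_self (fun y : ℝ =>
    Complex.exp (Complex.I * p * c) * (Complex.exp (-(Complex.I * p * y)) * f (point y 1 x))) c]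
  refine integral_congr_ae (Filter.Eventually.of_forall fun y => ?_)
  simp only
  rw [← mul_assoc, ← Complex.exp_add]
  push_cast
  ring_nf

theorem timeFourier_of_add_smul_single (f : Space n → ℂ) (c p : ℝ) (x : Space n) :
    timeFourier f p (x + c • EuclideanSpace.single 0 1) = timeFourier f p x := by
  simp only [timeFourier, point_of_add_smul_single]

theorem starMul_comp_add (lam : ℝ) (f g : Space n → ℂ) (c : ℝ) (x : Space n) :
    starMul lam f g (x + c • EuclideanSpace.single 0 1) =
      starMul lam (fun x => f (x + c • EuclideanSpace.single 0 1))
        (fun x => g (x + c • EuclideanSpace.single 0 1)) x := by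
  simp only [starMul, timeFourier_comp_add, timeFourier_of_add_smul_single,
    point_of_add_smul_single, point_add_smul_single]
  have h : (x + c • EuclideanSpace.single 0 1 : Space n) 0 = x 0 + c := by simp
  rw [h]
  congr 1
  refine integral_congr_ae (Filter.Eventually.of_forall fun p => ?_)
  simp only
  rw [← mul_assoc, ← Complex.exp_add]
  push_cast
  ring_nf

/-- The time Fourier transform turns the translation into the phase `e^{ipc}`, which is also what
replacing `x₀` by `x₀ + c` does to the outer exponential. -/
theorem starInv_comp_add (lam : ℝ) (f : Space n → ℂ) (c : ℝ) (x : Space n) :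
    starInv lam f (x + c • EuclideanSpace.single 0 1) =
      starInv lam (fun x => f (x + c • EuclideanSpace.single 0 1)) x := by
  have h1 : ∀ (p : ℝ) (y : Space n),
      timeFourier (fun y => conj (f (y + c • EuclideanSpace.single 0 1))) p y =
        Complex.exp (Complex.I * p * c) * timeFourier (fun y => conj (f y)) p y := fun p y =>
    timeFourier_comp_add (fun y => conj (f y)) c p y
  have h2 : ∀ (p s r : ℝ), timeFourier (fun y => conj (f y)) p (point (s + c) r x) =
      timeFourier (fun y => conj (f y)) p (point s r x) := by
    intro p s r
    rw [← point_add_smul_single, timeFourier_of_add_smul_single]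
  have h : (x + c • EuclideanSpace.single 0 1 : Space n) 0 = x 0 + c := by simp
  simp only [starInv, h1, h, h2, point_of_add_smul_single]
  congr 1
  refine integral_congr_ae (Filter.Eventually.of_forall fun p => ?_)
  simp only
  rw [← mul_assoc, ← Complex.exp_add]
  push_cast
  ring_nf

theorem isModularGroup (lam : ℝ) : IsModularGroup lam (modularGroup (n := n) lam) where
  map_mem t f hf := ⟨modularGroupSchwartz lam t f, timeShift_mem_alg hf _,
    (modularGroupSchwartz_coe lam t f).symm⟩
  map_zero f _ := by
    funext x
    simp [modularGroup]
  map_add s t f _ := by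
    funext x
    change f _ = f _
    congr 1
    rw [add_assoc, ← add_smul]
    congr 2
    ring
  map_mul t f _ g _ := funext fun x => starMul_comp_add lam f g _ x
  map_inv t f _ := funext fun x => starInv_comp_add lam f _ x
  invariant t f _ := integral_add_right_eq_self (fun x => f x) _
  integrable f hf g _ := by
    obtain ⟨m, rfl⟩ : ∃ m, n = m + 1 := ⟨n - 1, by have := NeZero.ne n; omega⟩
    exact integrable_starMul lam hf
  kms f hf g hg := by
    obtain ⟨m, rfl⟩ : ∃ m, n = m + 1 := ⟨n - 1, by have := NeZero.ne n; omega⟩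
    obtain ⟨F, h1, h2, h3, h4⟩ := exists_kms lam hf hg
    have h5 : ∀ t : ℝ, modularGroup (n := m + 1) lam t f = timeShift (m + 1) (m * lam * t) f := by
      intro t
      funext x
      have h6 : t * (((m + 1 : ℕ) : ℝ) - 1) * lam = m * lam * t := by push_cast; ring
      rw [timeShift_apply, ← h6]
      rfl
    refine ⟨F, h1.continuous.continuousOn, h1.differentiableOn, h2, fun t => ?_, fun t => ?_⟩
    · rw [h5]
      exact h3 t
    · rw [h5]
      exact h4 t

end ModularGroup

end Kappa

end

theorem mainTheorem1 (n : ℕ) [NeZero n] (lam : ℝ) :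
    Hochschild.twistedDim ℂ (Kappa.Env n lam) = ((n : ℕ∞) : WithBot ℕ∞) ∧
    (∀ σ : Kappa.Env n lam ≃ₐ[ℂ] Kappa.Env n lam,
      Nontrivial (Hochschild.TwistedHomology σ n) ↔
        ∃ a : {j : Fin n // j ≠ 0} → ℕ,
          σ = Kappa.shift n lam (-(lam * ((n : ℂ) - 1 + ∑ j, (a j : ℂ))))) ∧
    Kappa.IsModularGroup lam (Kappa.modularGroup (n := n) lam) ∧
    (∃! α : ℂ → Kappa.Env n lam ≃ₐ[ℂ] Kappa.Env n lam, Kappa.IsModularExtension α) ∧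
    (∀ α : ℂ → Kappa.Env n lam ≃ₐ[ℂ] Kappa.Env n lam, Kappa.IsModularExtension α →
      Kappa.shift n lam (-(lam * ((n : ℂ) - 1))) = (α Complex.I).symm) :=
  ⟨Kappa.twistedDim_eq, Kappa.nontrivial_twistedHomology_iff, Kappa.isModularGroup lam,
    Kappa.existsUnique_isModularExtension, fun _ hα => hα.symm_apply_I⟩
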